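/- Let $k$ be a field and let $H$ be a cocommutative Hopf algebra over $k$ with antipode $S$. For a right $H$-comodule algebra $A$ with coaction $\rho(a)=a_{[0]}\otimes a_{[1]}$ (all algebras are associative and unital, $\otimes=\otimes_k$) and with subalgebra of coinvariants $B=A^{\mathrm{co}H}=\{a\in A : \rho(a)=a\otimes 1\}$, say that $A$ is a *faithfully flat $H$-Galois extension of $B$* if the canonical map $$\mathrm{can}_A:\ A\otimes_B A\to A\otimes H,\qquad a\otimes_B b\mapsto a\,b_{[0]}\otimes b_{[1]},$$ is bijective and $A$ is faithfully flat as a left $B$-module. In that case put $\gamma_A(h)=\mathrm{can}_A^{-1}(1\otimes h)=\sum_i l_i(h)\otimes_B r_i(h)\in A\otimes_B A$ for $h\in H$ (the translation map). Let $A$ be a faithfully flat $H$-Galois extension of $B=A^{\mathrm{co}H}$. Regard $A^{\mathrm{op}}$ as a right $H$-comodule algebra with coaction $a\mapsto a_{[0]}\otimes S(a_{[1]})$, and put $A^e=A\otimes A^{\mathrm{op}}$ and $B^e=B\otimes B^{\mathrm{op}}$. Let $A^{\square e}=A\,\square_H A^{\mathrm{op}}$ be the subalgebra of $A^e$ of all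 elements $\sum_i a_i\otimes a_i'$ with $$\sum_i a_{i[0]}\otimes a_i'\otimes a_{i[1]}=\sum_i a_i\otimes a'_{i[0]}\otimes S(a'_{i[1]}),$$ which is a right $H$-comodule algebra with coaction given by either side of this equation. Then $B^e$, embedded in $A^e$ in the natural way, is the subalgebra of coinvariants of $A^{\square e}$, and $A^{\square e}$ is a faithfully flat $H$-Galois extension of $B^e$. Moreover, the map $A^{\square e}\otimes_{B^e}A^{\square e}\to A^e\otimes_{B^e}A^e$ induced by the inclusion $A^{\square e}\subseteq A^e$ is injective, and if $A^{\square e}\otimes_{B^e}A^{\square e}$ is regarded as a subspace of $A^e\otimes_{B^e}A^e$ through it, then for every $h\in H$ $$\gamma_{A^{\square e}}(h)=\sum_{i,j}\bigl(l_i(h_{(1)})\otimes r_j(h_{(2)})\bigr)\otimes_{B^e}\bigl(r_i(h_{(1)})\otimes l_j(h_{(2)})\bigr);$$ in particular, the right-hand side belongs to $A^{\square e}\otimes_{B^e}A^{\square e}$. -/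

import Mathlib

open scoped TensorProduct

noncomputable section

namespace HopfGalois

universe u v w w' x

/-! ### Tensor products over a (noncommutative) ring -/

section Balanced

variable (k : Type*) [CommRing k] {R M N M' N' : Type*}
  [AddCommGroup M] [Module k M] [AddCommGroup N] [Module k N]
  [AddCommGroup M'] [Module k M'] [AddCommGroup N'] [Module k N']

/-- The subspace of `M ⊗[k] N` spanned by all `m·r ⊗ n - m ⊗ r·n`, where `right` is the right
action of `R` on `M` and `left` is the left action of `R` on `N`. -/
def balancedRel (right : M → R → M) (left : R → N → N) : Submodule k (M ⊗[k] N) :=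
  Submodule.span k {t | ∃ (m : M) (r : R) (n : N), t = right m r ⊗ₜ[k] n - m ⊗ₜ[k] left r n}

/-- The tensor product `M ⊗_R N` over a `k`-algebra `R` of a right `R`-module `M` and a left
`R`-module `N`, with the two actions given explicitly. -/
abbrev BalancedTensor (right : M → R → M) (left : R → N → N) : Type _ :=
  (M ⊗[k] N) ⧸ balancedRel k right left

variable {k}

/-- The map `f ⊗_R g` induced by `k`-linear maps `f`, `g` that respect the actions of `R`. -/
def BalancedTensor.map {right : M → R → M} {left : R → N → N}
    {right' : M' → R → M'} {left' : R → N' → N'}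
    (f : M →ₗ[k] M') (g : N →ₗ[k] N')
    (hf : ∀ m r, f (right m r) = right' (f m) r) (hg : ∀ r n, g (left r n) = left' r (g n)) :
    BalancedTensor k right left →ₗ[k] BalancedTensor k right' left' :=
  Submodule.mapQ _ _ (TensorProduct.map f g) <| by
    refine Submodule.span_le.2 ?_
    rintro _ ⟨m, r, n, rfl⟩
    refine Submodule.subset_span ⟨f m, r, g n, ?_⟩
    simp [hf, hg]

end Balanced

section AlongAlgHom

variable {k : Type u} [CommRing k] {R : Type x} [Ring R] [Algebra k R]
  {A : Type w} [Ring A] [Algebra k A]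

/-- `M ⊗_R A`, for a right `R`-module `M` and an algebra map `ι : R → A`, through which `A` is a
left `R`-module. -/
abbrev TensorAlong (ι : R →ₐ[k] A) (M : Type*) [AddCommGroup M] [Module k M] [Module Rᵐᵒᵖ M] :
    Type _ :=
  BalancedTensor k (fun (m : M) (r : R) ↦ MulOpposite.op r • m) (fun (r : R) (a : A) ↦ ι r * a)

/-- `A ⊗_R A`, for an algebra map `ι : R → A`, through which `A` is an `R`-bimodule. -/
abbrev SelfTensor (ι : R →ₐ[k] A) : Type _ :=
  BalancedTensor k (fun (a : A) (r : R) ↦ a * ι r) (fun (r : R) (a : A) ↦ ι r * a)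

/-- `f ⊗_R A : M ⊗_R A → N ⊗_R A` for a map `f : M → N` of right `R`-modules. -/
def TensorAlong.map (ι : R →ₐ[k] A) {M N : Type*}
    [AddCommGroup M] [Module k M] [Module Rᵐᵒᵖ M] [IsScalarTower k Rᵐᵒᵖ M]
    [AddCommGroup N] [Module k N] [Module Rᵐᵒᵖ N] [IsScalarTower k Rᵐᵒᵖ N]
    (f : M →ₗ[Rᵐᵒᵖ] N) : TensorAlong ι M →ₗ[k] TensorAlong ι N :=
  BalancedTensor.map (f.restrictScalars k) LinearMap.id (fun _ _ ↦ by simp) (fun _ _ ↦ rfl)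

/-- The map `j ⊗_R j : A ⊗_R A → A' ⊗_R A'` induced by an algebra map `j : A → A'`, where `A'` is
an `R`-bimodule through `ι' = j ∘ ι`. -/
def SelfTensor.map {A' : Type*} [Ring A'] [Algebra k A'] (ι : R →ₐ[k] A) (ι' : R →ₐ[k] A')
    (j : A →ₐ[k] A') (hj : j.comp ι = ι') : SelfTensor ι →ₗ[k] SelfTensor ι' :=
  BalancedTensor.map j.toLinearMap j.toLinearMap
    (fun _ _ ↦ by simp [← hj]) (fun _ _ ↦ by simp [← hj])

end AlongAlgHom

/-- `A`, as a left module over `R` through `ι : R → A`, is faithfully flat: the functor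
`- ⊗_R A` on right `R`-modules is exact (it is always right exact, so it suffices that it
preserves injective maps) and sends only the zero module to zero.
A right `R`-module is a module over `Rᵐᵒᵖ`; its `k`-vector space structure is the restriction
along `k → R`. The universe `m` of the modules is to be at least that of `R`. -/
structure IsLeftFaithfullyFlat.{m, u₁, x₁, w₁} {k : Type u₁} [CommRing k] {R : Type x₁} [Ring R]
    [Algebra k R] {A : Type w₁} [Ring A] [Algebra k A] (ι : R →ₐ[k] A) : Prop where
  flat : ∀ (M N : Type m)
    [AddCommGroup M] [Module k M] [Module Rᵐᵒᵖ M] [IsScalarTower k Rᵐᵒᵖ M]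
    [AddCommGroup N] [Module k N] [Module Rᵐᵒᵖ N] [IsScalarTower k Rᵐᵒᵖ N]
    (f : M →ₗ[Rᵐᵒᵖ] N), Function.Injective f → Function.Injective (TensorAlong.map ι f)
  faithful : ∀ (M : Type m)
    [AddCommGroup M] [Module k M] [Module Rᵐᵒᵖ M] [IsScalarTower k Rᵐᵒᵖ M],
    Subsingleton (TensorAlong ι M) → Subsingleton M

/-! ### Comodule algebras -/

section ComoduleAlgebra

variable (k : Type u) [Field k] (H : Type v) [Ring H] [HopfAlgebra k H]

/-- The structure of a right `H`-comodule algebra on the `k`-algebra `A`. -/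
structure ComoduleAlgebra (A : Type w) [Ring A] [Algebra k A] where
  /-- The coaction `ρ(a) = a₀ ⊗ a₁`. -/
  coact : A →ₐ[k] A ⊗[k] H
  coassoc : (Algebra.TensorProduct.assoc k k k A H H).toAlgHom.comp
      ((Algebra.TensorProduct.map coact (AlgHom.id k H)).comp coact) =
    (Algebra.TensorProduct.map (AlgHom.id k A) (Bialgebra.comulAlgHom k H)).comp coact
  counit : (Algebra.TensorProduct.rid k k A).toAlgHom.comp
      ((Algebra.TensorProduct.map (AlgHom.id k A) (Bialgebra.counitAlgHom k H)).comp coact) =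
    AlgHom.id k A

variable {k H}

namespace ComoduleAlgebra

variable {A : Type w} [Ring A] [Algebra k A] (ρ : ComoduleAlgebra k H A)

/-- The subalgebra `A^{co H}` of all `a` with `ρ(a) = a ⊗ 1`. -/
def coinvariants : Subalgebra k A :=
  AlgHom.equalizer ρ.coact Algebra.TensorProduct.includeLeft

/-- The canonical map `can : A ⊗_R A → A ⊗ H`, `a ⊗ b ↦ a b₀ ⊗ b₁`, where `ι : R → A` takes
values in the coinvariants. -/
def can {R : Type x} [Ring R] [Algebra k R] (ι : R →ₐ[k] A) (hι : ι.range ≤ ρ.coinvariants) :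
    SelfTensor ι →ₗ[k] A ⊗[k] H :=
  Submodule.liftQ _ (LinearMap.mul' k (A ⊗[k] H) ∘ₗ
      TensorProduct.map (Algebra.TensorProduct.includeLeft : A →ₐ[k] A ⊗[k] H).toLinearMap
        ρ.coact.toLinearMap) <| by
    refine Submodule.span_le.2 ?_
    rintro _ ⟨a, r, b, rfl⟩
    have h : ρ.coact (ι r) = ι r ⊗ₜ[k] 1 := hι ⟨r, rfl⟩
    simp [h, ← mul_assoc]

/-- `A` is a faithfully flat `H`-Galois extension of `R`, where `R` is embedded in `A` by `ι`:
`ι` identifies `R` with `A^{co H}`, the canonical map `can` is an isomorphism, and `A` is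
faithfully flat as a left `R`-module. -/
structure IsFaithfullyFlatGalois {R : Type x} [Ring R] [Algebra k R] (ι : R →ₐ[k] A) : Prop where
  injective : Function.Injective ι
  range_eq : ι.range = ρ.coinvariants
  can_bijective : Function.Bijective (ρ.can ι range_eq.le)
  faithfullyFlat : IsLeftFaithfullyFlat.{max u v w x} ι

/-- The translation map `γ_A = can⁻¹ ∘ (η_A ⊗ H) : H → A ⊗_R A`. -/
def IsFaithfullyFlatGalois.translation {ρ : ComoduleAlgebra k H A} {R : Type x} [Ring R]
    [Algebra k R] {ι : R →ₐ[k] A} (hA : ρ.IsFaithfullyFlatGalois ι) : H →ₗ[k] SelfTensor ι :=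
  (LinearEquiv.ofBijective _ hA.can_bijective).symm.toLinearMap ∘ₗ
    (Algebra.TensorProduct.includeRight : H →ₐ[k] A ⊗[k] H).toLinearMap

/-- A right `H`-coaction commutes with the comultiplication, elementwise. -/
theorem coassoc_apply (a : A) :
    Algebra.TensorProduct.map ρ.coact (AlgHom.id k H) (ρ.coact a) =
      (Algebra.TensorProduct.assoc k k k A H H).symm
        (Algebra.TensorProduct.map (AlgHom.id k A) (Bialgebra.comulAlgHom k H) (ρ.coact a)) := by
  rw [AlgEquiv.eq_symm_apply]
  exact congr($(ρ.coassoc) a)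

theorem map_subtype_injective (S : Subalgebra k A) (X : Type*) [Ring X] [Algebra k X] :
    Function.Injective (Algebra.TensorProduct.map S.val (AlgHom.id k X)) :=
  Module.Flat.rTensor_preserves_injective_linearMap (M := X) S.val.toLinearMap
    Subtype.val_injective

theorem coact_mem_range (ρ₁ ρ₂ : ComoduleAlgebra k H A)
    (a : AlgHom.equalizer ρ₁.coact ρ₂.coact) :
    ρ₁.coact a ∈ (Algebra.TensorProduct.map (AlgHom.equalizer ρ₁.coact ρ₂.coact).val
      (AlgHom.id k H)).range := by
  obtain ⟨a, ha⟩ := a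
  have ha : ρ₁.coact a = ρ₂.coact a := ha
  have hex : Function.Exact (AlgHom.equalizer ρ₁.coact ρ₂.coact).val.toLinearMap
      (ρ₁.coact.toLinearMap - ρ₂.coact.toLinearMap) := by
    intro x
    simp only [LinearMap.sub_apply, sub_eq_zero]
    exact ⟨fun h ↦ ⟨⟨x, h⟩, rfl⟩, by rintro ⟨y, rfl⟩; exact y.2⟩
  refine (Module.Flat.rTensor_exact (M := H) hex (ρ₁.coact a)).1 ?_
  rw [LinearMap.rTensor_sub, LinearMap.sub_apply, sub_eq_zero]
  change Algebra.TensorProduct.map ρ₁.coact (AlgHom.id k H) (ρ₁.coact a) =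
    Algebra.TensorProduct.map ρ₂.coact (AlgHom.id k H) (ρ₁.coact a)
  conv_rhs => rw [ha]
  rw [coassoc_apply, coassoc_apply, ha]

/-- The coaction on the subalgebra on which two coactions agree. -/
def equalizerCoact (ρ₁ ρ₂ : ComoduleAlgebra k H A) :
    AlgHom.equalizer ρ₁.coact ρ₂.coact →ₐ[k] AlgHom.equalizer ρ₁.coact ρ₂.coact ⊗[k] H :=
  (AlgEquiv.ofInjective _ (map_subtype_injective (AlgHom.equalizer ρ₁.coact ρ₂.coact) H)).symm.toAlgHom.comp
    ((ρ₁.coact.comp (AlgHom.equalizer ρ₁.coact ρ₂.coact).val).codRestrict _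
      (coact_mem_range ρ₁ ρ₂))

theorem map_val_equalizerCoact (ρ₁ ρ₂ : ComoduleAlgebra k H A) :
    (Algebra.TensorProduct.map (AlgHom.equalizer ρ₁.coact ρ₂.coact).val (AlgHom.id k H)).comp
      (equalizerCoact ρ₁ ρ₂) = ρ₁.coact.comp (AlgHom.equalizer ρ₁.coact ρ₂.coact).val := by
  ext a
  have := AlgEquiv.apply_symm_apply (AlgEquiv.ofInjective _
    (map_subtype_injective (AlgHom.equalizer ρ₁.coact ρ₂.coact) H))
    ((ρ₁.coact.comp (AlgHom.equalizer ρ₁.coact ρ₂.coact).val).codRestrict _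
      (coact_mem_range ρ₁ ρ₂) a)
  exact congr($(this).1)

/-- If `ρ₁` and `ρ₂` are two right `H`-comodule algebra structures on `A`, then they restrict to
one and the same `H`-comodule algebra structure on the subalgebra `{a | ρ₁(a) = ρ₂(a)}`. -/
def equalizer (ρ₁ ρ₂ : ComoduleAlgebra k H A) :
    ComoduleAlgebra k H (AlgHom.equalizer ρ₁.coact ρ₂.coact) where
  coact := equalizerCoact ρ₁ ρ₂
  coassoc := by
    set E := AlgHom.equalizer ρ₁.coact ρ₂.coact
    have h := map_val_equalizerCoact ρ₁ ρ₂
    refine AlgHom.cancel_left (map_subtype_injective E (H ⊗[k] H)) |>.1 ?_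
    have e1 : (Algebra.TensorProduct.map E.val (AlgHom.id k (H ⊗[k] H))).comp
        (Algebra.TensorProduct.assoc k k k E H H).toAlgHom =
        (Algebra.TensorProduct.assoc k k k A H H).toAlgHom.comp
          (Algebra.TensorProduct.map (Algebra.TensorProduct.map E.val (AlgHom.id k H))
            (AlgHom.id k H)) := by
      ext <;> rfl
    have e2 : (Algebra.TensorProduct.map E.val (AlgHom.id k (H ⊗[k] H))).comp
        (Algebra.TensorProduct.map (AlgHom.id k E) (Bialgebra.comulAlgHom k H)) =
        (Algebra.TensorProduct.map (AlgHom.id k A) (Bialgebra.comulAlgHom k H)).comp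
          (Algebra.TensorProduct.map E.val (AlgHom.id k H)) := by
      ext <;> simp
    have e3 : (Algebra.TensorProduct.map (Algebra.TensorProduct.map E.val (AlgHom.id k H))
            (AlgHom.id k H)).comp
        (Algebra.TensorProduct.map (equalizerCoact ρ₁ ρ₂) (AlgHom.id k H)) =
        (Algebra.TensorProduct.map ρ₁.coact (AlgHom.id k H)).comp
          (Algebra.TensorProduct.map E.val (AlgHom.id k H)) := by
      rw [← Algebra.TensorProduct.map_comp, ← Algebra.TensorProduct.map_comp, h]
    ext1 a
    have h' (a : E) := congr($h a)
    have e1' (t) := congr($e1 t)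
    have e2' (t) := congr($e2 t)
    have e3' (t) := congr($e3 t)
    have hc := congr($(ρ₁.coassoc) (a : A))
    simp only [AlgHom.comp_apply] at h' e1' e2' e3' hc ⊢
    rw [e1', e2', e3', h']
    exact hc
  counit := by
    set E := AlgHom.equalizer ρ₁.coact ρ₂.coact
    have h := map_val_equalizerCoact ρ₁ ρ₂
    refine AlgHom.cancel_left (f := E.val) Subtype.val_injective |>.1 ?_
    have e1 : E.val.comp ((Algebra.TensorProduct.rid k k E).toAlgHom.comp
        (Algebra.TensorProduct.map (AlgHom.id k E) (Bialgebra.counitAlgHom k H))) =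
        ((Algebra.TensorProduct.rid k k A).toAlgHom.comp
          (Algebra.TensorProduct.map (AlgHom.id k A) (Bialgebra.counitAlgHom k H))).comp
          (Algebra.TensorProduct.map E.val (AlgHom.id k H)) := by
      ext <;> simp
    rw [← AlgHom.comp_assoc, ← AlgHom.comp_assoc, AlgHom.comp_assoc E.val, e1, AlgHom.comp_assoc, h,
      ← AlgHom.comp_assoc, AlgHom.comp_assoc _ _ ρ₁.coact, ρ₁.counit]
    rfl

variable {A' : Type w'} [Ring A'] [Algebra k A']

theorem coassoc_comp {X : Type*} [Ring X] [Algebra k X] (φ : A →ₐ[k] X) (c : X →ₐ[k] X ⊗[k] H)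
    (h : c.comp φ = (Algebra.TensorProduct.map φ (AlgHom.id k H)).comp ρ.coact) :
    ((Algebra.TensorProduct.assoc k k k X H H).toAlgHom.comp
      ((Algebra.TensorProduct.map c (AlgHom.id k H)).comp c)).comp φ =
    ((Algebra.TensorProduct.map (AlgHom.id k X) (Bialgebra.comulAlgHom k H)).comp c).comp φ := by
  have e1 : ((Algebra.TensorProduct.assoc k k k X H H).toAlgHom.comp
        (Algebra.TensorProduct.map c (AlgHom.id k H))).comp
          (Algebra.TensorProduct.map φ (AlgHom.id k H)) =
      ((Algebra.TensorProduct.map φ (AlgHom.id k (H ⊗[k] H))).comp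
        (Algebra.TensorProduct.assoc k k k A H H).toAlgHom).comp
          (Algebra.TensorProduct.map ρ.coact (AlgHom.id k H)) := by
    rw [AlgHom.comp_assoc, ← Algebra.TensorProduct.map_comp, h, AlgHom.id_comp]
    have : (Algebra.TensorProduct.map φ (AlgHom.id k (H ⊗[k] H))).comp
        (Algebra.TensorProduct.assoc k k k A H H).toAlgHom =
        (Algebra.TensorProduct.assoc k k k X H H).toAlgHom.comp
          (Algebra.TensorProduct.map (Algebra.TensorProduct.map φ (AlgHom.id k H))
            (AlgHom.id k H)) := by
      ext <;> rfl
    rw [this, AlgHom.comp_assoc, ← Algebra.TensorProduct.map_comp, AlgHom.id_comp]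
  have e2 : (Algebra.TensorProduct.map (AlgHom.id k X) (Bialgebra.comulAlgHom k H)).comp
        (Algebra.TensorProduct.map φ (AlgHom.id k H)) =
      (Algebra.TensorProduct.map φ (AlgHom.id k (H ⊗[k] H))).comp
        (Algebra.TensorProduct.map (AlgHom.id k A) (Bialgebra.comulAlgHom k H)) := by
    ext <;> simp
  ext1 a
  have h' (a : A) := congr($h a)
  have e1' (t) := congr($e1 t)
  have e2' (t) := congr($e2 t)
  have hc := congr($(ρ.coassoc) a)
  simp only [AlgHom.comp_apply] at h' e1' e2' hc ⊢
  rw [h', e1', e2', hc]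

theorem counit_comp {X : Type*} [Ring X] [Algebra k X] (φ : A →ₐ[k] X) (c : X →ₐ[k] X ⊗[k] H)
    (h : c.comp φ = (Algebra.TensorProduct.map φ (AlgHom.id k H)).comp ρ.coact) :
    ((Algebra.TensorProduct.rid k k X).toAlgHom.comp
      ((Algebra.TensorProduct.map (AlgHom.id k X) (Bialgebra.counitAlgHom k H)).comp c)).comp φ =
    φ := by
  have e1 : ((Algebra.TensorProduct.rid k k X).toAlgHom.comp
        (Algebra.TensorProduct.map (AlgHom.id k X) (Bialgebra.counitAlgHom k H))).comp
          (Algebra.TensorProduct.map φ (AlgHom.id k H)) =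
      φ.comp ((Algebra.TensorProduct.rid k k A).toAlgHom.comp
        (Algebra.TensorProduct.map (AlgHom.id k A) (Bialgebra.counitAlgHom k H))) := by
    ext <;> simp
  ext1 a
  have h' (a : A) := congr($h a)
  have e1' (t) := congr($e1 t)
  have hc := congr($(ρ.counit) a)
  simp only [AlgHom.comp_apply] at h' e1' hc ⊢
  rw [h', e1', hc]
  rfl

variable (k H) in
/-- The trivial coaction `a ↦ a ⊗ 1`. -/
def trivial (A : Type w) [Ring A] [Algebra k A] : ComoduleAlgebra k H A where
  coact := Algebra.TensorProduct.includeLeft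
  coassoc := by ext; simp [Algebra.TensorProduct.one_def]
  counit := by ext; simp

/-- An algebra map `c : A ⊗ A' → A ⊗ A' ⊗ H` is a coaction if it restricts to coactions of `H` on
both factors. -/
def ofTensor (ρ : ComoduleAlgebra k H A) (ρ' : ComoduleAlgebra k H A')
    (c : A ⊗[k] A' →ₐ[k] (A ⊗[k] A') ⊗[k] H)
    (h : c.comp Algebra.TensorProduct.includeLeft = (Algebra.TensorProduct.map
      Algebra.TensorProduct.includeLeft (AlgHom.id k H)).comp ρ.coact)
    (h' : c.comp Algebra.TensorProduct.includeRight = (Algebra.TensorProduct.map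
      Algebra.TensorProduct.includeRight (AlgHom.id k H)).comp ρ'.coact) :
    ComoduleAlgebra k H (A ⊗[k] A') where
  coact := c
  coassoc := Algebra.TensorProduct.ext (ρ.coassoc_comp _ c h) (ρ'.coassoc_comp _ c h')
  counit := Algebra.TensorProduct.ext (ρ.counit_comp _ c h) (ρ'.counit_comp _ c h')

/-- The `H`-comodule algebra `A ⊗ A'` with coaction `a ⊗ a' ↦ a ⊗ a'₀ ⊗ a'₁`. -/
def tensorRight (A : Type w) [Ring A] [Algebra k A] (ρ' : ComoduleAlgebra k H A') :
    ComoduleAlgebra k H (A ⊗[k] A') :=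
  ofTensor (trivial k H A) ρ'
    ((Algebra.TensorProduct.assoc k k k A A' H).symm.toAlgHom.comp
      (Algebra.TensorProduct.map (AlgHom.id k A) ρ'.coact))
    (by ext; simp [trivial, Algebra.TensorProduct.one_def])
    (by
      have : (Algebra.TensorProduct.assoc k k k A A' H).symm.toAlgHom.comp
          Algebra.TensorProduct.includeRight = Algebra.TensorProduct.map
            Algebra.TensorProduct.includeRight (AlgHom.id k H) := by
        ext <;> simp [Algebra.TensorProduct.one_def]
      rw [← this]
      ext; simp)

/-- The `H`-comodule algebra `A ⊗ A'` with coaction `a ⊗ a' ↦ a₀ ⊗ a' ⊗ a₁`. -/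
def tensorLeft (ρ : ComoduleAlgebra k H A) (A' : Type w') [Ring A'] [Algebra k A'] :
    ComoduleAlgebra k H (A ⊗[k] A') :=
  ofTensor ρ (trivial k H A')
    ((Algebra.TensorProduct.assoc k k k A A' H).symm.toAlgHom.comp
      ((Algebra.TensorProduct.leftComm k A' A H).toAlgHom.comp
        ((Algebra.TensorProduct.map (AlgHom.id k A') ρ.coact).comp
          (Algebra.TensorProduct.comm k A A').toAlgHom)))
    (by
      have : ((Algebra.TensorProduct.assoc k k k A A' H).symm.toAlgHom.comp
          (Algebra.TensorProduct.leftComm k A' A H).toAlgHom).comp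
          Algebra.TensorProduct.includeRight = Algebra.TensorProduct.map
            Algebra.TensorProduct.includeLeft (AlgHom.id k H) := by
        ext <;> simp [Algebra.TensorProduct.one_def]
      rw [← this]
      ext; simp)
    (by ext; simp [trivial, Algebra.TensorProduct.one_def])

/-- The cotensor product `A □_H A'`: the subalgebra of all `∑ aᵢ ⊗ a'ᵢ` in `A ⊗ A'` with
`∑ aᵢ₀ ⊗ a'ᵢ ⊗ aᵢ₁ = ∑ aᵢ ⊗ a'ᵢ₀ ⊗ a'ᵢ₁`. (For cocommutative `H`, the right coaction of `A'` is
also a left coaction, up to the order of the tensor factors.) -/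
def cotensor (ρ : ComoduleAlgebra k H A) (ρ' : ComoduleAlgebra k H A') :
    Subalgebra k (A ⊗[k] A') :=
  AlgHom.equalizer (ρ.tensorLeft A').coact (tensorRight A ρ').coact

/-- The `H`-comodule algebra structure
`ρ(∑ aᵢ ⊗ a'ᵢ) = ∑ aᵢ₀ ⊗ a'ᵢ ⊗ aᵢ₁ = ∑ aᵢ ⊗ a'ᵢ₀ ⊗ a'ᵢ₁` on `A □_H A'`. -/
def cotensorCoaction (ρ : ComoduleAlgebra k H A) (ρ' : ComoduleAlgebra k H A') :
    ComoduleAlgebra k H (ρ.cotensor ρ') :=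
  equalizer (ρ.tensorLeft A') (tensorRight A ρ')

theorem comul_antipode [Coalgebra.IsCocomm k H] :
    Coalgebra.comul ∘ₗ HopfAlgebra.antipode k (A := H) =
      TensorProduct.map (HopfAlgebra.antipode k) (HopfAlgebra.antipode k) ∘ₗ Coalgebra.comul := by
  refine WithConv.toConv_injective ?_
  refine (left_inv_eq_right_inv (a := WithConv.toConv (Coalgebra.comul (R := k) (A := H))) ?_
    LinearMap.comul_right_inv).symm
  have h1 : WithConv.toConv (TensorProduct.map (HopfAlgebra.antipode k (A := H))
      (HopfAlgebra.antipode k (A := H))) * WithConv.toConv (TensorProduct.map LinearMap.id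
        LinearMap.id) = (1 : WithConv (H ⊗[k] H →ₗ[k] H ⊗[k] H)) := by
    have := TensorProduct.map_convMul_map (f := WithConv.toConv (HopfAlgebra.antipode k (A := H)))
      (g := WithConv.toConv (HopfAlgebra.antipode k (A := H)))
      (h := WithConv.toConv LinearMap.id) (k := WithConv.toConv LinearMap.id)
    simp only [LinearMap.antipode_mul_id] at this
    refine this.trans (WithConv.ext ?_)
    ext x y
    simp [LinearMap.convOne_def,
      Algebra.algebraMap_eq_smul_one, Algebra.TensorProduct.one_def, TensorProduct.smul_tmul',
      TensorProduct.tmul_smul, smul_smul, mul_comm]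
  have h2 := LinearMap.convMul_comp_coalgHom_distrib
    (WithConv.toConv (TensorProduct.map (HopfAlgebra.antipode k (A := H))
      (HopfAlgebra.antipode k (A := H)))) (WithConv.toConv (TensorProduct.map LinearMap.id
        LinearMap.id)) (Coalgebra.comulCoalgHom k H)
  rw [h1] at h2
  refine WithConv.ext (Eq.trans ?_ (h2.symm.trans ?_))
  · congr 3
    simp only [TensorProduct.map_id, LinearMap.id_comp]
    rfl
  · ext x
    exact congr(algebraMap k (H ⊗[k] H) $(congr($((Coalgebra.comulCoalgHom k H).counit_comp) x)))

theorem op_coact_apply (a : A) :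
    ((Algebra.TensorProduct.map (AlgHom.id k Aᵐᵒᵖ)
      (AlgHom.opComm (HopfAlgebra.antipodeAlgHomOp k H))).comp
    ((Algebra.TensorProduct.opAlgEquiv k k A H).symm.toAlgHom.comp (AlgHom.op ρ.coact)))
      (MulOpposite.op a) =
    TensorProduct.map (MulOpposite.opLinearEquiv k).toLinearMap (HopfAlgebra.antipode k)
      (ρ.coact a) := by
  simp only [AlgHom.comp_apply]
  have : AlgHom.op ρ.coact (MulOpposite.op a) = MulOpposite.op (ρ.coact a) := rfl
  rw [this]
  induction ρ.coact a using TensorProduct.induction_on with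
  | zero => simp
  | tmul x y => simp
  | add x y hx hy => rw [map_add, ← hx, ← hy, MulOpposite.op_add, map_add, map_add]

/-- The opposite algebra `A^op` of a comodule algebra over a cocommutative Hopf algebra, with the
coaction `a ↦ a₀ ⊗ S(a₁)`. -/
def op [Coalgebra.IsCocomm k H] (ρ : ComoduleAlgebra k H A) : ComoduleAlgebra k H Aᵐᵒᵖ where
  coact := (Algebra.TensorProduct.map (AlgHom.id k Aᵐᵒᵖ)
      (AlgHom.opComm (HopfAlgebra.antipodeAlgHomOp k H))).comp
    ((Algebra.TensorProduct.opAlgEquiv k k A H).symm.toAlgHom.comp (AlgHom.op ρ.coact))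
  coassoc := by
    have hop := ρ.op_coact_apply
    set c := (Algebra.TensorProduct.map (AlgHom.id k Aᵐᵒᵖ)
      (AlgHom.opComm (HopfAlgebra.antipodeAlgHomOp k H))).comp
      ((Algebra.TensorProduct.opAlgEquiv k k A H).symm.toAlgHom.comp (AlgHom.op ρ.coact))
    ext1 a
    obtain ⟨a, rfl⟩ := MulOpposite.op_surjective a
    set S := HopfAlgebra.antipode k (A := H)
    set o : A →ₗ[k] Aᵐᵒᵖ := (MulOpposite.opLinearEquiv k).toLinearMap
    have e1 (t : A ⊗[k] H) : (Algebra.TensorProduct.assoc k k k Aᵐᵒᵖ H H)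
        (Algebra.TensorProduct.map c (AlgHom.id k H) (TensorProduct.map o S t)) =
        TensorProduct.map o (TensorProduct.map S S) (Algebra.TensorProduct.assoc k k k A H H
          (Algebra.TensorProduct.map ρ.coact (AlgHom.id k H) t)) := by
      induction t using TensorProduct.induction_on with
      | zero => simp
      | add x y hx hy => simp only [map_add, hx, hy]
      | tmul x y =>
        have : c (o x) = _ := hop x
        simp only [TensorProduct.map_tmul, Algebra.TensorProduct.map_tmul, this]
        induction ρ.coact x using TensorProduct.induction_on with
        | zero => simp
        | add x y hx hy => simp only [map_add, TensorProduct.add_tmul, hx, hy]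
        | tmul x z => simp
    have e2 (t : A ⊗[k] H) : Algebra.TensorProduct.map (AlgHom.id k Aᵐᵒᵖ)
          (Bialgebra.comulAlgHom k H) (TensorProduct.map o S t) =
        TensorProduct.map o (TensorProduct.map S S)
          (Algebra.TensorProduct.map (AlgHom.id k A) (Bialgebra.comulAlgHom k H) t) := by
      induction t using TensorProduct.induction_on with
      | zero => simp
      | add x y hx hy => simp only [map_add, hx, hy]
      | tmul x y =>
        have : Coalgebra.comul (S y) = _ := congr($comul_antipode y)
        simp [this, S]
    have hc := congr($(ρ.coassoc) a)
    simp only [AlgHom.comp_apply] at hc ⊢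
    rw [hop, e2, ← hc]
    exact e1 _
  counit := by
    have hop := ρ.op_coact_apply
    ext1 a
    obtain ⟨a, rfl⟩ := MulOpposite.op_surjective a
    have e1 (t : A ⊗[k] H) : (Algebra.TensorProduct.rid k k Aᵐᵒᵖ)
        (Algebra.TensorProduct.map (AlgHom.id k Aᵐᵒᵖ) (Bialgebra.counitAlgHom k H)
          (TensorProduct.map (MulOpposite.opLinearEquiv k).toLinearMap
            (HopfAlgebra.antipode k) t)) =
        MulOpposite.op (Algebra.TensorProduct.rid k k A
          (Algebra.TensorProduct.map (AlgHom.id k A) (Bialgebra.counitAlgHom k H) t)) := by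
      induction t using TensorProduct.induction_on with
      | zero => simp
      | add x y hx hy => simp only [map_add, hx, hy, MulOpposite.op_add]
      | tmul x y => simp
    have hc := congr($(ρ.counit) a)
    rw [AlgHom.comp_apply, AlgHom.comp_apply, hop]
    exact (e1 _).trans (congrArg MulOpposite.op hc)

/-! ### The extension `B ⊗ B^op ⊆ A □_H A^op` -/

section Env

variable {R : Type x} [Ring R] [Algebra k R]

/-- The map `ι ⊗ ι : R^e = R ⊗ R^op → A^e = A ⊗ A^op` of enveloping algebras. -/
def envMap (ι : R →ₐ[k] A) : R ⊗[k] Rᵐᵒᵖ →ₐ[k] A ⊗[k] Aᵐᵒᵖ :=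
  Algebra.TensorProduct.map ι (AlgHom.op ι)

variable [Coalgebra.IsCocomm k H]

theorem envMap_mem_cotensor (ι : R →ₐ[k] A) (hι : ι.range ≤ ρ.coinvariants) (t : R ⊗[k] Rᵐᵒᵖ) :
    envMap ι t ∈ ρ.cotensor ρ.op := by
  induction t using TensorProduct.induction_on with
  | zero => rw [map_zero]; exact zero_mem _
  | add x y hx hy => rw [map_add]; exact add_mem hx hy
  | tmul r s =>
    obtain ⟨s, rfl⟩ := MulOpposite.op_surjective s
    have hr : ρ.coact (ι r) = ι r ⊗ₜ[k] 1 := hι ⟨r, rfl⟩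
    have hs : ρ.coact (ι s) = ι s ⊗ₜ[k] 1 := hι ⟨s, rfl⟩
    have hs' : ρ.op.coact (MulOpposite.op (ι s)) = MulOpposite.op (ι s) ⊗ₜ[k] 1 := by
      refine (ρ.op_coact_apply (ι s)).trans ?_
      simp [hs]
    change (ρ.tensorLeft Aᵐᵒᵖ).coact (ι r ⊗ₜ MulOpposite.op (ι s)) =
      (tensorRight A ρ.op).coact (ι r ⊗ₜ MulOpposite.op (ι s))
    simp [tensorLeft, tensorRight, ofTensor, hr, hs']

/-- The map `B^e = B ⊗ B^op → A^{□e} = A □_H A^op`, `b ⊗ b' ↦ b ⊗ b'`, where `B = A^{co H}`. -/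
def envToCotensor : ρ.coinvariants ⊗[k] ρ.coinvariantsᵐᵒᵖ →ₐ[k] ρ.cotensor ρ.op :=
  (envMap ρ.coinvariants.val).codRestrict _
    (ρ.envMap_mem_cotensor _ (by rw [Subalgebra.range_val]))

end Env

end ComoduleAlgebra

end ComoduleAlgebra

section Shuffle

variable {k : Type u} [Field k] {R : Type x} [Ring R] [Algebra k R]
  {A : Type w} [Ring A] [Algebra k A] (ι : R →ₐ[k] A)

/-- The class of `(l ⊗ r') ⊗ (r ⊗ l')` in `A^e ⊗_{R^e} A^e`, as a linear map of
`(l ⊗ r) ⊗ (l' ⊗ r')`. -/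
def shuffleAux : (A ⊗[k] A) ⊗[k] (A ⊗[k] A) →ₗ[k] SelfTensor (ComoduleAlgebra.envMap ι) :=
  Submodule.mkQ _ ∘ₗ
    TensorProduct.map
      (TensorProduct.map LinearMap.id (MulOpposite.opLinearEquiv k).toLinearMap)
      (TensorProduct.map LinearMap.id (MulOpposite.opLinearEquiv k).toLinearMap) ∘ₗ
    (TensorProduct.tensorTensorTensorComm k A A A A).toLinearMap ∘ₗ
    TensorProduct.map LinearMap.id (TensorProduct.comm k A A).toLinearMap

theorem shuffleAux_tmul (l r l' r' : A) :
    shuffleAux ι ((l ⊗ₜ r) ⊗ₜ (l' ⊗ₜ r')) =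
      Submodule.Quotient.mk ((l ⊗ₜ MulOpposite.op r') ⊗ₜ[k] (r ⊗ₜ MulOpposite.op l')) := rfl

theorem shuffleAux_left (x : A ⊗[k] A)
    (hx : x ∈ balancedRel k (fun (a : A) (r : R) ↦ a * ι r) (fun (r : R) (a : A) ↦ ι r * a))
    (y : A ⊗[k] A) : shuffleAux ι (x ⊗ₜ y) = 0 := by
  induction y using TensorProduct.induction_on with
  | zero => simp
  | add y z hy hz => rw [TensorProduct.tmul_add, map_add, hy, hz, add_zero]
  | tmul l' r' =>
    refine (Submodule.span_le (p := LinearMap.ker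
      (shuffleAux ι ∘ₗ (TensorProduct.mk k _ _).flip (l' ⊗ₜ r')))).2 ?_ hx
    rintro _ ⟨a, r, b, rfl⟩
    simp only [SetLike.mem_coe, LinearMap.mem_ker, LinearMap.comp_apply, LinearMap.flip_apply,
      TensorProduct.mk_apply, map_sub, shuffleAux_tmul, sub_eq_zero]
    refine (Submodule.Quotient.eq _).2 (Submodule.subset_span
      ⟨a ⊗ₜ MulOpposite.op r', r ⊗ₜ 1, b ⊗ₜ MulOpposite.op l', ?_⟩)
    simp [ComoduleAlgebra.envMap]

theorem shuffleAux_right (x y : A ⊗[k] A)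
    (hy : y ∈ balancedRel k (fun (a : A) (r : R) ↦ a * ι r) (fun (r : R) (a : A) ↦ ι r * a)) :
    shuffleAux ι (x ⊗ₜ y) = 0 := by
  induction x using TensorProduct.induction_on with
  | zero => simp
  | add x z hx hz => rw [TensorProduct.add_tmul, map_add, hx, hz, add_zero]
  | tmul l r =>
    refine (Submodule.span_le (p := LinearMap.ker
      (shuffleAux ι ∘ₗ TensorProduct.mk k _ _ (l ⊗ₜ r)))).2 ?_ hy
    rintro _ ⟨a, s, b, rfl⟩
    simp only [SetLike.mem_coe, LinearMap.mem_ker, LinearMap.comp_apply,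
      TensorProduct.mk_apply, map_sub, shuffleAux_tmul, sub_eq_zero]
    refine Eq.symm ((Submodule.Quotient.eq _).2 (Submodule.subset_span
      ⟨l ⊗ₜ MulOpposite.op b, 1 ⊗ₜ MulOpposite.op s, r ⊗ₜ MulOpposite.op a, ?_⟩))
    simp [ComoduleAlgebra.envMap]

/-- The map `(A ⊗_R A) ⊗ (A ⊗_R A) → A^e ⊗_{R^e} A^e`,
`(l ⊗_R r) ⊗ (l' ⊗_R r') ↦ (l ⊗ r') ⊗_{R^e} (r ⊗ l')`. -/
def shuffle : SelfTensor ι ⊗[k] SelfTensor ι →ₗ[k] SelfTensor (ComoduleAlgebra.envMap ι) :=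
  TensorProduct.lift <|
    Submodule.liftQ _
      (LinearMap.flip <| Submodule.liftQ _ (TensorProduct.curry (shuffleAux ι)).flip
        fun y hy ↦ LinearMap.mem_ker.2 <| LinearMap.ext fun x ↦ shuffleAux_right ι x y hy)
      fun x hx ↦ LinearMap.mem_ker.2 <| LinearMap.ext fun y ↦ by
        obtain ⟨y, rfl⟩ := Submodule.Quotient.mk_surjective _ y
        exact shuffleAux_left ι x hx y

theorem shuffle_mk_tmul_mk (l r l' r' : A) :
    shuffle ι (Submodule.Quotient.mk (l ⊗ₜ r) ⊗ₜ Submodule.Quotient.mk (l' ⊗ₜ r')) =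
      Submodule.Quotient.mk ((l ⊗ₜ MulOpposite.op r') ⊗ₜ[k] (r ⊗ₜ MulOpposite.op l')) := rfl

end Shuffle

section Statement

variable {k : Type u} [Field k] {H : Type v} [Ring H] [HopfAlgebra k H]
  {A : Type w} [Ring A] [Algebra k A]

/-- For a linear map `γ : H → A ⊗_R A`, `γ(h) = ∑ᵢ lᵢ(h) ⊗_R rᵢ(h)`, the element
`∑ᵢⱼ (lᵢ(h₁) ⊗ rⱼ(h₂)) ⊗_{R^e} (rᵢ(h₁) ⊗ lⱼ(h₂))` of `A^e ⊗_{R^e} A^e`. -/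
def envTranslation {R : Type x} [Ring R] [Algebra k R] {ι : R →ₐ[k] A}
    (γ : H →ₗ[k] SelfTensor ι) : H →ₗ[k] SelfTensor (ComoduleAlgebra.envMap ι) :=
  shuffle ι ∘ₗ TensorProduct.map γ γ ∘ₗ Coalgebra.comul

/-- The map `i ⊗_{B^e} i : A^{□e} ⊗_{B^e} A^{□e} → A^e ⊗_{B^e} A^e` induced by the inclusion `i`
of `A^{□e}` in `A^e`. -/
def cotensorToEnv [Coalgebra.IsCocomm k H] (ρ : ComoduleAlgebra k H A) :
    SelfTensor ρ.envToCotensor →ₗ[k] SelfTensor (ComoduleAlgebra.envMap ρ.coinvariants.val) :=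
  SelfTensor.map _ _ (ρ.cotensor ρ.op).val rfl

end Statement

end HopfGalois

end

/-!
Write `Γ(h) = ∑ l ⊗ r` for a linear map `Γ : H → D ⊗ D` on a comodule algebra `D`. Everything rests
on the notion of a bicolinear lift of the translation map (`IsTranslationLift`): a unital `Γ` with
`∑ l r = ε(h)`, with `r₀ ⊗ r₁` governed by `Γ(h₁) ⊗ h₂` and `l₀ ⊗ l₁` by `Γ(h₁) ⊗ S(h₂)`. The
conditions involve tensor products over `k` only, and not the subalgebra of coinvariants.

*A bicolinear lift makes `D` a faithfully flat Galois extension* of its coinvariants `R`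
(`IsTranslationLift.isFaithfullyFlatGalois`). Left colinearity shows that
`σ(a) = ∑ a₀ l ⊗ r`, with `Γ(a₁) = ∑ l ⊗ r`, lies in `R ⊗ D`. So `σ` is a unital `R`-linear section
of the multiplication `R ⊗ D → D`, which embeds `M ⊗_R D` naturally in `M ⊗_k D` for each right
`R`-module `M`; this gives faithful flatness. The inverse of the canonical map is
`d ⊗ h ↦ ∑ d l ⊗_R r`, and the class of `Γ(h)` is the translation map (`IsTranslationLift.mk_eq`).

*Conversely, a faithfully flat Galois extension `A` has a bicolinear lift*
(`exists_isTranslationLift`). First, `A` has a total integral, that is, a unital colinear map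
`φ : H → A` (`exists_isTotalIntegral`): by Zorn's lemma and local finiteness of `H`, it suffices to
extend colinear maps to `A` from a comodule `U` to a larger comodule `V` of finite dimension, and
the restriction map `Hom^H(V, A) → Hom^H(U, A)` becomes the surjection `Hom(V, A) → Hom(U, A)` after the
faithfully flat base change along `R → A` (`exists_colinear_extension`). Then an arbitrary
`k`-linear unital lift of the translation map is averaged by `φ` in its right leg, and by the total integral
`φ ∘ S` of `A^op` in its left leg; the second averaging does not destroy what the first has achieved
(`isColinear_swapLegs_average`).

*The cotensor product.* If `Γ` is a bicolinear lift for `A`, then exchanging its legs gives one for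
`A^op` (`IsTranslationLift.op`), and the map `Γ_E(h) = ∑ (l ⊗ r') ⊗ (r ⊗ l')` with
`Γ(h₁) = ∑ l ⊗ r` and `Γ(h₂) = ∑ l' ⊗ r'` is a bicolinear lift for both coactions
`a₀ ⊗ a' ⊗ a₁` and `a ⊗ a'₀ ⊗ S(a'₁)` of `A ⊗ A^op`; here cocommutativity enters. Hence both legs
of `Γ_E(h)` lie in the subalgebra on which the two coactions agree, which is the cotensor product,
and `Γ_E` is a bicolinear lift for it (`IsTranslationLift.exists_equalizer`). By the first part, the
cotensor product is a faithfully flat Galois extension of its coinvariants, and these are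
`B ⊗ B^op` (`envToCotensor_range`). The formula for its translation map is the definition of `Γ_E`.
Finally, `A^{□e} ⊗ A^{□e} → A^e ⊗ A^e` (over `B^e`) is injective because its composite with the
canonical map of the coaction `a₀ ⊗ a' ⊗ a₁` is the injective canonical map of `A^{□e}`.
-/

open scoped TensorProduct

noncomputable section

namespace HopfGalois

universe u v w w' x

/-! ### Tensor products over a field -/

section Field

variable {k : Type*} [Field k] {M N M' N' : Type*} [AddCommGroup M] [Module k M]
  [AddCommGroup N] [Module k N] [AddCommGroup M'] [Module k M'] [AddCommGroup N'] [Module k N']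

theorem exists_map_ker_left (d : M →ₗ[k] N) (x : M ⊗[k] M')
    (h : TensorProduct.map d LinearMap.id x = 0) :
    ∃ y : LinearMap.ker d ⊗[k] M',
      TensorProduct.map (LinearMap.ker d).subtype LinearMap.id y = x :=
  (Module.Flat.rTensor_exact (M := M') (LinearMap.exact_subtype_ker_map d) x).1 h

theorem exists_map_ker_right (d : M' →ₗ[k] N') (x : M ⊗[k] M')
    (h : TensorProduct.map LinearMap.id d x = 0) :
    ∃ y : M ⊗[k] LinearMap.ker d,
      TensorProduct.map LinearMap.id (LinearMap.ker d).subtype y = x :=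
  (Module.Flat.lTensor_exact (M := M) (LinearMap.exact_subtype_ker_map d) x).1 h

theorem map_id_injective {f : M →ₗ[k] N} (hf : Function.Injective f) :
    Function.Injective (TensorProduct.map f (LinearMap.id : M' →ₗ[k] M')) :=
  Module.Flat.rTensor_preserves_injective_linearMap (M := M') f hf

theorem id_map_injective {f : M →ₗ[k] N} (hf : Function.Injective f) :
    Function.Injective (TensorProduct.map (LinearMap.id : M' →ₗ[k] M') f) :=
  Module.Flat.lTensor_preserves_injective_linearMap (M := M') f hf

theorem map_map_apply {P P' : Type*} [AddCommGroup P] [Module k P] [AddCommGroup P'] [Module k P']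
    (f : N →ₗ[k] P) (f' : N' →ₗ[k] P') (g : M →ₗ[k] N) (g' : M' →ₗ[k] N') (x : M ⊗[k] M') :
    TensorProduct.map f f' (TensorProduct.map g g' x) =
      TensorProduct.map (f ∘ₗ g) (f' ∘ₗ g') x := by
  rw [TensorProduct.map_comp]; rfl

/-- Over a field, `ker d ⊗ ker d'` is the intersection of `ker d ⊗ M'` and `M ⊗ ker d'`. -/
theorem exists_map_ker (d : M →ₗ[k] N) (d' : M' →ₗ[k] N') (x : M ⊗[k] M')
    (h : TensorProduct.map d LinearMap.id x = 0) (h' : TensorProduct.map LinearMap.id d' x = 0) :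
    ∃ y : LinearMap.ker d ⊗[k] LinearMap.ker d',
      TensorProduct.map (LinearMap.ker d).subtype (LinearMap.ker d').subtype y = x := by
  obtain ⟨y, rfl⟩ := exists_map_ker_left d x h
  have hy : TensorProduct.map LinearMap.id d' y = 0 := by
    refine map_id_injective (M' := N') (LinearMap.ker d).injective_subtype ?_
    rw [map_zero, ← h', map_map_apply, map_map_apply]
    rfl
  obtain ⟨z, rfl⟩ := exists_map_ker_right d' y hy
  exact ⟨z, by rw [map_map_apply]; rfl⟩

/-- The contraction `m ⊗ h ↦ β(h) m` with a functional `β`. -/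
def contract (M : Type*) [AddCommGroup M] [Module k M] (β : M' →ₗ[k] k) : M ⊗[k] M' →ₗ[k] M :=
  (TensorProduct.rid k M).toLinearMap ∘ₗ TensorProduct.map LinearMap.id β

@[simp] theorem contract_tmul (β : M' →ₗ[k] k) (m : M) (h : M') :
    contract M β (m ⊗ₜ h) = β h • m := by
  simp [contract]

theorem contract_map (f : M →ₗ[k] N) (β : M' →ₗ[k] k) (z : M ⊗[k] M') :
    contract N β (TensorProduct.map f LinearMap.id z) = f (contract M β z) := by
  induction z using TensorProduct.induction_on with
  | zero => simp
  | tmul m h => simp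
  | add y z hy hz => simp only [map_add, hy, hz]

theorem eq_zero_of_contract (z : M ⊗[k] M') (h : ∀ β, contract M β z = 0) : z = 0 := by
  let b := Module.Free.chooseBasis k M'
  refine (TensorProduct.equivFinsuppOfBasisRight b (M := M)).injective ?_
  rw [map_zero]
  ext i
  have : ∀ z : M ⊗[k] M', TensorProduct.equivFinsuppOfBasisRight b z i =
      contract M (b.coord i) z := by
    intro z
    induction z using TensorProduct.induction_on with
    | zero => simp
    | tmul m h => simp
    | add y z hy hz => simp only [map_add, Finsupp.add_apply, hy, hz]
  rw [this, h]
  rfl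

theorem eq_of_contract (y z : M ⊗[k] M') (h : ∀ β, contract M β y = contract M β z) : y = z :=
  sub_eq_zero.1 <| eq_zero_of_contract _ fun β ↦ by rw [map_sub, h, sub_self]

/-- An element of `M ⊗ M'` lies in `V ⊗ M'` as soon as all its contractions lie in `V`. -/
theorem exists_of_contract_mem (V : Submodule k M) (z : M ⊗[k] M') (h : ∀ β, contract M β z ∈ V) :
    ∃ y : V ⊗[k] M', TensorProduct.map V.subtype LinearMap.id y = z := by
  have h0 : TensorProduct.map V.mkQ LinearMap.id z = 0 :=
    eq_zero_of_contract _ fun β ↦ by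
      rw [contract_map, Submodule.mkQ_apply, (Submodule.Quotient.mk_eq_zero V).2 (h β)]
  have hex : Function.Exact V.subtype V.mkQ := LinearMap.exact_subtype_mkQ V
  exact (Module.Flat.rTensor_exact (M := M') hex z).1 h0

end Field

/-! ### Convolution -/

section Convolution

variable {k : Type*} [Field k] {C : Type*} [AddCommGroup C] [Module k C] [Coalgebra k C]
  {D D' : Type*} [Ring D] [Algebra k D] [Ring D'] [Algebra k D']

/-- The convolution `(f * g)(c) = f(c₁) g(c₂)` of linear maps from a coalgebra to an algebra. -/
def conv (f g : C →ₗ[k] D) : C →ₗ[k] D :=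
  LinearMap.mul' k D ∘ₗ TensorProduct.map f g ∘ₗ Coalgebra.comul

/-- The unit `c ↦ ε(c) 1` of the convolution product. -/
def convUnit (k C D : Type*) [Field k] [AddCommGroup C] [Module k C] [Coalgebra k C] [Ring D]
    [Algebra k D] : C →ₗ[k] D :=
  Algebra.linearMap k D ∘ₗ Coalgebra.counit

theorem conv_eq (f g : C →ₗ[k] D) :
    conv f g = (WithConv.toConv f * WithConv.toConv g).ofConv := rfl

theorem conv_assoc (f g h : C →ₗ[k] D) : conv (conv f g) h = conv f (conv g h) := by
  simp only [conv_eq, WithConv.toConv_ofConv, mul_assoc]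

theorem convUnit_conv (f : C →ₗ[k] D) : conv (convUnit k C D) f = f := by
  change (1 * WithConv.toConv f).ofConv = f
  rw [one_mul]

theorem conv_convUnit (f : C →ₗ[k] D) : conv f (convUnit k C D) = f := by
  change (WithConv.toConv f * 1).ofConv = f
  rw [mul_one]

theorem comp_conv (φ : D →ₐ[k] D') (f g : C →ₗ[k] D) :
    φ.toLinearMap ∘ₗ conv f g = conv (φ.toLinearMap ∘ₗ f) (φ.toLinearMap ∘ₗ g) := by
  have : φ.toLinearMap ∘ₗ LinearMap.mul' k D =
      LinearMap.mul' k D' ∘ₗ TensorProduct.map φ.toLinearMap φ.toLinearMap := by ext; simp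
  simp only [conv]
  rw [← LinearMap.comp_assoc, this, TensorProduct.map_comp]
  rfl

theorem comp_convUnit (φ : D →ₐ[k] D') :
    φ.toLinearMap ∘ₗ convUnit k C D = convUnit k C D' := by
  ext c
  simp [convUnit]

/-- Convolution over a cocommutative coalgebra is commutative on maps with commuting values. -/
theorem conv_comm [Coalgebra.IsCocomm k C] (f g : C →ₗ[k] D) (h : ∀ x y, Commute (f x) (g y)) :
    conv f g = conv g f := by
  have h1 : LinearMap.mul' k D ∘ₗ TensorProduct.map f g =
      LinearMap.mul' k D ∘ₗ TensorProduct.map g f ∘ₗ (TensorProduct.comm k C C).toLinearMap := by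
    ext x y
    exact h x y
  ext c
  have h2 := congr($h1 (Coalgebra.comul c))
  simp only [LinearMap.comp_apply, LinearEquiv.coe_coe, Coalgebra.comm_comul] at h2
  exact h2

end Convolution

/-! ### Cocommutative Hopf algebras -/

section Hopf

variable {k : Type*} [Field k] {H : Type*} [Ring H] [HopfAlgebra k H]

theorem antipode_conv_id : conv (HopfAlgebra.antipode k) LinearMap.id = convUnit k H H :=
  congr(($(LinearMap.antipode_mul_id (R := k) (C := H))).ofConv)

theorem id_conv_antipode : conv LinearMap.id (HopfAlgebra.antipode k) = convUnit k H H :=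
  congr(($(LinearMap.id_mul_antipode (R := k) (C := H))).ofConv)

variable [Coalgebra.IsCocomm k H]

/-- The antipode of a cocommutative Hopf algebra is an involution. -/
theorem antipode_antipode (h : H) :
    HopfAlgebra.antipode k (HopfAlgebra.antipode k h) = h := by
  set S := HopfAlgebra.antipode k (A := H)
  have h1 : conv S (S ∘ₗ S) = convUnit k H H := by
    have : LinearMap.mul' k H ∘ₗ TensorProduct.map S (S ∘ₗ S) =
        S ∘ₗ LinearMap.mul' k H ∘ₗ TensorProduct.map S LinearMap.id ∘ₗ
          (TensorProduct.comm k H H).toLinearMap := by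
      ext x y
      simp [S, HopfAlgebra.antipode_mul_antidistrib]
    ext c
    have h2 := congr($this (Coalgebra.comul c))
    simp only [LinearMap.comp_apply, LinearEquiv.coe_coe, Coalgebra.comm_comul] at h2
    refine h2.trans ?_
    have h3 := congr(S ($(antipode_conv_id (k := k)) c))
    refine h3.trans ?_
    simp [convUnit, Algebra.algebraMap_eq_smul_one, S]
  have h2 : S ∘ₗ S = LinearMap.id := by
    rw [← convUnit_conv (S ∘ₗ S), ← id_conv_antipode, conv_assoc, h1, conv_convUnit]
  exact congr($h2 h)

end Hopf

/-! ### Iterated comultiplication -/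

section TripleComul

variable {k : Type*} [Field k] {H : Type*} [AddCommGroup H] [Module k H] [Coalgebra k H]
  {X : Type*} [AddCommGroup X] [Module k X]

/-- The iterated comultiplication `h ↦ (h₁ ⊗ h₂) ⊗ h₃`. -/
def comul₃ (k H : Type*) [Field k] [AddCommGroup H] [Module k H] [Coalgebra k H] :
    H →ₗ[k] (H ⊗[k] H) ⊗[k] H :=
  TensorProduct.map Coalgebra.comul LinearMap.id ∘ₗ Coalgebra.comul

theorem map_id_comul_comul :
    TensorProduct.map LinearMap.id (Coalgebra.comul (R := k)) ∘ₗ Coalgebra.comul =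
      (TensorProduct.assoc k H H H).toLinearMap ∘ₗ comul₃ k H :=
  (Coalgebra.coassoc (R := k) (A := H)).symm

theorem map_comp_comul_comul {Y Z : Type*} [AddCommGroup Y] [Module k Y] [AddCommGroup Z]
    [Module k Z] (f : H ⊗[k] H →ₗ[k] Y) (g : H →ₗ[k] Z) :
    TensorProduct.map (f ∘ₗ Coalgebra.comul) g ∘ₗ Coalgebra.comul =
      TensorProduct.map f g ∘ₗ comul₃ k H := by
  rw [comul₃, ← LinearMap.comp_assoc, ← TensorProduct.map_comp, LinearMap.comp_id]

theorem comul₃_congr {F G : (H ⊗[k] H) ⊗[k] H →ₗ[k] X}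
    (h : ∀ a b c, F ((a ⊗ₜ b) ⊗ₜ c) = G ((a ⊗ₜ b) ⊗ₜ c)) : F ∘ₗ comul₃ k H = G ∘ₗ comul₃ k H := by
  congr 1
  ext a b c
  exact h a b c

variable [Coalgebra.IsCocomm k H]

/-- In a cocommutative coalgebra, `h₂` and `h₃` may be exchanged in `h₁ ⊗ h₂ ⊗ h₃`. -/
theorem comul₃_swap₂₃ {F G : (H ⊗[k] H) ⊗[k] H →ₗ[k] X}
    (h : ∀ a b c, F ((a ⊗ₜ b) ⊗ₜ c) = G ((a ⊗ₜ c) ⊗ₜ b)) : F ∘ₗ comul₃ k H = G ∘ₗ comul₃ k H := by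
  have h1 : F ∘ₗ (TensorProduct.assoc k H H H).symm.toLinearMap =
      (G ∘ₗ (TensorProduct.assoc k H H H).symm.toLinearMap) ∘ₗ
        TensorProduct.map LinearMap.id (TensorProduct.comm k H H).toLinearMap := by
    ext a b c
    exact h a b c
  have h2 : TensorProduct.map LinearMap.id (TensorProduct.comm k H H).toLinearMap ∘ₗ
      TensorProduct.map LinearMap.id (Coalgebra.comul (R := k)) ∘ₗ Coalgebra.comul =
      TensorProduct.map LinearMap.id (Coalgebra.comul (R := k)) ∘ₗ Coalgebra.comul := by
    rw [← LinearMap.comp_assoc, ← TensorProduct.map_comp, LinearMap.comp_id]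
    congr 2
    exact Coalgebra.IsCocomm.comm_comp_comul
  have h3 : comul₃ k H = (TensorProduct.assoc k H H H).symm.toLinearMap ∘ₗ
      TensorProduct.map LinearMap.id (Coalgebra.comul (R := k)) ∘ₗ Coalgebra.comul := by
    rw [map_id_comul_comul]
    ext c
    simp
  rw [h3, ← LinearMap.comp_assoc, h1, LinearMap.comp_assoc, h2, LinearMap.comp_assoc]

end TripleComul

/-! ### Colinear maps and averaging by a total integral -/

section Colinear

variable {k : Type u} [Field k] {H : Type v} [Ring H] [HopfAlgebra k H]
  {X : Type*} [AddCommGroup X] [Module k X] {Y : Type*} [AddCommGroup Y] [Module k Y]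

/-- Colinearity in the second leg of `s : H → X ⊗ Y`, `s(h) = ∑ x ⊗ y`, twisted by `θ : H → H`:
`∑ x ⊗ δ(y) = s(h₁) ⊗ θ(h₂)`. Only `θ = id` and `θ = S` occur. -/
def IsColinear (δ : Y →ₗ[k] Y ⊗[k] H) (θ : H →ₗ[k] H) (s : H →ₗ[k] X ⊗[k] Y) : Prop :=
  TensorProduct.map LinearMap.id δ ∘ₗ s =
    (TensorProduct.assoc k X Y H).toLinearMap ∘ₗ TensorProduct.map s θ ∘ₗ Coalgebra.comul

/-- A map `s : H → X ⊗ Y` with the legs exchanged. -/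
def swapLegs (s : H →ₗ[k] X ⊗[k] Y) : H →ₗ[k] Y ⊗[k] X :=
  (TensorProduct.comm k X Y).toLinearMap ∘ₗ s

@[simp] theorem swapLegs_swapLegs (s : H →ₗ[k] X ⊗[k] Y) : swapLegs (swapLegs s) = s := by
  ext h
  simp [swapLegs]

namespace ComoduleAlgebra

variable {D : Type w} [Ring D] [Algebra k D] (ρ : ComoduleAlgebra k H D)

/-- A total integral: an `H`-colinear map `H → D` that preserves `1`. -/
structure IsTotalIntegral (φ : H →ₗ[k] D) : Prop where
  colinear : ρ.coact.toLinearMap ∘ₗ φ = TensorProduct.map φ LinearMap.id ∘ₗ Coalgebra.comul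
  map_one : φ 1 = 1

/-- The linear map `D ⊗ D → D ⊗ H`, `a ⊗ b ↦ a b₀ ⊗ b₁`, which induces the canonical map. -/
def canLin : D ⊗[k] D →ₗ[k] D ⊗[k] H :=
  LinearMap.mul' k (D ⊗[k] H) ∘ₗ
    TensorProduct.map (Algebra.TensorProduct.includeLeft : D →ₐ[k] D ⊗[k] H).toLinearMap
      ρ.coact.toLinearMap

@[simp] theorem canLin_tmul (a b : D) : ρ.canLin (a ⊗ₜ b) = (a ⊗ₜ 1) * ρ.coact b := rfl

theorem coassoc_linear_apply (a : D) :
    TensorProduct.map ρ.coact.toLinearMap LinearMap.id (ρ.coact a) =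
      (TensorProduct.assoc k D H H).symm
        (TensorProduct.map LinearMap.id Coalgebra.comul (ρ.coact a)) :=
  ρ.coassoc_apply a

theorem counit_linear_apply (a : D) :
    TensorProduct.rid k D (TensorProduct.map LinearMap.id Coalgebra.counit (ρ.coact a)) = a :=
  congr($(ρ.counit) a)

/-- The map `D ⊗ H → D`, `d ⊗ h ↦ d φ(h)`. -/
def mulRightBy (φ : H →ₗ[k] D) : D ⊗[k] H →ₗ[k] D :=
  LinearMap.mul' k D ∘ₗ TensorProduct.map LinearMap.id φ

@[simp] theorem mulRightBy_tmul (φ : H →ₗ[k] D) (d : D) (h : H) :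
    mulRightBy φ (d ⊗ₜ h) = d * φ h := rfl

/-- The map `D ⊗ H → D`, `d ⊗ h ↦ d₀ φ(S(d₁) h)`. If `φ` is a total integral, it is a colinear
retraction of the coaction; for `H = k[G]` it
maps `d` of degree `g` to `d φ(g⁻¹h)`, which has degree `h`. -/
def retract (φ : H →ₗ[k] D) : D ⊗[k] H →ₗ[k] D :=
  mulRightBy φ ∘ₗ LinearMap.mul' k (D ⊗[k] H) ∘ₗ
    TensorProduct.map
      (TensorProduct.map LinearMap.id (HopfAlgebra.antipode k) ∘ₗ ρ.coact.toLinearMap)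
      (Algebra.TensorProduct.includeRight : H →ₐ[k] D ⊗[k] H).toLinearMap

theorem retract_tmul (φ : H →ₗ[k] D) (d : D) (h : H) :
    ρ.retract φ (d ⊗ₜ h) =
      mulRightBy φ (TensorProduct.map LinearMap.id (HopfAlgebra.antipode k) (ρ.coact d) *
        (1 ⊗ₜ h)) := rfl

theorem retract_one {φ : H →ₗ[k] D} (hφ : φ 1 = 1) : ρ.retract φ (1 ⊗ₜ 1) = 1 := by
  rw [retract_tmul, map_one, Algebra.TensorProduct.one_def, TensorProduct.map_tmul,
    Algebra.TensorProduct.tmul_mul_tmul, mulRightBy_tmul, HopfAlgebra.antipode_one]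
  simp [hφ]

section Cocomm

variable [Coalgebra.IsCocomm k H]

/-- `∑ (1 ⊗ c₁) Δ(S(c₂)) = S(c) ⊗ 1`. -/
theorem comul_mul_left_eq (c : H) :
    conv (Algebra.TensorProduct.includeRight : H →ₐ[k] H ⊗[k] H).toLinearMap
        (Coalgebra.comul ∘ₗ HopfAlgebra.antipode k) c =
      HopfAlgebra.antipode k c ⊗ₜ[k] (1 : H) := by
  set j := (Algebra.TensorProduct.includeRight : H →ₐ[k] H ⊗[k] H)
  set i := (Algebra.TensorProduct.includeLeft : H →ₐ[k] H ⊗[k] H)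
  set S := HopfAlgebra.antipode k (A := H)
  have h1 : Coalgebra.comul ∘ₗ S = conv (i.toLinearMap ∘ₗ S) (j.toLinearMap ∘ₗ S) := by
    rw [comul_antipode, conv, ← LinearMap.comp_assoc]
    congr 1
    ext a b
    simp [i, j, S]
  have h2 : conv j.toLinearMap (j.toLinearMap ∘ₗ S) = convUnit k H (H ⊗[k] H) := by
    have := comp_conv j LinearMap.id S
    rw [id_conv_antipode, comp_convUnit, LinearMap.comp_id] at this
    exact this.symm
  rw [h1, conv_comm (i.toLinearMap ∘ₗ S), ← conv_assoc, h2, convUnit_conv]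
  · rfl
  · intro x y
    simp [i, j, Commute, SemiconjBy]

/-- `∑ (1 ⊗ c₁) ρ(φ(S(c₂) h)) = ∑ φ(S(c) h₁) ⊗ h₂`. -/
theorem coact_retract_aux {φ : H →ₗ[k] D} (hφ : ρ.IsTotalIntegral φ) (h c : H) :
    conv (Algebra.TensorProduct.includeRight : H →ₐ[k] D ⊗[k] H).toLinearMap
        (ρ.coact.toLinearMap ∘ₗ φ ∘ₗ (LinearMap.mul k H).flip h ∘ₗ HopfAlgebra.antipode k) c =
      TensorProduct.map φ LinearMap.id ((HopfAlgebra.antipode k c ⊗ₜ 1) * Coalgebra.comul h) := by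
  set S := HopfAlgebra.antipode k (A := H)
  set ψ : H ⊗[k] H →ₗ[k] D ⊗[k] H := TensorProduct.map φ LinearMap.id ∘ₗ
    (LinearMap.mul k (H ⊗[k] H)).flip (Coalgebra.comul h) with hψ
  have h1 : ρ.coact.toLinearMap ∘ₗ φ ∘ₗ (LinearMap.mul k H).flip h ∘ₗ S =
      ψ ∘ₗ Coalgebra.comul ∘ₗ S := by
    rw [← LinearMap.comp_assoc, hφ.colinear]
    ext c
    simp [ψ]
  have h2 (a : H) (t : H ⊗[k] H) : ((1 : D) ⊗ₜ[k] a) * TensorProduct.map φ LinearMap.id t =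
      TensorProduct.map φ LinearMap.id ((1 ⊗ₜ a) * t) := by
    induction t using TensorProduct.induction_on with
    | zero => simp
    | add y z hy hz => simp only [map_add, mul_add, hy, hz]
    | tmul x y => simp
  have h3 (g : H →ₗ[k] H ⊗[k] H) (z : H ⊗[k] H) : LinearMap.mul' k (D ⊗[k] H)
      (TensorProduct.map (Algebra.TensorProduct.includeRight : H →ₐ[k] D ⊗[k] H).toLinearMap
        (ψ ∘ₗ g) z) =
      ψ (LinearMap.mul' k (H ⊗[k] H) (TensorProduct.map
        (Algebra.TensorProduct.includeRight : H →ₐ[k] H ⊗[k] H).toLinearMap g z)) := by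
    induction z using TensorProduct.induction_on with
    | zero => simp
    | add y z hy hz => simp only [map_add, hy, hz]
    | tmul x y =>
      have := h2 x (g y * Coalgebra.comul h)
      rw [← mul_assoc] at this
      exact this
  rw [h1]
  refine (h3 _ _).trans ?_
  exact congr(ψ $(comul_mul_left_eq (k := k) c))

/-- For a total integral `φ`, the map `d ⊗ h ↦ d₀ φ(S(d₁) h)` is colinear. -/
theorem coact_retract {φ : H →ₗ[k] D} (hφ : ρ.IsTotalIntegral φ) :
    ρ.coact.toLinearMap ∘ₗ ρ.retract φ =
      TensorProduct.map (ρ.retract φ) LinearMap.id ∘ₗ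
        (TensorProduct.assoc k D H H).symm.toLinearMap ∘ₗ
          TensorProduct.map LinearMap.id Coalgebra.comul := by
  set S := HopfAlgebra.antipode k (A := H)
  refine TensorProduct.ext' fun d h ↦ ?_
  set G : (D ⊗[k] H) ⊗[k] H →ₗ[k] D ⊗[k] H := LinearMap.mul' k (D ⊗[k] H) ∘ₗ
    TensorProduct.map LinearMap.id
      (ρ.coact.toLinearMap ∘ₗ φ ∘ₗ (LinearMap.mul k H).flip h ∘ₗ S)
  have h1 (z : D ⊗[k] H) : ρ.coact (mulRightBy φ (TensorProduct.map LinearMap.id S z *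
      (1 ⊗ₜ h))) = G (TensorProduct.map ρ.coact.toLinearMap LinearMap.id z) := by
    induction z using TensorProduct.induction_on with
    | zero => simp
    | add y z hy hz => simp only [map_add, add_mul, hy, hz]
    | tmul d c => simp [G]
  have h2 (d : D) (c : H) : G ((TensorProduct.assoc k D H H).symm
        (d ⊗ₜ (Coalgebra.comul c))) =
      (d ⊗ₜ 1) * TensorProduct.map φ LinearMap.id ((S c ⊗ₜ 1) * Coalgebra.comul h) := by
    rw [← ρ.coact_retract_aux hφ h c]
    simp only [conv, LinearMap.comp_apply]
    induction Coalgebra.comul (R := k) c using TensorProduct.induction_on with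
    | zero => simp
    | add y z hy hz => simp only [TensorProduct.tmul_add, map_add, mul_add, hy, hz]
    | tmul x y =>
      simp only [TensorProduct.assoc_symm_tmul, G, LinearMap.comp_apply, TensorProduct.map_tmul,
        LinearMap.mul'_apply, LinearMap.id_apply, AlgHom.toLinearMap_apply,
        Algebra.TensorProduct.includeRight_apply, ← mul_assoc,
        Algebra.TensorProduct.tmul_mul_tmul, mul_one, one_mul]
      rfl
  have h3 (z : D ⊗[k] H) : G ((TensorProduct.assoc k D H H).symm
        (TensorProduct.map LinearMap.id Coalgebra.comul z)) =
      TensorProduct.map (mulRightBy φ ∘ₗ LinearMap.mul' k (D ⊗[k] H) ∘ₗ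
        TensorProduct.mk k _ _ (TensorProduct.map LinearMap.id S z) ∘ₗ
        (Algebra.TensorProduct.includeRight : H →ₐ[k] D ⊗[k] H).toLinearMap) LinearMap.id
        (Coalgebra.comul h) := by
    induction z using TensorProduct.induction_on with
    | zero => simp
    | add y z hy hz =>
      simp only [map_add, hy, hz, LinearMap.add_comp, LinearMap.comp_add,
        TensorProduct.map_add_left, LinearMap.add_apply]
    | tmul d c =>
      rw [TensorProduct.map_tmul, LinearMap.id_apply, h2]
      induction Coalgebra.comul (R := k) h using TensorProduct.induction_on with
      | zero => simp
      | add y z hy hz => simp only [map_add, mul_add, hy, hz]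
      | tmul x y => simp
  rw [LinearMap.comp_apply, retract_tmul]
  refine (h1 _).trans ?_
  rw [coassoc_linear_apply, h3]
  simp only [LinearMap.comp_apply, TensorProduct.map_tmul, LinearMap.id_apply]
  induction Coalgebra.comul (R := k) h using TensorProduct.induction_on with
  | zero => simp
  | add y z hy hz => simp only [map_add, hy, hz, TensorProduct.tmul_add]
  | tmul x y =>
    simp [retract_tmul, S]

end Cocomm

/-- The average of `s : H → X ⊗ D` by `φ : H → D` in the second leg:
`h ↦ ∑ x ⊗ d₀ φ(S(d₁) h₂)` with `s(h₁) = ∑ x ⊗ d`. -/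
def average (φ : H →ₗ[k] D) (s : H →ₗ[k] X ⊗[k] D) : H →ₗ[k] X ⊗[k] D :=
  TensorProduct.map LinearMap.id (ρ.retract φ) ∘ₗ (TensorProduct.assoc k X D H).toLinearMap ∘ₗ
    TensorProduct.map s LinearMap.id ∘ₗ Coalgebra.comul

theorem average_one {φ : H →ₗ[k] D} (hφ : φ 1 = 1) {s : H →ₗ[k] X ⊗[k] D} {a : X}
    (hs : s 1 = a ⊗ₜ 1) : ρ.average φ s 1 = a ⊗ₜ 1 := by
  simp [average, hs, ρ.retract_one hφ, Algebra.TensorProduct.one_def]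

theorem isColinear_average [Coalgebra.IsCocomm k H] {φ : H →ₗ[k] D} (hφ : ρ.IsTotalIntegral φ)
    (s : H →ₗ[k] X ⊗[k] D) :
    IsColinear ρ.coact.toLinearMap LinearMap.id (ρ.average φ s) := by
  have h1 : TensorProduct.map LinearMap.id ρ.coact.toLinearMap ∘ₗ ρ.average φ s =
      ((TensorProduct.map LinearMap.id
        (TensorProduct.map (ρ.retract φ) LinearMap.id ∘ₗ
          (TensorProduct.assoc k D H H).symm.toLinearMap) ∘ₗ
        (TensorProduct.assoc k X D (H ⊗[k] H)).toLinearMap ∘ₗ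
        TensorProduct.map s LinearMap.id) ∘ₗ (TensorProduct.assoc k H H H).toLinearMap) ∘ₗ
          comul₃ k H := by
    rw [LinearMap.comp_assoc, ← map_id_comul_comul]
    simp only [average, ← LinearMap.comp_assoc]
    rw [← TensorProduct.map_comp, coact_retract _ hφ]
    congr 1
    ext a b
    simp only [TensorProduct.AlgebraTensorModule.curry_apply, TensorProduct.curry_apply,
      LinearMap.coe_restrictScalars, LinearMap.comp_apply, TensorProduct.map_tmul,
      LinearMap.id_apply, LinearEquiv.coe_coe]
    induction s a using TensorProduct.induction_on with
    | zero => simp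
    | add y z hy hz => simp only [map_add, hy, hz, TensorProduct.add_tmul]
    | tmul x y => simp
  have h2 : TensorProduct.map (ρ.average φ s) LinearMap.id ∘ₗ Coalgebra.comul =
      TensorProduct.map (TensorProduct.map LinearMap.id (ρ.retract φ) ∘ₗ
        (TensorProduct.assoc k X D H).toLinearMap ∘ₗ TensorProduct.map s LinearMap.id)
        LinearMap.id ∘ₗ comul₃ k H := by
    rw [← map_comp_comul_comul]
    rfl
  rw [IsColinear, h1, h2, ← LinearMap.comp_assoc (comul₃ k H)]
  refine comul₃_congr fun a b c ↦ ?_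
  simp only [LinearMap.comp_apply, TensorProduct.map_tmul, LinearMap.id_apply,
    LinearEquiv.coe_coe, TensorProduct.assoc_tmul]
  induction s a using TensorProduct.induction_on with
  | zero => simp
  | add y z hy hz => simp only [map_add, hy, hz, TensorProduct.add_tmul]
  | tmul x y => simp

/-- Averaging in the second leg preserves colinearity in the first leg. -/
theorem isColinear_swapLegs_average [Coalgebra.IsCocomm k H] (φ : H →ₗ[k] D)
    (s : H →ₗ[k] X ⊗[k] D) {δ : X →ₗ[k] X ⊗[k] H} {θ : H →ₗ[k] H}
    (hs : IsColinear δ θ (swapLegs s)) : IsColinear δ θ (swapLegs (ρ.average φ s)) := by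
  have h1 : TensorProduct.map LinearMap.id δ ∘ₗ swapLegs (ρ.average φ s) =
      ((TensorProduct.map (ρ.retract φ) LinearMap.id ∘ₗ
        (TensorProduct.rightComm k D (X ⊗[k] H) H).toLinearMap) ∘ₗ
        TensorProduct.map ((TensorProduct.assoc k D X H).toLinearMap ∘ₗ
          TensorProduct.map (swapLegs s) θ) LinearMap.id) ∘ₗ comul₃ k H := by
    have e : TensorProduct.map LinearMap.id δ ∘ₗ (TensorProduct.comm k X D).toLinearMap ∘ₗ
        TensorProduct.map LinearMap.id (ρ.retract φ) ∘ₗ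
          (TensorProduct.assoc k X D H).toLinearMap =
        (TensorProduct.map (ρ.retract φ) LinearMap.id ∘ₗ
        (TensorProduct.rightComm k D (X ⊗[k] H) H).toLinearMap) ∘ₗ
          TensorProduct.map (TensorProduct.map LinearMap.id δ ∘ₗ
            (TensorProduct.comm k X D).toLinearMap) LinearMap.id := by
      ext a d h
      simp
    calc _ = (TensorProduct.map LinearMap.id δ ∘ₗ (TensorProduct.comm k X D).toLinearMap ∘ₗ
        TensorProduct.map LinearMap.id (ρ.retract φ) ∘ₗ
          (TensorProduct.assoc k X D H).toLinearMap) ∘ₗ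
            TensorProduct.map s LinearMap.id ∘ₗ Coalgebra.comul := rfl
      _ = (TensorProduct.map (ρ.retract φ) LinearMap.id ∘ₗ
        (TensorProduct.rightComm k D (X ⊗[k] H) H).toLinearMap) ∘ₗ
          TensorProduct.map (TensorProduct.map LinearMap.id δ ∘ₗ swapLegs s) LinearMap.id ∘ₗ
            Coalgebra.comul := by
        rw [e, LinearMap.comp_assoc, ← LinearMap.comp_assoc _ (TensorProduct.map s _),
          ← TensorProduct.map_comp]
        rfl
      _ = _ := by
        rw [hs, LinearMap.comp_assoc (comul₃ k H), ← map_comp_comul_comul]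
        rfl
  have h2 : TensorProduct.map (swapLegs (ρ.average φ s)) θ ∘ₗ Coalgebra.comul =
      TensorProduct.map ((TensorProduct.comm k X D).toLinearMap ∘ₗ
        TensorProduct.map LinearMap.id (ρ.retract φ) ∘ₗ
        (TensorProduct.assoc k X D H).toLinearMap ∘ₗ TensorProduct.map s LinearMap.id)
        θ ∘ₗ comul₃ k H := by
    rw [← map_comp_comul_comul]
    rfl
  rw [IsColinear, h1, h2, ← LinearMap.comp_assoc (comul₃ k H)]
  refine comul₃_swap₂₃ fun a b c ↦ ?_
  simp only [LinearMap.comp_apply, TensorProduct.map_tmul, LinearMap.id_apply,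
    LinearEquiv.coe_coe, swapLegs]
  induction s a using TensorProduct.induction_on with
  | zero => simp
  | add y z hy hz => simp only [map_add, hy, hz, TensorProduct.add_tmul]
  | tmul x y => simp

/-- If `can(s(h)) = 1 ⊗ h`, then the average of `s` multiplies to `ε`: it maps `h` to
`φ(S(h₁) h₂)`. -/
theorem mul_average {φ : H →ₗ[k] D} (hφ : φ 1 = 1) {s : H →ₗ[k] D ⊗[k] D}
    (hs : ∀ h, ρ.canLin (s h) = 1 ⊗ₜ h) :
    LinearMap.mul' k D ∘ₗ ρ.average φ s = convUnit k H D := by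
  set S := HopfAlgebra.antipode k (A := H)
  have h1 (t : D ⊗[k] D) (h : H) : LinearMap.mul' k D (TensorProduct.map LinearMap.id
      (ρ.retract φ) (TensorProduct.assoc k D D H (t ⊗ₜ h))) =
      mulRightBy φ (TensorProduct.map LinearMap.id S (ρ.canLin t) * (1 ⊗ₜ h)) := by
    induction t using TensorProduct.induction_on with
    | zero => simp
    | add y z hy hz => simp only [map_add, hy, hz, TensorProduct.add_tmul, add_mul]
    | tmul x y =>
      simp only [TensorProduct.assoc_tmul, TensorProduct.map_tmul, LinearMap.id_apply,
        LinearMap.mul'_apply, retract_tmul, canLin_tmul]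
      induction ρ.coact y using TensorProduct.induction_on with
      | zero => simp
      | add y z hy hz => simp only [map_add, mul_add, add_mul, hy, hz]
      | tmul y c => simp [mul_assoc, S]
  have h2 : LinearMap.mul' k D ∘ₗ ρ.average φ s =
      φ ∘ₗ conv S LinearMap.id := by
    simp only [average, conv, ← LinearMap.comp_assoc]
    congr 1
    refine TensorProduct.ext' fun a b ↦ ?_
    refine (h1 (s a) b).trans ?_
    rw [hs]
    simp [S]
  rw [h2, antipode_conv_id]
  ext h
  simp [convUnit, Algebra.algebraMap_eq_smul_one, hφ]

/-- A right colinear map `s : H → D ⊗ D` that multiplies to `ε` satisfies `can(s(h)) = 1 ⊗ h`. -/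
theorem canLin_of_isColinear {s : H →ₗ[k] D ⊗[k] D}
    (hs : IsColinear ρ.coact.toLinearMap LinearMap.id s)
    (hm : LinearMap.mul' k D ∘ₗ s = convUnit k H D) (h : H) : ρ.canLin (s h) = 1 ⊗ₜ h := by
  have e : ρ.canLin = TensorProduct.map (LinearMap.mul' k D) LinearMap.id ∘ₗ
      (TensorProduct.assoc k D D H).symm.toLinearMap ∘ₗ
        TensorProduct.map LinearMap.id ρ.coact.toLinearMap := by
    refine TensorProduct.ext' fun a b ↦ ?_
    simp only [canLin_tmul, LinearMap.comp_apply, TensorProduct.map_tmul, LinearMap.id_apply,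
      AlgHom.toLinearMap_apply]
    induction ρ.coact b using TensorProduct.induction_on with
    | zero => simp
    | add y z hy hz => simp only [map_add, mul_add, hy, hz, TensorProduct.tmul_add]
    | tmul y c => simp
  have h1 := congr($hs h)
  rw [e]
  simp only [LinearMap.comp_apply] at h1 ⊢
  rw [h1]
  simp only [LinearEquiv.coe_coe, LinearEquiv.symm_apply_apply]
  rw [map_map_apply, hm, LinearMap.comp_id]
  have h2 : TensorProduct.map (convUnit k H D) LinearMap.id (Coalgebra.comul h) =
      TensorProduct.map (Algebra.linearMap k D) LinearMap.id
        (LinearMap.rTensor H Coalgebra.counit (Coalgebra.comul h)) := by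
    rw [LinearMap.rTensor, map_map_apply]
    rfl
  rw [h2, Coalgebra.rTensor_counit_comul]
  simp

end ComoduleAlgebra

end Colinear

/-! ### Tensor products over a ring and faithful flatness -/

section Along

variable {k : Type u} [Field k] {R : Type x} [Ring R] [Algebra k R]
  {A : Type w} [Ring A] [Algebra k A] (ι : R →ₐ[k] A)

namespace TensorAlong

variable {M N P : Type*}
  [AddCommGroup M] [Module k M] [Module Rᵐᵒᵖ M]
  [AddCommGroup N] [Module k N] [Module Rᵐᵒᵖ N]
  [AddCommGroup P] [Module k P] [Module Rᵐᵒᵖ P]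

/-- The class of `m ⊗ a` in `M ⊗_R A`. -/
def mk (m : M) (a : A) : TensorAlong ι M := Submodule.Quotient.mk (m ⊗ₜ[k] a)

variable {ι} in
theorem induction_on {p : TensorAlong ι M → Prop} (t : TensorAlong ι M) (zero : p 0)
    (mk : ∀ m a, p (mk ι m a)) (add : ∀ s t, p s → p t → p (s + t)) : p t := by
  obtain ⟨t, rfl⟩ := Submodule.Quotient.mk_surjective _ t
  induction t using TensorProduct.induction_on with
  | zero => exact zero
  | tmul m a => exact mk m a
  | add s t hs ht => exact add _ _ hs ht

variable {ι} in
theorem hom_ext {Q : Type*} [AddCommGroup Q] [Module k Q] {f g : TensorAlong ι M →ₗ[k] Q}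
    (h : ∀ m a, f (mk ι m a) = g (mk ι m a)) : f = g := by
  refine LinearMap.ext fun t ↦ ?_
  induction t using induction_on with
  | zero => simp
  | mk m a => exact h m a
  | add s t hs ht => rw [map_add, map_add, hs, ht]

theorem mk_add_left (m m' : M) (a : A) : mk ι (m + m') a = mk ι m a + mk ι m' a := by
  rw [mk, TensorProduct.add_tmul]; rfl

theorem mk_add_right (m : M) (a a' : A) : mk ι m (a + a') = mk ι m a + mk ι m a' := by
  rw [mk, TensorProduct.tmul_add]; rfl

theorem mk_smul_left (c : k) (m : M) (a : A) : mk ι (c • m) a = c • mk ι m a := by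
  rw [mk, ← TensorProduct.smul_tmul']; rfl

theorem mk_smul_right (c : k) (m : M) (a : A) : mk ι m (c • a) = c • mk ι m a := by
  rw [mk, TensorProduct.tmul_smul]; rfl

theorem mk_op_smul (m : M) (r : R) (a : A) : mk ι (MulOpposite.op r • m) a = mk ι m (ι r * a) :=
  (Submodule.Quotient.eq _).2 (Submodule.subset_span ⟨m, r, a, rfl⟩)

theorem mk_sum_left {I : Type*} (s : Finset I) (m : I → M) (a : A) :
    mk ι (∑ i ∈ s, m i) a = ∑ i ∈ s, mk ι (m i) a := by
  rw [mk, TensorProduct.sum_tmul]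
  exact map_sum (Submodule.mkQ _) _ _

/-- The linear map on `M ⊗_R A` defined by a balanced bilinear map. -/
def lift {Q : Type*} [AddCommGroup Q] [Module k Q] (f : M →ₗ[k] A →ₗ[k] Q)
    (h : ∀ m (r : R) a, f (MulOpposite.op r • m) a = f m (ι r * a)) : TensorAlong ι M →ₗ[k] Q :=
  Submodule.liftQ _ (TensorProduct.lift f) <| by
    refine Submodule.span_le.2 ?_
    rintro _ ⟨m, r, a, rfl⟩
    simp [h]

/-- The linear map `m ↦ m ⊗ a`. -/
def mkₗ (a : A) : M →ₗ[k] TensorAlong ι M where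
  toFun m := mk ι m a
  map_add' _ _ := mk_add_left ι _ _ _
  map_smul' _ _ := mk_smul_left ι _ _ _

@[simp] theorem mkₗ_apply (m : M) (a : A) : mkₗ ι a m = mk ι m a := rfl

variable [IsScalarTower k Rᵐᵒᵖ M] [IsScalarTower k Rᵐᵒᵖ N] [IsScalarTower k Rᵐᵒᵖ P]

@[simp] theorem map_mk (f : M →ₗ[Rᵐᵒᵖ] N) (m : M) (a : A) :
    TensorAlong.map ι f (mk ι m a) = mk ι (f m) a := rfl

theorem map_map (g : N →ₗ[Rᵐᵒᵖ] P) (f : M →ₗ[Rᵐᵒᵖ] N) (t : TensorAlong ι M) :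
    TensorAlong.map ι g (TensorAlong.map ι f t) = TensorAlong.map ι (g ∘ₗ f) t := by
  induction t using induction_on with
  | zero => simp
  | mk m a => simp
  | add s t hs ht => simp only [map_add, hs, ht]

theorem map_id (t : TensorAlong ι M) : TensorAlong.map ι LinearMap.id t = t := by
  induction t using induction_on with
  | zero => simp
  | mk m a => simp
  | add s t hs ht => simp only [map_add, hs, ht]

theorem map_surjective {f : M →ₗ[Rᵐᵒᵖ] N} (hf : Function.Surjective f) :
    Function.Surjective (TensorAlong.map ι f) := by
  intro t
  induction t using induction_on with
  | zero => exact ⟨0, map_zero _⟩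
  | mk m a =>
    obtain ⟨m, rfl⟩ := hf m
    exact ⟨mk ι m a, rfl⟩
  | add s t hs ht =>
    obtain ⟨s, rfl⟩ := hs
    obtain ⟨t, rfl⟩ := ht
    exact ⟨s + t, map_add _ _ _⟩

/-- Right exactness of `- ⊗_R A`. -/
theorem exists_of_map_mkQ_eq_zero (K : Submodule Rᵐᵒᵖ M) (t : TensorAlong ι M)
    (h : TensorAlong.map ι K.mkQ t = 0) : ∃ s, TensorAlong.map ι K.subtype s = t := by
  obtain ⟨z, rfl⟩ := Submodule.Quotient.mk_surjective _ t
  set q : M ⊗[k] A →ₗ[k] (M ⧸ K) ⊗[k] A :=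
    TensorProduct.map (K.mkQ.restrictScalars k) LinearMap.id
  have h1 : q z ∈ balancedRel k (fun (m : M ⧸ K) (r : R) ↦ MulOpposite.op r • m)
      (fun (r : R) (a : A) ↦ ι r * a) := (Submodule.Quotient.mk_eq_zero _).1 h
  have h2 : balancedRel k (fun (m : M ⧸ K) (r : R) ↦ MulOpposite.op r • m)
      (fun (r : R) (a : A) ↦ ι r * a) ≤ (balancedRel k
        (fun (m : M) (r : R) ↦ MulOpposite.op r • m) (fun (r : R) (a : A) ↦ ι r * a)).map q := by
    refine Submodule.span_le.2 ?_
    rintro _ ⟨m, r, a, rfl⟩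
    obtain ⟨m, rfl⟩ := K.mkQ_surjective m
    exact ⟨_, Submodule.subset_span ⟨m, r, a, rfl⟩, by simp [q]⟩
  obtain ⟨b, hb, hbz⟩ := h2 h1
  have hex : Function.Exact (K.subtype.restrictScalars k) (K.mkQ.restrictScalars k) :=
    LinearMap.exact_subtype_mkQ K
  obtain ⟨y, hy⟩ := (rTensor_exact A hex K.mkQ_surjective (z - b)).1 (by
    change q (z - b) = 0
    rw [map_sub, hbz, sub_self])
  refine ⟨Submodule.Quotient.mk y, ?_⟩
  refine (Submodule.Quotient.eq _).2 ?_
  change LinearMap.rTensor A (K.subtype.restrictScalars k) y - z ∈ _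
  rw [hy, sub_sub_cancel_left]
  exact neg_mem hb

section Hom

variable {V : Type*} [AddCommGroup V] [Module k V]

variable (P) in
/-- The map `p ↦ (v ↦ β(v) p)`, as a map of right `R`-modules. -/
def coeval (β : V →ₗ[k] k) : P →ₗ[Rᵐᵒᵖ] (V →ₗ[k] P) where
  toFun p := β.smulRight p
  map_add' _ _ := by ext; simp
  map_smul' _ _ := LinearMap.ext fun _ ↦ smul_comm _ _ _

/-- The natural map `Hom(V, P) ⊗_R A → Hom(V, P ⊗_R A)`. -/
def homMap : TensorAlong ι (V →ₗ[k] P) →ₗ[k] (V →ₗ[k] TensorAlong ι P) :=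
  lift ι (LinearMap.mk₂ k
      (fun (f : V →ₗ[k] P) (a : A) ↦ mkₗ ι a ∘ₗ f)
      (fun _ _ _ ↦ LinearMap.ext fun _ ↦ mk_add_left ι _ _ _)
      (fun _ _ _ ↦ LinearMap.ext fun _ ↦ mk_smul_left ι _ _ _)
      (fun _ _ _ ↦ LinearMap.ext fun _ ↦ mk_add_right ι _ _ _)
      (fun _ _ _ ↦ LinearMap.ext fun _ ↦ mk_smul_right ι _ _ _))
    fun _ _ _ ↦ LinearMap.ext fun _ ↦ mk_op_smul ι _ _ _

@[simp] theorem homMap_mk (f : V →ₗ[k] P) (a : A) (v : V) :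
    homMap ι (mk ι f a) v = mk ι (f v) a := rfl

theorem homMap_bijective [Module.Finite k V] :
    Function.Bijective (homMap (V := V) (P := P) ι) := by
  let b := Module.finBasis k V
  set G : (V →ₗ[k] TensorAlong ι P) →ₗ[k] TensorAlong ι (V →ₗ[k] P) :=
    ∑ i, TensorAlong.map ι (coeval P (b.coord i)) ∘ₗ LinearMap.applyₗ (b i)
  refine Function.bijective_iff_has_inverse.2 ⟨G, fun t ↦ ?_, fun F ↦ ?_⟩
  · induction t using induction_on with
    | zero => simp
    | mk f a =>
      simp only [G, LinearMap.sum_apply, LinearMap.comp_apply, LinearMap.applyₗ_apply_apply,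
        homMap_mk, map_mk]
      have : ∑ i, coeval (R := R) P (b.coord i) (f (b i)) = f := by
        ext v
        have h1 := congrArg f (b.sum_repr v)
        rw [map_sum] at h1
        rw [LinearMap.sum_apply, ← h1]
        exact Finset.sum_congr rfl fun i _ ↦ (map_smul f _ _).symm
      rw [← mk_sum_left, this]
    | add s t hs ht => simp only [map_add, hs, ht]
  · refine b.ext fun j ↦ ?_
    simp only [G, LinearMap.sum_apply, LinearMap.comp_apply, LinearMap.applyₗ_apply_apply,
      map_sum]
    have h (i) (t : TensorAlong ι P) : homMap ι (TensorAlong.map ι (coeval P (b.coord i)) t) (b j) =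
        b.coord i (b j) • t := by
      induction t using induction_on with
      | zero => simp
      | mk p a => exact mk_smul_left ι _ _ _
      | add s t hs ht => simp only [map_add, LinearMap.add_apply, hs, ht, smul_add]
    simp only [h]
    simp [Finsupp.single_apply]

end Hom

section Tensor

variable {H : Type*} [AddCommGroup H] [Module k H]

/-- The natural map `(P ⊗ H) ⊗_R A → (P ⊗_R A) ⊗ H`. -/
def tensorMap : TensorAlong ι (P ⊗[k] H) →ₗ[k] TensorAlong ι P ⊗[k] H :=
  lift ι (LinearMap.mk₂ k
      (fun (t : P ⊗[k] H) (a : A) ↦ TensorProduct.map (mkₗ ι a) (LinearMap.id : H →ₗ[k] H) t)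
      (fun _ _ _ ↦ map_add _ _ _)
      (fun _ _ _ ↦ map_smul _ _ _)
      (fun t a a' ↦ by
        induction t using TensorProduct.induction_on with
        | zero => simp
        | tmul p h => simp [mk_add_right, TensorProduct.add_tmul]
        | add s t hs ht => simp only [map_add, hs, ht]; abel)
      (fun c t a ↦ by
        induction t using TensorProduct.induction_on with
        | zero => simp
        | tmul p h => simp [mk_smul_right, TensorProduct.smul_tmul']
        | add s t hs ht => simp only [map_add, hs, ht, smul_add]))
    fun t r a ↦ by
      induction t using TensorProduct.induction_on with
      | zero => simp
      | add s t hs ht => simp only [smul_add, map_add, LinearMap.add_apply, hs, ht]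
      | tmul p h =>
        rw [TensorProduct.smul_tmul']
        simp [mk_op_smul]

@[simp] theorem tensorMap_mk (p : P) (h : H) (a : A) :
    tensorMap ι (mk ι (p ⊗ₜ h) a) = mk ι p a ⊗ₜ h := rfl

theorem tensorMap_injective : Function.Injective (tensorMap (P := P) (H := H) ι) := by
  let j (h : H) : P →ₗ[Rᵐᵒᵖ] P ⊗[k] H :=
    { toFun := fun p ↦ p ⊗ₜ h
      map_add' := fun _ _ ↦ TensorProduct.add_tmul _ _ _
      map_smul' := fun _ _ ↦ rfl }
  have hj (h : H) (p : P) (a : A) : TensorAlong.map ι (j h) (mk ι p a) = mk ι (p ⊗ₜ h) a := rfl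
  set G : TensorAlong ι P ⊗[k] H →ₗ[k] TensorAlong ι (P ⊗[k] H) :=
    TensorProduct.lift (LinearMap.mk₂ k (fun t h ↦ TensorAlong.map ι (j h) t)
      (fun _ _ _ ↦ map_add _ _ _)
      (fun _ _ _ ↦ map_smul _ _ _)
      (fun t h h' ↦ by
        induction t using induction_on with
        | zero => simp
        | mk p a => simp [hj, mk_add_left, TensorProduct.tmul_add]
        | add s t hs ht => simp only [map_add, hs, ht]; abel)
      (fun c t h ↦ by
        induction t using induction_on with
        | zero => simp
        | mk p a => simp only [hj, TensorProduct.tmul_smul, mk_smul_left]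
        | add s t hs ht => simp only [map_add, hs, ht, smul_add]))
  refine Function.LeftInverse.injective (g := G) fun t ↦ ?_
  induction t using induction_on with
  | zero => simp
  | mk z a =>
    induction z using TensorProduct.induction_on with
    | zero =>
      have : mk ι (0 : P ⊗[k] H) a = 0 := by simp [mk]
      simp [this]
    | tmul p h => simp [G, hj]
    | add y z hy hz =>
      rw [mk_add_left, map_add, map_add, hy, hz]
  | add s t hs ht => simp only [map_add, hs, ht]

end Tensor

end TensorAlong

namespace IsLeftFaithfullyFlat

universe m m'

variable {ι}

/-- Faithful flatness, tested on modules of a large universe, holds for modules of a smaller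
universe. -/
theorem map_injective (hι : IsLeftFaithfullyFlat.{max m m'} ι) {M N : Type m'}
    [AddCommGroup M] [Module k M] [Module Rᵐᵒᵖ M] [IsScalarTower k Rᵐᵒᵖ M]
    [AddCommGroup N] [Module k N] [Module Rᵐᵒᵖ N] [IsScalarTower k Rᵐᵒᵖ N]
    {f : M →ₗ[Rᵐᵒᵖ] N} (hf : Function.Injective f) :
    Function.Injective (TensorAlong.map ι f) := by
  set e : ULift.{m} M ≃ₗ[Rᵐᵒᵖ] M := ULift.moduleEquiv
  set e' : ULift.{m} N ≃ₗ[Rᵐᵒᵖ] N := ULift.moduleEquiv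
  have h := hι.flat (ULift.{m} M) (ULift.{m} N) (e'.symm.toLinearMap ∘ₗ f ∘ₗ e.toLinearMap)
    (e'.symm.injective.comp (hf.comp e.injective))
  intro s t hst
  have h1 : TensorAlong.map ι e.symm.toLinearMap s = TensorAlong.map ι e.symm.toLinearMap t := by
    refine h ?_
    have e1 : (e'.symm.toLinearMap ∘ₗ f ∘ₗ e.toLinearMap) ∘ₗ e.symm.toLinearMap =
        e'.symm.toLinearMap ∘ₗ f := by ext; simp
    rw [TensorAlong.map_map, TensorAlong.map_map, e1, ← TensorAlong.map_map,
      ← TensorAlong.map_map, hst]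
  have h2 := congrArg (TensorAlong.map ι e.toLinearMap) h1
  have e2 : e.toLinearMap ∘ₗ e.symm.toLinearMap = LinearMap.id := by ext; simp
  rwa [TensorAlong.map_map, TensorAlong.map_map, e2, TensorAlong.map_id,
    TensorAlong.map_id] at h2

theorem subsingleton (hι : IsLeftFaithfullyFlat.{max m m'} ι) (M : Type m')
    [AddCommGroup M] [Module k M] [Module Rᵐᵒᵖ M] [IsScalarTower k Rᵐᵒᵖ M]
    (h : ∀ t : TensorAlong ι M, t = 0) : Subsingleton M := by
  set e : ULift.{m} M ≃ₗ[Rᵐᵒᵖ] M := ULift.moduleEquiv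
  have : Subsingleton (ULift.{m} M) := by
    refine hι.faithful _ (subsingleton_of_forall_eq 0 fun t ↦ ?_)
    have e1 : e.symm.toLinearMap ∘ₗ e.toLinearMap = LinearMap.id := by ext; simp
    rw [← TensorAlong.map_id ι t, ← e1, ← TensorAlong.map_map, h (TensorAlong.map ι _ t), map_zero]
  exact e.symm.injective.subsingleton

/-- Exactness of `- ⊗_R A` in the middle of `L → M → N`. -/
theorem exists_of_map_eq_zero (hι : IsLeftFaithfullyFlat.{max m m'} ι) {L M N : Type m'}
    [AddCommGroup L] [Module k L] [Module Rᵐᵒᵖ L] [IsScalarTower k Rᵐᵒᵖ L]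
    [AddCommGroup M] [Module k M] [Module Rᵐᵒᵖ M] [IsScalarTower k Rᵐᵒᵖ M]
    [AddCommGroup N] [Module k N] [Module Rᵐᵒᵖ N] [IsScalarTower k Rᵐᵒᵖ N]
    (i : L →ₗ[Rᵐᵒᵖ] M) (d : M →ₗ[Rᵐᵒᵖ] N) (hid : ∀ m, d m = 0 → ∃ l, i l = m)
    (t : TensorAlong ι M) (h : TensorAlong.map ι d t = 0) : ∃ s, TensorAlong.map ι i s = t := by
  have h1 : TensorAlong.map ι (LinearMap.ker d).mkQ t = 0 := by
    set d' : (M ⧸ LinearMap.ker d) →ₗ[Rᵐᵒᵖ] N := (LinearMap.ker d).liftQ d le_rfl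
    have hd' : Function.Injective d' :=
      LinearMap.ker_eq_bot.1 (Submodule.ker_liftQ_eq_bot' _ _ rfl)
    refine map_injective.{u, w, x, m, m'} hι hd' ?_
    rw [TensorAlong.map_map, map_zero, ← h]
    congr 1
  obtain ⟨s, rfl⟩ := TensorAlong.exists_of_map_mkQ_eq_zero ι _ t h1
  clear h h1
  induction s using TensorAlong.induction_on with
  | zero => exact ⟨0, by simp⟩
  | mk m a =>
    obtain ⟨l, hl⟩ := hid m.1 m.2
    exact ⟨TensorAlong.mk ι l a, by rw [TensorAlong.map_mk, hl]; rfl⟩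
  | add s t hs ht =>
    obtain ⟨s', hs⟩ := hs
    obtain ⟨t', ht⟩ := ht
    exact ⟨s' + t', by rw [map_add, map_add, hs, ht]⟩

/-- Tensoring with `A` reflects surjectivity. -/
theorem surjective_of_map (hι : IsLeftFaithfullyFlat.{max m m'} ι) {M N : Type m'}
    [AddCommGroup M] [Module k M] [Module Rᵐᵒᵖ M] [IsScalarTower k Rᵐᵒᵖ M]
    [AddCommGroup N] [Module k N] [Module Rᵐᵒᵖ N] [IsScalarTower k Rᵐᵒᵖ N]
    (f : M →ₗ[Rᵐᵒᵖ] N) (hf : Function.Surjective (TensorAlong.map ι f)) :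
    Function.Surjective f := by
  have hC : Subsingleton (N ⧸ LinearMap.range f) := by
    refine subsingleton.{u, w, x, m, m'} hι _ fun t ↦ ?_
    obtain ⟨s, rfl⟩ := TensorAlong.map_surjective ι (LinearMap.range f).mkQ_surjective t
    obtain ⟨q, rfl⟩ := hf s
    rw [TensorAlong.map_map, LinearMap.range_mkQ_comp]
    induction q using TensorAlong.induction_on with
    | zero => simp
    | mk m a =>
      rw [TensorAlong.map_mk, LinearMap.zero_apply, ← TensorAlong.mkₗ_apply, map_zero]
    | add s t hs ht => rw [map_add, hs, ht, add_zero]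
  exact LinearMap.range_eq_top.1 (Submodule.Quotient.subsingleton_iff.1 hC)

end IsLeftFaithfullyFlat

end Along

/-! ### Extension of colinear maps into a faithfully flat Galois extension -/

/-- A right `H`-coaction on the vector space `V`. -/
structure IsCoaction {k : Type*} [Field k] {H : Type*} [AddCommGroup H] [Module k H]
    [Coalgebra k H] {V : Type*} [AddCommGroup V] [Module k V] (δ : V →ₗ[k] V ⊗[k] H) : Prop where
  coassoc : (TensorProduct.assoc k V H H).toLinearMap ∘ₗ TensorProduct.map δ LinearMap.id ∘ₗ δ =
    TensorProduct.map LinearMap.id Coalgebra.comul ∘ₗ δ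
  counit : (TensorProduct.rid k V).toLinearMap ∘ₗ
    TensorProduct.map LinearMap.id Coalgebra.counit ∘ₗ δ = LinearMap.id

namespace ComoduleAlgebra

variable {k : Type u} [Field k] {H : Type v} [Ring H] [HopfAlgebra k H]
  {A : Type w} [Ring A] [Algebra k A] (ρ : ComoduleAlgebra k H A)

/-- To prove `G(a₀ ⊗ a₁ ⊗ a₂) = g(a)` it suffices that `G(d ⊗ c₁ ⊗ c₂) = ε(c) g(d)`. -/
theorem coassoc_elim {X : Type*} [AddCommGroup X] [Module k X]
    (G : (A ⊗[k] H) ⊗[k] H →ₗ[k] X) (g : A →ₗ[k] X)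
    (h : ∀ d c, G ((TensorProduct.assoc k A H H).symm (d ⊗ₜ Coalgebra.comul c)) =
      Coalgebra.counit (R := k) c • g d) (a : A) :
    G (TensorProduct.map ρ.coact.toLinearMap LinearMap.id (ρ.coact a)) = g a := by
  rw [coassoc_linear_apply]
  conv_rhs => rw [← ρ.counit_linear_apply a]
  induction ρ.coact a using TensorProduct.induction_on with
  | zero => simp
  | add y z hy hz => simp only [map_add, hy, hz]
  | tmul d c => simp [h]

section Flip

/-- The map `A ⊗ H → A ⊗ H`, `a ⊗ h ↦ a₀ ⊗ a₁ S(h)`, which carries `a b₀ ⊗ b₁` to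
`a₀ b ⊗ a₁`. -/
def flipEquivFun : A ⊗[k] H →ₗ[k] A ⊗[k] H :=
  LinearMap.mul' k (A ⊗[k] H) ∘ₗ TensorProduct.map ρ.coact.toLinearMap
    ((Algebra.TensorProduct.includeRight : H →ₐ[k] A ⊗[k] H).toLinearMap ∘ₗ
      HopfAlgebra.antipode k)

/-- The map `A ⊗ H → A ⊗ H`, `a ⊗ h ↦ a₀ ⊗ S(h) a₁`. -/
def flipEquivInv : A ⊗[k] H →ₗ[k] A ⊗[k] H :=
  LinearMap.mul' k (A ⊗[k] H) ∘ₗ (TensorProduct.comm k _ _).toLinearMap ∘ₗ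
    TensorProduct.map ρ.coact.toLinearMap
    ((Algebra.TensorProduct.includeRight : H →ₐ[k] A ⊗[k] H).toLinearMap ∘ₗ
      HopfAlgebra.antipode k)

@[simp] theorem flipEquivFun_tmul (a : A) (h : H) :
    ρ.flipEquivFun (a ⊗ₜ h) = ρ.coact a * (1 ⊗ₜ HopfAlgebra.antipode k h) := rfl

@[simp] theorem flipEquivInv_tmul (a : A) (h : H) :
    ρ.flipEquivInv (a ⊗ₜ h) = (1 ⊗ₜ HopfAlgebra.antipode k h) * ρ.coact a := rfl

theorem flipEquivFun_coact (a : A) : ρ.flipEquivFun (ρ.coact a) = a ⊗ₜ 1 := by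
  have h := ρ.coassoc_elim (LinearMap.mul' k (A ⊗[k] H) ∘ₗ TensorProduct.map LinearMap.id
    ((Algebra.TensorProduct.includeRight : H →ₐ[k] A ⊗[k] H).toLinearMap ∘ₗ
      HopfAlgebra.antipode k))
    (Algebra.TensorProduct.includeLeft : A →ₐ[k] A ⊗[k] H).toLinearMap ?_ a
  · simp only [LinearMap.comp_apply, map_map_apply, LinearMap.id_comp, LinearMap.comp_id] at h
    exact h
  · intro d c
    have h1 (t : H ⊗[k] H) : LinearMap.mul' k (A ⊗[k] H) (TensorProduct.map LinearMap.id
        ((Algebra.TensorProduct.includeRight : H →ₐ[k] A ⊗[k] H).toLinearMap ∘ₗ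
        HopfAlgebra.antipode k) ((TensorProduct.assoc k A H H).symm (d ⊗ₜ t))) =
        d ⊗ₜ LinearMap.mul' k H (LinearMap.lTensor H (HopfAlgebra.antipode k) t) := by
      induction t using TensorProduct.induction_on with
      | zero => simp
      | add y z hy hz => simp only [TensorProduct.tmul_add, map_add, hy, hz]
      | tmul x y => simp
    refine (h1 _).trans ?_
    rw [HopfAlgebra.mul_antipode_lTensor_comul_apply]
    simp [Algebra.algebraMap_eq_smul_one]

variable [Coalgebra.IsCocomm k H]

theorem flipEquivInv_coact (a : A) : ρ.flipEquivInv (ρ.coact a) = a ⊗ₜ 1 := by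
  have h := ρ.coassoc_elim (LinearMap.mul' k (A ⊗[k] H) ∘ₗ (TensorProduct.comm k _ _).toLinearMap ∘ₗ
    TensorProduct.map LinearMap.id
    ((Algebra.TensorProduct.includeRight : H →ₐ[k] A ⊗[k] H).toLinearMap ∘ₗ
      HopfAlgebra.antipode k))
    (Algebra.TensorProduct.includeLeft : A →ₐ[k] A ⊗[k] H).toLinearMap ?_ a
  · simp only [LinearMap.comp_apply, map_map_apply, LinearMap.id_comp, LinearMap.comp_id] at h
    exact h
  · intro d c
    have h1 (t : H ⊗[k] H) : LinearMap.mul' k (A ⊗[k] H) (TensorProduct.comm k _ _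
        (TensorProduct.map LinearMap.id
        ((Algebra.TensorProduct.includeRight : H →ₐ[k] A ⊗[k] H).toLinearMap ∘ₗ
        HopfAlgebra.antipode k) ((TensorProduct.assoc k A H H).symm (d ⊗ₜ t)))) =
        d ⊗ₜ LinearMap.mul' k H (LinearMap.rTensor H (HopfAlgebra.antipode k)
          (TensorProduct.comm k H H t)) := by
      induction t using TensorProduct.induction_on with
      | zero => simp
      | add y z hy hz => simp only [TensorProduct.tmul_add, map_add, hy, hz]
      | tmul x y => simp
    refine (h1 _).trans ?_
    rw [Coalgebra.comm_comul, HopfAlgebra.mul_antipode_rTensor_comul_apply]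
    simp [Algebra.algebraMap_eq_smul_one]

theorem flipEquivFun_bijective : Function.Bijective ρ.flipEquivFun := by
  refine Function.bijective_iff_has_inverse.2 ⟨ρ.flipEquivInv, fun t ↦ ?_, fun t ↦ ?_⟩
  · induction t using TensorProduct.induction_on with
    | zero => simp
    | add y z hy hz => simp only [map_add, hy, hz]
    | tmul a h =>
      have h1 (t : A ⊗[k] H) : ρ.flipEquivInv (t * (1 ⊗ₜ HopfAlgebra.antipode k h)) =
          (1 ⊗ₜ h) * ρ.flipEquivInv t := by
        induction t using TensorProduct.induction_on with
        | zero => simp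
        | add y z hy hz => simp only [add_mul, mul_add, map_add, hy, hz]
        | tmul x y =>
          simp [HopfAlgebra.antipode_mul_antidistrib, antipode_antipode, ← mul_assoc]
      rw [flipEquivFun_tmul, h1, flipEquivInv_coact]
      simp
  · induction t using TensorProduct.induction_on with
    | zero => simp
    | add y z hy hz => simp only [map_add, hy, hz]
    | tmul a h =>
      have h1 (t : A ⊗[k] H) : ρ.flipEquivFun ((1 ⊗ₜ HopfAlgebra.antipode k h) * t) =
          ρ.flipEquivFun t * (1 ⊗ₜ h) := by
        induction t using TensorProduct.induction_on with
        | zero => simp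
        | add y z hy hz => simp only [add_mul, mul_add, map_add, hy, hz]
        | tmul x y =>
          simp [HopfAlgebra.antipode_mul_antidistrib, antipode_antipode, mul_assoc]
      rw [flipEquivInv_tmul, h1, flipEquivFun_coact]
      simp

end Flip

section Extension

variable {R : Type x} [Ring R] [Algebra k R] {ι : R →ₐ[k] A}
  [Module Rᵐᵒᵖ A]

/-- The map `A ⊗_R A → A ⊗ H`, `a ⊗ b ↦ a₀ b ⊗ a₁`. -/
def canFlip (hr : ∀ (r : R) (a : A), MulOpposite.op r • a = a * ι r)
    (hι : ι.range ≤ ρ.coinvariants) : TensorAlong ι A →ₗ[k] A ⊗[k] H :=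
  TensorAlong.lift ι (LinearMap.mk₂ k (fun a b ↦ ρ.coact a * (b ⊗ₜ 1))
    (fun _ _ _ ↦ by rw [map_add, add_mul])
    (fun _ _ _ ↦ by rw [map_smul, smul_mul_assoc])
    (fun _ _ _ ↦ by rw [TensorProduct.add_tmul, mul_add])
    (fun _ _ _ ↦ by rw [← TensorProduct.smul_tmul', mul_smul_comm])) fun a r b ↦ by
      have h : ρ.coact (ι r) = ι r ⊗ₜ[k] 1 := hι ⟨r, rfl⟩
      simp [hr, h, mul_assoc]

@[simp] theorem canFlip_mk (hr : ∀ (r : R) (a : A), MulOpposite.op r • a = a * ι r)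
    (hι : ι.range ≤ ρ.coinvariants) (a b : A) :
    ρ.canFlip hr hι (TensorAlong.mk ι a b) = ρ.coact a * (b ⊗ₜ 1) := rfl

theorem canFlip_bijective [Coalgebra.IsCocomm k H]
    (hr : ∀ (r : R) (a : A), MulOpposite.op r • a = a * ι r)
    (hι : ι.range ≤ ρ.coinvariants) (hcan : Function.Bijective (ρ.can ι hι)) :
    Function.Bijective (ρ.canFlip hr hι) := by
  set e : TensorAlong ι A →ₗ[k] SelfTensor ι :=
    BalancedTensor.map LinearMap.id LinearMap.id (fun _ _ ↦ hr _ _) (fun _ _ ↦ rfl)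
  set e' : SelfTensor ι →ₗ[k] TensorAlong ι A :=
    BalancedTensor.map LinearMap.id LinearMap.id (fun _ _ ↦ (hr _ _).symm) (fun _ _ ↦ rfl)
  have he : Function.Bijective e := by
    refine Function.bijective_iff_has_inverse.2 ⟨e', fun t ↦ ?_, fun t ↦ ?_⟩
    all_goals
      obtain ⟨t, rfl⟩ := Submodule.Quotient.mk_surjective _ t
      change Submodule.Quotient.mk (TensorProduct.map LinearMap.id LinearMap.id
        (TensorProduct.map LinearMap.id LinearMap.id t)) = _
      simp [TensorProduct.map_id]
  have h : ρ.canFlip hr hι = ρ.flipEquivFun ∘ₗ ρ.can ι hι ∘ₗ e := by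
    refine TensorAlong.hom_ext fun a b ↦ ?_
    change ρ.coact a * (b ⊗ₜ 1) = ρ.flipEquivFun ((a ⊗ₜ 1) * ρ.coact b)
    rw [← ρ.flipEquivFun_coact b]
    induction ρ.coact b using TensorProduct.induction_on with
    | zero => simp
    | add y z hy hz => simp only [mul_add, map_add, hy, hz]
    | tmul x y => simp [mul_assoc]
  rw [h]
  exact ρ.flipEquivFun_bijective.comp (hcan.comp he)

/-- The multiplication `A ⊗_R A → A`. -/
def mulAlong (hr : ∀ (r : R) (a : A), MulOpposite.op r • a = a * ι r) : TensorAlong ι A →ₗ[k] A :=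
  TensorAlong.lift ι (LinearMap.mul k A) fun a r b ↦ by simp [hr, mul_assoc]

@[simp] theorem mulAlong_mk (hr : ∀ (r : R) (a : A), MulOpposite.op r • a = a * ι r) (a b : A) :
    mulAlong (k := k) hr (TensorAlong.mk ι a b) = a * b := rfl

theorem mulAlong_eq (hr : ∀ (r : R) (a : A), MulOpposite.op r • a = a * ι r)
    (hι : ι.range ≤ ρ.coinvariants) (t : TensorAlong ι A) :
    mulAlong hr t = TensorProduct.rid k A
      (TensorProduct.map LinearMap.id Coalgebra.counit (ρ.canFlip hr hι t)) := by
  induction t using TensorAlong.induction_on with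
  | zero => simp
  | add s t hs ht => simp only [map_add, hs, ht]
  | mk a b =>
    rw [mulAlong_mk, canFlip_mk]
    conv_lhs => rw [← ρ.counit_linear_apply a]
    induction ρ.coact a using TensorProduct.induction_on with
    | zero => simp
    | add y z hy hz => simp only [map_add, add_mul, hy, hz]
    | tmul x y => simp

variable [IsScalarTower k Rᵐᵒᵖ A]

theorem op_smul_eq_mul (hr : ∀ (r : R) (a : A), MulOpposite.op r • a = a * ι r) (r : R)
    (t : A ⊗[k] H) : MulOpposite.op r • t = t * (ι r ⊗ₜ 1) := by
  induction t using TensorProduct.induction_on with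
  | zero => simp
  | add y z hy hz => rw [smul_add, hy, hz, add_mul]
  | tmul a h => rw [TensorProduct.smul_tmul', hr]; simp

/-- The coaction as a map of right `R`-modules, where `R` acts on `A` through coinvariants. -/
def coactRight (hr : ∀ (r : R) (a : A), MulOpposite.op r • a = a * ι r)
    (hι : ι.range ≤ ρ.coinvariants) : A →ₗ[Rᵐᵒᵖ] A ⊗[k] H where
  toFun := ρ.coact
  map_add' := map_add _
  map_smul' r a := by
    obtain ⟨r, rfl⟩ := MulOpposite.op_surjective r
    have h : ρ.coact (ι r) = ι r ⊗ₜ[k] 1 := hι ⟨r, rfl⟩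
    rw [RingHom.id_apply, op_smul_eq_mul hr, hr, map_mul, h]

@[simp] theorem coactRight_apply (hr : ∀ (r : R) (a : A), MulOpposite.op r • a = a * ι r)
    (hι : ι.range ≤ ρ.coinvariants) (a : A) : ρ.coactRight hr hι a = ρ.coact a := rfl

variable {V : Type*} [AddCommGroup V] [Module k V]

/-- The map `f ↦ ρ ∘ f - (f ⊗ H) ∘ δ` on linear maps `f : V → A`, whose kernel consists of the
colinear maps. -/
def colinearDefect (hr : ∀ (r : R) (a : A), MulOpposite.op r • a = a * ι r)
    (hι : ι.range ≤ ρ.coinvariants) (δ : V →ₗ[k] V ⊗[k] H) :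
    (V →ₗ[k] A) →ₗ[Rᵐᵒᵖ] (V →ₗ[k] A ⊗[k] H) where
  toFun f := (ρ.coactRight hr hι).restrictScalars k ∘ₗ f - TensorProduct.map f LinearMap.id ∘ₗ δ
  map_add' f g := by
    rw [LinearMap.comp_add, TensorProduct.map_add_left, LinearMap.add_comp]
    abel
  map_smul' r f := by
    ext v
    have h (t : V ⊗[k] H) : TensorProduct.map (r • f) LinearMap.id t =
        r • TensorProduct.map f LinearMap.id t := by
      induction t using TensorProduct.induction_on with
      | zero => simp
      | add y z hy hz => simp only [map_add, smul_add, hy, hz]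
      | tmul x y => rfl
    simp only [LinearMap.sub_apply, LinearMap.comp_apply, h, LinearMap.smul_apply,
      LinearMap.coe_restrictScalars, map_smul, RingHom.id_apply, smul_sub]

theorem colinearDefect_eq_zero_iff (hr : ∀ (r : R) (a : A), MulOpposite.op r • a = a * ι r)
    (hι : ι.range ≤ ρ.coinvariants) (δ : V →ₗ[k] V ⊗[k] H) (f : V →ₗ[k] A) :
    ρ.colinearDefect hr hι δ f = 0 ↔
      ∀ v, ρ.coact (f v) = TensorProduct.map f LinearMap.id (δ v) := by
  rw [LinearMap.ext_iff]
  exact forall_congr' fun v ↦ sub_eq_zero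

/-- The right `R`-module `Hom^H(V, A)` of colinear maps. -/
def ColinearHom (hr : ∀ (r : R) (a : A), MulOpposite.op r • a = a * ι r)
    (hι : ι.range ≤ ρ.coinvariants) (δ : V →ₗ[k] V ⊗[k] H) : Type _ :=
  LinearMap.ker (ρ.colinearDefect hr hι δ)

namespace ColinearHom

variable {ρ} {hr : ∀ (r : R) (a : A), MulOpposite.op r • a = a * ι r}
  {hι : ι.range ≤ ρ.coinvariants} {δ : V →ₗ[k] V ⊗[k] H}

instance : AddCommGroup (ρ.ColinearHom hr hι δ) :=
  inferInstanceAs (AddCommGroup (LinearMap.ker (ρ.colinearDefect hr hι δ)))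

instance : Module Rᵐᵒᵖ (ρ.ColinearHom hr hι δ) :=
  inferInstanceAs (Module Rᵐᵒᵖ (LinearMap.ker (ρ.colinearDefect hr hι δ)))

instance : Module k (ρ.ColinearHom hr hι δ) :=
  inferInstanceAs (Module k (LinearMap.ker (ρ.colinearDefect hr hι δ)))

instance : IsScalarTower k Rᵐᵒᵖ (ρ.ColinearHom hr hι δ) :=
  inferInstanceAs (IsScalarTower k Rᵐᵒᵖ (LinearMap.ker (ρ.colinearDefect hr hι δ)))

/-- The inclusion of `Hom^H(V, A)` in `Hom(V, A)`. -/
def incl : ρ.ColinearHom hr hι δ →ₗ[Rᵐᵒᵖ] (V →ₗ[k] A) where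
  toFun f := f.1
  map_add' _ _ := rfl
  map_smul' _ _ := rfl

theorem incl_injective : Function.Injective (incl (ρ := ρ) (hr := hr) (hι := hι) (δ := δ)) :=
  fun _ _ ↦ Subtype.ext

theorem coact_incl (f : ρ.ColinearHom hr hι δ) (v : V) :
    ρ.coact (f.incl v) = TensorProduct.map f.incl LinearMap.id (δ v) :=
  (ρ.colinearDefect_eq_zero_iff hr hι δ f.1).1 f.2 v

theorem exists_incl_eq (f : V →ₗ[k] A)
    (hf : ∀ v, ρ.coact (f v) = TensorProduct.map f LinearMap.id (δ v)) :
    ∃ g : ρ.ColinearHom hr hι δ, g.incl = f :=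
  ⟨⟨f, (ρ.colinearDefect_eq_zero_iff hr hι δ f).2 hf⟩, rfl⟩

end ColinearHom

/-- For `∑ f ⊗ a ∈ Hom^H(V, A) ⊗_R A` with `G(v) = ∑ f(v) a`, the map `canFlip` sends
`∑ f(v) ⊗ a` to `(G ⊗ H)(δ(v))`. -/
theorem canFlip_homMap (hr : ∀ (r : R) (a : A), MulOpposite.op r • a = a * ι r)
    (hι : ι.range ≤ ρ.coinvariants) (δ : V →ₗ[k] V ⊗[k] H)
    (t : TensorAlong ι (ρ.ColinearHom hr hι δ)) (v : V) :
    ρ.canFlip hr hι (TensorAlong.homMap ι (TensorAlong.map ι ColinearHom.incl t) v) =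
      TensorProduct.map (mulAlong hr ∘ₗ TensorAlong.homMap ι
        (TensorAlong.map ι ColinearHom.incl t)) LinearMap.id (δ v) := by
  induction t using TensorAlong.induction_on with
  | zero => simp
  | add s t hs ht =>
    simp only [map_add, LinearMap.add_apply, LinearMap.comp_add, TensorProduct.map_add_left, hs, ht]
  | mk f a =>
    simp only [TensorAlong.map_mk, TensorAlong.homMap_mk, canFlip_mk, f.coact_incl]
    induction δ v using TensorProduct.induction_on with
    | zero => simp
    | add y z hy hz => simp only [map_add, add_mul, hy, hz]
    | tmul x y => simp

/-- `canFlip` is colinear for the coaction on the left factor of `A ⊗_R A` and the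
comultiplication on `A ⊗ H`. -/
theorem canFlip_tensorMap_coact (hr : ∀ (r : R) (a : A), MulOpposite.op r • a = a * ι r)
    (hι : ι.range ≤ ρ.coinvariants) (t : TensorAlong ι A) :
    TensorProduct.map (ρ.canFlip hr hι) LinearMap.id (TensorAlong.tensorMap ι
      (TensorAlong.map ι (ρ.coactRight hr hι) t)) = (TensorProduct.assoc k A H H).symm
        (TensorProduct.map LinearMap.id Coalgebra.comul (ρ.canFlip hr hι t)) := by
  induction t using TensorAlong.induction_on with
  | zero => simp
  | add s t hs ht => simp only [map_add, hs, ht]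
  | mk a b =>
    rw [TensorAlong.map_mk, coactRight_apply, canFlip_mk]
    have h1 (z : A ⊗[k] H) : TensorProduct.map (ρ.canFlip hr hι) LinearMap.id
        (TensorAlong.tensorMap ι (TensorAlong.mk ι z b)) =
        TensorProduct.map ρ.coact.toLinearMap LinearMap.id z * ((b ⊗ₜ 1) ⊗ₜ 1) := by
      rw [← TensorAlong.mkₗ_apply]
      induction z using TensorProduct.induction_on with
      | zero => simp only [map_zero, zero_mul]
      | add y z hy hz => simp only [map_add, add_mul, hy, hz]
      | tmul x y => simp
    rw [h1, coassoc_linear_apply]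
    induction ρ.coact a using TensorProduct.induction_on with
    | zero => simp
    | add y z hy hz => simp only [map_add, add_mul, hy, hz]
    | tmul x y =>
      simp only [TensorProduct.map_tmul, LinearMap.id_apply, Algebra.TensorProduct.tmul_mul_tmul,
        mul_one]
      induction Coalgebra.comul (R := k) y using TensorProduct.induction_on with
      | zero => simp
      | add y z hy hz => simp only [TensorProduct.tmul_add, map_add, add_mul, hy, hz]
      | tmul x y => simp

/-- The defect of colinearity, after tensoring with `A` over `R`. -/
theorem tensorMap_colinearDefect (hr : ∀ (r : R) (a : A), MulOpposite.op r • a = a * ι r)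
    (hι : ι.range ≤ ρ.coinvariants) (δ : V →ₗ[k] V ⊗[k] H)
    (t : TensorAlong ι (V →ₗ[k] A)) (v : V) :
    TensorAlong.tensorMap ι (TensorAlong.homMap ι
      (TensorAlong.map ι (ρ.colinearDefect hr hι δ) t) v) =
      TensorAlong.tensorMap ι (TensorAlong.map ι (ρ.coactRight hr hι) (TensorAlong.homMap ι t v)) -
      TensorProduct.map (TensorAlong.homMap ι t) LinearMap.id (δ v) := by
  induction t using TensorAlong.induction_on with
  | zero => simp
  | add s t hs ht =>
    simp only [map_add, LinearMap.add_apply, TensorProduct.map_add_left, hs, ht]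
    abel
  | mk f a =>
    have h1 (z : V ⊗[k] H) : TensorProduct.map (TensorAlong.homMap ι (TensorAlong.mk ι f a))
        LinearMap.id z = TensorAlong.tensorMap ι
          (TensorAlong.mk ι (TensorProduct.map f LinearMap.id z) a) := by
      rw [← TensorAlong.mkₗ_apply ι (TensorProduct.map f LinearMap.id z)]
      induction z using TensorProduct.induction_on with
      | zero => simp only [map_zero]
      | add y z hy hz => simp only [map_add, hy, hz]
      | tmul x y => simp
    rw [h1, TensorAlong.map_mk, TensorAlong.homMap_mk, TensorAlong.homMap_mk, TensorAlong.map_mk,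
      ← map_sub, ← TensorAlong.mkₗ_apply, ← TensorAlong.mkₗ_apply, ← TensorAlong.mkₗ_apply,
      ← map_sub]
    rfl

end Extension
end ComoduleAlgebra

namespace ComoduleAlgebra

variable {k : Type u} [Field k] {H : Type v} [Ring H] [HopfAlgebra k H]
  {A : Type w} [Ring A] [Algebra k A] (ρ : ComoduleAlgebra k H A)

section Extension

variable {R : Type x} [Ring R] [Algebra k R] {ι : R →ₐ[k] A}
  [Module Rᵐᵒᵖ A] [IsScalarTower k Rᵐᵒᵖ A] {V U : Type v} [AddCommGroup V] [Module k V]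
  [AddCommGroup U] [Module k U]

/-- For `V` of finite dimension, an element `∑ f ⊗ a` of `Hom^H(V, A) ⊗_R A` is determined by the
linear map `v ↦ ∑ f(v) a`. -/
theorem eq_zero_of_mulAlong_homMap [Module.Finite k V]
    (hr : ∀ (r : R) (a : A), MulOpposite.op r • a = a * ι r)
    (hι : ι.range ≤ ρ.coinvariants) (hff : IsLeftFaithfullyFlat.{max u v w x} ι)
    (hcan : Function.Bijective (ρ.canFlip hr hι)) (δ : V →ₗ[k] V ⊗[k] H)
    (t : TensorAlong ι (ρ.ColinearHom hr hι δ))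
    (h : mulAlong hr ∘ₗ TensorAlong.homMap ι (TensorAlong.map ι
      ColinearHom.incl t) = 0) : t = 0 := by
  refine IsLeftFaithfullyFlat.map_injective.{u, w, x, max u x, max v w} hff
    ColinearHom.incl_injective ?_
  refine (TensorAlong.homMap_bijective ι).1 ?_
  rw [map_zero, map_zero]
  ext v
  refine hcan.1 ?_
  rw [ρ.canFlip_homMap, h]
  simp

/-- For `V` of finite dimension, each linear map `V → A` has the form `v ↦ ∑ f(v) a` with colinear
maps `f`. -/
theorem exists_mulAlong_homMap_eq [Module.Finite k V]
    (hr : ∀ (r : R) (a : A), MulOpposite.op r • a = a * ι r)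
    (hι : ι.range ≤ ρ.coinvariants) (hff : IsLeftFaithfullyFlat.{max u v w x} ι)
    (hcan : Function.Bijective (ρ.canFlip hr hι)) {δ : V →ₗ[k] V ⊗[k] H} (hδ : IsCoaction δ)
    (g : V →ₗ[k] A) :
    ∃ t : TensorAlong ι (ρ.ColinearHom hr hι δ),
      mulAlong hr ∘ₗ TensorAlong.homMap ι (TensorAlong.map ι
        ColinearHom.incl t) = g := by
  -- The preimage of `g` is the preimage of `(g ⊗ H) ∘ δ` under `canFlip`, regarded as an element
  -- of `Hom(V, A) ⊗_R A`; it is killed by the defect of colinearity.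
  set F : V →ₗ[k] TensorAlong ι A := (LinearEquiv.ofBijective _ hcan).symm.toLinearMap ∘ₗ
    TensorProduct.map g LinearMap.id ∘ₗ δ with hF
  have hF' : ρ.canFlip hr hι ∘ₗ F = TensorProduct.map g LinearMap.id ∘ₗ δ := by
    ext v
    exact LinearEquiv.apply_symm_apply (LinearEquiv.ofBijective _ hcan) _
  have hF'' (v : V) : ρ.canFlip hr hι (F v) = TensorProduct.map g LinearMap.id (δ v) :=
    congr($hF' v)
  obtain ⟨z, hz⟩ := (TensorAlong.homMap_bijective (P := A) (V := V) ι).2 F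
  have h0 : TensorAlong.map ι (ρ.colinearDefect hr hι δ) z = 0 := by
    refine (TensorAlong.homMap_bijective ι).1 ?_
    rw [map_zero]
    ext v
    refine TensorAlong.tensorMap_injective ι ?_
    rw [ρ.tensorMap_colinearDefect, hz, LinearMap.zero_apply, map_zero, sub_eq_zero]
    refine map_id_injective hcan.1 ?_
    rw [ρ.canFlip_tensorMap_coact, map_map_apply, hF', hF'']
    have h1 := congr($(hδ.coassoc) v)
    simp only [LinearMap.comp_apply, LinearEquiv.coe_coe] at h1
    have h2 (s : V ⊗[k] H) : TensorProduct.map LinearMap.id Coalgebra.comul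
        (TensorProduct.map g LinearMap.id s) = TensorProduct.map g LinearMap.id
          (TensorProduct.map LinearMap.id (Coalgebra.comul (R := k)) s) := by
      rw [map_map_apply, map_map_apply]
      rfl
    rw [h2, ← h1, LinearEquiv.symm_apply_eq]
    have h3 (s : (V ⊗[k] H) ⊗[k] H) : TensorProduct.map g LinearMap.id
        (TensorProduct.assoc k V H H s) = TensorProduct.assoc k A H H
          (TensorProduct.map (TensorProduct.map g LinearMap.id) LinearMap.id s) := by
      rw [← LinearEquiv.coe_coe, ← LinearEquiv.coe_coe, ← LinearMap.comp_apply,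
        ← LinearMap.comp_apply]
      congr 1
      ext
      simp
    rw [h3, map_map_apply]
  obtain ⟨t, rfl⟩ := IsLeftFaithfullyFlat.exists_of_map_eq_zero.{u, w, x, max u x, max v w} hff
    (L := ρ.ColinearHom hr hι δ) ColinearHom.incl (ρ.colinearDefect hr hι δ)
    (fun f hf ↦ ColinearHom.exists_incl_eq f
      ((ρ.colinearDefect_eq_zero_iff hr hι δ f).1 hf)) z h0
  refine ⟨t, ?_⟩
  rw [hz]
  ext v
  have h1 := congr(g ($(hδ.counit) v))
  refine Eq.trans ?_ h1
  rw [LinearMap.comp_apply, ρ.mulAlong_eq hr hι, hF'']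
  simp only [LinearMap.comp_apply]
  induction δ v using TensorProduct.induction_on with
  | zero => simp
  | add y z hy hz => simp only [map_add, hy, hz]
  | tmul x y => simp

/-- The restriction `Hom^H(V, A) → Hom^H(U, A)` along a colinear map `j : U → V`. -/
def ColinearHom.restrict (hr : ∀ (r : R) (a : A), MulOpposite.op r • a = a * ι r)
    (hι : ι.range ≤ ρ.coinvariants) (δ : V →ₗ[k] V ⊗[k] H)
    (δ' : U →ₗ[k] U ⊗[k] H) (j : U →ₗ[k] V)
    (hjδ : ∀ a, δ (j a) = TensorProduct.map j LinearMap.id (δ' a)) :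
    ρ.ColinearHom hr hι δ →ₗ[Rᵐᵒᵖ] ρ.ColinearHom hr hι δ' where
  toFun g := ⟨g.1 ∘ₗ j, (ρ.colinearDefect_eq_zero_iff hr hι δ' _).2 fun a ↦ by
    refine (g.coact_incl (j a)).trans ?_
    rw [hjδ, map_map_apply]
    rfl⟩
  map_add' _ _ := rfl
  map_smul' _ _ := rfl

/-- A colinear map into a faithfully flat Galois extension extends from `U` to a larger comodule
`V` of finite dimension: the restriction `Hom^H(V, A) → Hom^H(U, A)` becomes surjective after
tensoring with `A` over `R`, since the two sides are then `Hom(V, A)` and `Hom(U, A)`. -/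
theorem exists_colinear_extension [Module.Finite k V] [Module.Finite k U]
    (hr : ∀ (r : R) (a : A), MulOpposite.op r • a = a * ι r)
    (hι : ι.range ≤ ρ.coinvariants) (hff : IsLeftFaithfullyFlat.{max u v w x} ι)
    (hcan : Function.Bijective (ρ.canFlip hr hι)) {δ : V →ₗ[k] V ⊗[k] H} (hδ : IsCoaction δ)
    (δ' : U →ₗ[k] U ⊗[k] H) (j : U →ₗ[k] V) (hj : Function.Injective j)
    (hjδ : ∀ a, δ (j a) = TensorProduct.map j LinearMap.id (δ' a)) (f : U →ₗ[k] A)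
    (hf : ∀ a, ρ.coact (f a) = TensorProduct.map f LinearMap.id (δ' a)) :
    ∃ g : V →ₗ[k] A, g ∘ₗ j = f ∧
      ∀ v, ρ.coact (g v) = TensorProduct.map g LinearMap.id (δ v) := by
  set res := ColinearHom.restrict ρ hr hι δ δ' j hjδ
  have hmul (t : TensorAlong ι (ρ.ColinearHom hr hι δ)) :
      TensorAlong.homMap ι (TensorAlong.map ι ColinearHom.incl (TensorAlong.map ι res t)) =
        TensorAlong.homMap ι (TensorAlong.map ι ColinearHom.incl t) ∘ₗ j := by
    induction t using TensorAlong.induction_on with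
    | zero => simp
    | mk m a => rfl
    | add s t hs ht => simp only [map_add, LinearMap.add_comp, hs, ht]
  have hsurj : Function.Surjective (TensorAlong.map ι res) := by
    intro t
    obtain ⟨p, hp⟩ := LinearMap.exists_leftInverse_of_injective j (LinearMap.ker_eq_bot.2 hj)
    obtain ⟨s, hs⟩ := ρ.exists_mulAlong_homMap_eq hr hι hff hcan hδ
      ((mulAlong hr ∘ₗ TensorAlong.homMap ι (TensorAlong.map ι ColinearHom.incl t)) ∘ₗ p)
    refine ⟨s, sub_eq_zero.1 (ρ.eq_zero_of_mulAlong_homMap hr hι hff hcan δ' _ ?_)⟩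
    rw [map_sub, map_sub, LinearMap.comp_sub, sub_eq_zero, hmul, ← LinearMap.comp_assoc, hs,
      LinearMap.comp_assoc, hp, LinearMap.comp_id]
  obtain ⟨f', hf'⟩ := ColinearHom.exists_incl_eq (hr := hr) (hι := hι) f hf
  obtain ⟨g, hg⟩ := IsLeftFaithfullyFlat.surjective_of_map.{u, w, x, max u x, max v w} hff
    res hsurj f'
  refine ⟨g.incl, ?_, g.coact_incl⟩
  rw [← hf', ← hg]
  rfl

end Extension
end ComoduleAlgebra

/-! ### Right coideals and total integrals -/

section Coideal

variable {k : Type u} [Field k] {H : Type v} [AddCommGroup H] [Module k H] [Coalgebra k H]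

/-- The operator `h ↦ β(h₂) h₁` on a coalgebra given by a functional `β`. -/
def contractComul (β : H →ₗ[k] k) : H →ₗ[k] H := contract H β ∘ₗ Coalgebra.comul

/-- A right coideal: a subspace `W` with `Δ(W) ⊆ W ⊗ H`, expressed by functionals. -/
def IsRightCoideal (W : Submodule k H) : Prop :=
  ∀ β : H →ₗ[k] k, ∀ h ∈ W, contractComul β h ∈ W

/-- The comultiplication restricts to a coaction on a right coideal. -/
theorem IsRightCoideal.exists_coaction {W : Submodule k H} (hW : IsRightCoideal W) :
    ∃ δ : W →ₗ[k] W ⊗[k] H, IsCoaction δ ∧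
      ∀ a, TensorProduct.map W.subtype LinearMap.id (δ a) = Coalgebra.comul (a : H) := by
  have hinj : Function.Injective (TensorProduct.map W.subtype (LinearMap.id : H →ₗ[k] H)) :=
    map_id_injective W.injective_subtype
  have hinj2 : Function.Injective
      (TensorProduct.map W.subtype (LinearMap.id : H ⊗[k] H →ₗ[k] H ⊗[k] H)) :=
    map_id_injective W.injective_subtype
  set e := LinearEquiv.ofInjective _ hinj
  have hmem (a : W) : Coalgebra.comul (a : H) ∈
      LinearMap.range (TensorProduct.map W.subtype (LinearMap.id : H →ₗ[k] H)) :=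
    exists_of_contract_mem W _ fun β ↦ hW β a a.2
  set δ : W →ₗ[k] W ⊗[k] H := e.symm.toLinearMap ∘ₗ
    (Coalgebra.comul ∘ₗ W.subtype).codRestrict _ hmem with hδdef
  have hδ (a : W) : TensorProduct.map W.subtype LinearMap.id (δ a) = Coalgebra.comul (a : H) :=
    congrArg Subtype.val (e.apply_symm_apply ⟨_, hmem a⟩)
  have hδ' : TensorProduct.map W.subtype LinearMap.id ∘ₗ δ = Coalgebra.comul ∘ₗ W.subtype :=
    LinearMap.ext hδ
  refine ⟨δ, ⟨?_, ?_⟩, hδ⟩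
  · ext a
    refine hinj2 ?_
    have h1 (s : (W ⊗[k] H) ⊗[k] H) : TensorProduct.map W.subtype LinearMap.id
        (TensorProduct.assoc k W H H s) = TensorProduct.assoc k H H H
          (TensorProduct.map (TensorProduct.map W.subtype LinearMap.id) LinearMap.id s) := by
      rw [← LinearEquiv.coe_coe, ← LinearEquiv.coe_coe, ← LinearMap.comp_apply,
        ← LinearMap.comp_apply]
      congr 1
      ext
      simp
    have h2 (t : W ⊗[k] H) : TensorProduct.map W.subtype LinearMap.id
        (TensorProduct.map LinearMap.id Coalgebra.comul t) =
        TensorProduct.map LinearMap.id Coalgebra.comul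
          (TensorProduct.map W.subtype (LinearMap.id : H →ₗ[k] H) t) := by
      rw [map_map_apply, map_map_apply]
      rfl
    have h3 (t : W ⊗[k] H) : TensorProduct.map (Coalgebra.comul ∘ₗ W.subtype) LinearMap.id t =
        TensorProduct.map Coalgebra.comul LinearMap.id
          (TensorProduct.map W.subtype (LinearMap.id : H →ₗ[k] H) t) := by
      rw [map_map_apply, LinearMap.comp_id]
    simp only [LinearMap.comp_apply, LinearEquiv.coe_coe]
    rw [h1, map_map_apply, hδ', LinearMap.comp_id, h2, h3, hδ]
    exact Coalgebra.coassoc_apply (a : H)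
  · ext a
    have h1 (t : W ⊗[k] H) : (TensorProduct.rid k W
        (TensorProduct.map LinearMap.id (Coalgebra.counit (R := k)) t) : H) =
        TensorProduct.rid k H (LinearMap.lTensor H Coalgebra.counit
          (TensorProduct.map W.subtype LinearMap.id t)) := by
      induction t using TensorProduct.induction_on with
      | zero => simp
      | add y z hy hz => simp only [map_add, Submodule.coe_add, hy, hz]
      | tmul x y => simp
    refine (h1 _).trans ?_
    rw [hδ, Coalgebra.lTensor_counit_comul]
    simp

theorem contractComul_contractComul (β β' : H →ₗ[k] k) (h : H) :
    contractComul β' (contractComul β h) =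
      contractComul (LinearMap.mul' k k ∘ₗ TensorProduct.map β' β ∘ₗ Coalgebra.comul) h := by
  have h1 (t : (H ⊗[k] H) ⊗[k] H) : contract H β' (contract (H ⊗[k] H) β t) =
      contract H (LinearMap.mul' k k ∘ₗ TensorProduct.map β' β)
        (TensorProduct.assoc k H H H t) := by
    rw [← LinearEquiv.coe_coe, ← LinearMap.comp_apply, ← LinearMap.comp_apply]
    congr 1
    ext a b c
    simp [smul_smul, mul_comm]
  have h2 := h1 (TensorProduct.map Coalgebra.comul LinearMap.id (Coalgebra.comul h))
  rw [contract_map] at h2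
  refine h2.trans ?_
  have h3 : TensorProduct.assoc k H H H
      (TensorProduct.map Coalgebra.comul LinearMap.id (Coalgebra.comul h)) =
      TensorProduct.map LinearMap.id Coalgebra.comul (Coalgebra.comul (R := k) h) :=
    Coalgebra.coassoc_apply h
  rw [h3]
  simp only [contract, contractComul, LinearMap.comp_apply, map_map_apply]
  rfl

/-- Local finiteness: each element of a coalgebra lies in a right coideal of finite dimension. -/
theorem exists_finite_rightCoideal (h : H) :
    ∃ W : Submodule k H, IsRightCoideal W ∧ Module.Finite k W ∧ h ∈ W := by
  set f : (H →ₗ[k] k) →ₗ[k] H :=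
    { toFun := fun β ↦ contractComul β h
      map_add' := fun β β' ↦ by
        simp only [contractComul, contract, TensorProduct.map_add_right, LinearMap.add_apply,
          LinearMap.comp_apply, map_add]
      map_smul' := fun c β ↦ by
        simp only [contractComul, contract, TensorProduct.map_smul_right, LinearMap.smul_apply,
          LinearMap.comp_apply, map_smul, RingHom.id_apply] }
  refine ⟨LinearMap.range f, ?_, ?_, ⟨Coalgebra.counit, ?_⟩⟩
  · rintro β _ ⟨β', rfl⟩
    exact ⟨_, (contractComul_contractComul β' β h).symm⟩
  · have hfin (t : H ⊗[k] H) : ∃ W : Submodule k H, Module.Finite k W ∧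
        ∀ β, contract H β t ∈ W := by
      induction t using TensorProduct.induction_on with
      | zero => exact ⟨⊥, inferInstance, fun β ↦ by simp⟩
      | tmul a b =>
        refine ⟨Submodule.span k {a}, inferInstance, fun β ↦ ?_⟩
        rw [contract_tmul]
        exact Submodule.smul_mem _ _ (Submodule.mem_span_singleton_self a)
      | add s t hs ht =>
        obtain ⟨W, hW, hs⟩ := hs
        obtain ⟨W', hW', ht⟩ := ht
        refine ⟨W ⊔ W', inferInstance, fun β ↦ ?_⟩
        rw [map_add]
        exact Submodule.add_mem_sup (hs β) (ht β)
    obtain ⟨W, hW, hf⟩ := hfin (Coalgebra.comul h)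
    refine Submodule.finiteDimensional_of_le (S₂ := W) ?_
    rintro _ ⟨β, rfl⟩
    exact hf β
  · change contractComul Coalgebra.counit h = h
    have := Coalgebra.lTensor_counit_comul (R := k) h
    simp only [contractComul, contract, LinearMap.comp_apply, LinearEquiv.coe_coe]
    refine (congrArg (TensorProduct.rid k H) this).trans ?_
    simp

end Coideal

namespace ComoduleAlgebra

variable {k : Type u} [Field k] {H : Type v} [Ring H] [HopfAlgebra k H]
  {A : Type w} [Ring A] [Algebra k A] (ρ : ComoduleAlgebra k H A)

/-- A partially defined linear map `H → A` is colinear if its domain is a right coideal and it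
commutes with the coactions; both conditions are expressed by functionals. -/
def IsPartialColinear (f : H →ₗ.[k] A) : Prop :=
  ∀ (β : H →ₗ[k] k) (h : f.domain), ∃ h' : f.domain,
    (h' : H) = contractComul β h ∧ f h' = contract A β (ρ.coact (f h))

variable {ρ}

theorem IsPartialColinear.isRightCoideal {f : H →ₗ.[k] A} (hf : ρ.IsPartialColinear f) :
    IsRightCoideal f.domain := by
  intro β h hh
  obtain ⟨h', hh', -⟩ := hf β ⟨h, hh⟩
  exact hh' ▸ h'.2

theorem IsPartialColinear.coact_eq {f : H →ₗ.[k] A} (hf : ρ.IsPartialColinear f)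
    (δ : f.domain →ₗ[k] f.domain ⊗[k] H)
    (hδ : ∀ a, TensorProduct.map f.domain.subtype LinearMap.id (δ a) = Coalgebra.comul (a : H))
    (a : f.domain) : ρ.coact (f a) = TensorProduct.map f.toFun LinearMap.id (δ a) := by
  refine eq_of_contract _ _ fun β ↦ ?_
  obtain ⟨h', hh', hfh'⟩ := hf β a
  rw [← hfh', contract_map]
  change f.toFun h' = _
  congr 1
  ext
  rw [hh', contractComul, LinearMap.comp_apply, ← hδ, contract_map]
  rfl

theorem isPartialColinear_of_coact_eq {W : Submodule k H} (f : W →ₗ[k] A)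
    (δ : W →ₗ[k] W ⊗[k] H)
    (hδ : ∀ a, TensorProduct.map W.subtype LinearMap.id (δ a) = Coalgebra.comul (a : H))
    (hf : ∀ a, ρ.coact (f a) = TensorProduct.map f LinearMap.id (δ a)) :
    ρ.IsPartialColinear ⟨W, f⟩ := by
  intro β a
  refine ⟨contract W β (δ a), ?_, ?_⟩
  · rw [contractComul, LinearMap.comp_apply, ← hδ, contract_map]
    rfl
  · change f _ = contract A β (ρ.coact (f a))
    rw [hf, contract_map]

theorem IsPartialColinear.sup {f g : H →ₗ.[k] A} (hf : ρ.IsPartialColinear f)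
    (hg : ρ.IsPartialColinear g) (h : ∀ (x : f.domain) (y : g.domain), (x : H) = y → f x = g y) :
    ρ.IsPartialColinear (f.sup g h) := by
  intro β a
  obtain ⟨x, hx, y, hy, hxy⟩ := Submodule.mem_sup.1 a.2
  obtain ⟨x', hx', hfx⟩ := hf β ⟨x, hx⟩
  obtain ⟨y', hy', hgy⟩ := hg β ⟨y, hy⟩
  refine ⟨⟨(x' : H) + y', Submodule.add_mem_sup x'.2 y'.2⟩, ?_, ?_⟩
  · rw [← hxy, map_add, ← hx', ← hy']
  · have h2 := LinearPMap.sup_apply h ⟨x, hx⟩ ⟨y, hy⟩ a hxy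
    refine (LinearPMap.sup_apply h x' y' ⟨(x' : H) + y', _⟩ rfl).trans ?_
    rw [h2, hfx, hgy, map_add, map_add]

variable {R : Type x} [Ring R] [Algebra k R] {ι : R →ₐ[k] A}

/-- A partial colinear map into a faithfully flat Galois extension whose domain is not all of `H`
has a proper extension. -/
theorem IsPartialColinear.exists_extension [Module Rᵐᵒᵖ A] [IsScalarTower k Rᵐᵒᵖ A]
    (hr : ∀ (r : R) (a : A), MulOpposite.op r • a = a * ι r)
    (hι : ι.range ≤ ρ.coinvariants) (hff : IsLeftFaithfullyFlat.{max u v w x} ι)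
    (hcan : Function.Bijective (ρ.canFlip hr hι)) {f : H →ₗ.[k] A} (hf : ρ.IsPartialColinear f)
    (h : H) : ∃ g, f ≤ g ∧ ρ.IsPartialColinear g ∧ h ∈ g.domain := by
  -- extend `f` from `U = W ∩ V` to `V`, where `W` is its domain and `V ∋ h` is finite-dimensional
  obtain ⟨V, hV, hVfin, hhV⟩ := exists_finite_rightCoideal (k := k) h
  have hW := hf.isRightCoideal
  have hU : IsRightCoideal (f.domain ⊓ V) := fun β a ha ↦ ⟨hW β a ha.1, hV β a ha.2⟩
  obtain ⟨δ, hδ, hδ1⟩ := hV.exists_coaction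
  obtain ⟨δU, -, hδU1⟩ := hU.exists_coaction
  obtain ⟨δW, -, hδW1⟩ := hW.exists_coaction
  have : Module.Finite k (f.domain ⊓ V : Submodule k H) :=
    Submodule.finiteDimensional_of_le inf_le_right
  set j := Submodule.inclusion (inf_le_right : f.domain ⊓ V ≤ V)
  set i := Submodule.inclusion (inf_le_left : f.domain ⊓ V ≤ f.domain)
  have hj (a) : δ (j a) = TensorProduct.map j LinearMap.id (δU a) := by
    refine map_id_injective V.injective_subtype ?_
    rw [hδ1, map_map_apply]
    exact (hδU1 a).symm
  have hi (a) : δW (i a) = TensorProduct.map i LinearMap.id (δU a) := by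
    refine map_id_injective f.domain.injective_subtype ?_
    rw [hδW1, map_map_apply]
    exact (hδU1 a).symm
  obtain ⟨g, hgf, hg⟩ := ρ.exists_colinear_extension hr hι hff hcan hδ δU j
    (Submodule.inclusion_injective _) hj (f.toFun ∘ₗ i) fun a ↦ by
      rw [LinearMap.comp_apply]
      refine (hf.coact_eq δW hδW1 (i a)).trans ?_
      rw [hi, map_map_apply]
      rfl
  have hagree : ∀ (x : f.domain) (y : V), (x : H) = y → f x = (⟨V, g⟩ : H →ₗ.[k] A) y := by
    intro x y hxy
    have := congr($hgf ⟨x, x.2, by rw [hxy]; exact y.2⟩)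
    refine this.symm.trans ?_
    change g _ = g y
    congr 1
    ext
    exact hxy
  exact ⟨f.sup ⟨V, g⟩ hagree, LinearPMap.left_le_sup _ _ _,
    hf.sup (isPartialColinear_of_coact_eq g δ hδ1 hg) hagree,
    (le_sup_right : V ≤ f.domain ⊔ V) hhV⟩

theorem IsPartialColinear.sSup {c : Set (H →ₗ.[k] A)} (hc : ∀ f ∈ c, ρ.IsPartialColinear f)
    (hne : c.Nonempty) (hdir : DirectedOn (· ≤ ·) c) :
    ρ.IsPartialColinear (LinearPMap.sSup c hdir) := by
  intro β a
  obtain ⟨f, hfc, haf⟩ := (LinearPMap.mem_domain_sSup_iff hne hdir).1 a.2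
  obtain ⟨b, hb, hfb⟩ := hc f hfc β ⟨a, haf⟩
  have hle := LinearPMap.le_sSup hdir hfc
  refine ⟨⟨b, hle.1 b.2⟩, hb, ?_⟩
  rw [← hle.2 (x := b) (y := ⟨b, hle.1 b.2⟩) rfl, hfb, hle.2 (x := ⟨a, haf⟩) (y := a) rfl]

/-- A faithfully flat Galois extension has a total integral. -/
theorem exists_isTotalIntegral [Coalgebra.IsCocomm k H]
    (hι : ι.range ≤ ρ.coinvariants) (hff : IsLeftFaithfullyFlat.{max u v w x} ι)
    (hcan : Function.Bijective (ρ.can ι hι)) : ∃ φ : H →ₗ[k] A, ρ.IsTotalIntegral φ := by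
  let _ : Module Rᵐᵒᵖ A := Module.compHom A (AlgHom.op ι).toRingHom
  have hr (r : R) (a : A) : MulOpposite.op r • a = a * ι r := rfl
  have : IsScalarTower k Rᵐᵒᵖ A := ⟨fun c r a ↦ by
    obtain ⟨r, rfl⟩ := MulOpposite.op_surjective r
    rw [← MulOpposite.op_smul, hr, hr, map_smul, mul_smul_comm]⟩
  have hcan' := ρ.canFlip_bijective hr hι hcan
  have h1 : (1 : H) ≠ 0 := by
    intro h
    have := congrArg (Coalgebra.counit (R := k)) h
    rw [Bialgebra.counit_one, map_zero] at this
    exact one_ne_zero this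
  -- the map `1 ↦ 1` on `k 1` is contained in a maximal partial colinear map
  set f₀ : H →ₗ.[k] A := LinearPMap.mkSpanSingleton (1 : H) (1 : A) h1
  have hf₀ (c : k) (h) : f₀ ⟨c • 1, h⟩ = c • 1 :=
    LinearPMap.mkSpanSingleton'_apply _ _ _ c h
  have hf₀c : ρ.IsPartialColinear f₀ := by
    rintro β ⟨a, ha⟩
    obtain ⟨c, rfl⟩ := Submodule.mem_span_singleton.1 ha
    refine ⟨⟨(β 1 * c) • 1, Submodule.mem_span_singleton.2 ⟨_, rfl⟩⟩, ?_, ?_⟩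
    · simp [contractComul, Bialgebra.comul_one, Algebra.TensorProduct.one_def, mul_smul,
        smul_comm c]
    · refine (hf₀ _ _).trans ?_
      rw [hf₀ c ha, map_smul, map_one ρ.coact, map_smul, Algebra.TensorProduct.one_def,
        contract_tmul, mul_comm, mul_smul]
  obtain ⟨m, hm₀, hm⟩ := zorn_le_nonempty₀ {f | ρ.IsPartialColinear f} (fun c hc hchain y hy ↦
    ⟨LinearPMap.sSup c hchain.directedOn,
      IsPartialColinear.sSup (fun f hf ↦ hc hf) ⟨y, hy⟩ _,
      fun z hz ↦ LinearPMap.le_sSup _ hz⟩) f₀ hf₀c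
  have htop (h : H) : h ∈ m.domain := by
    obtain ⟨g, hg, hgc, hhg⟩ := IsPartialColinear.exists_extension hr hι hff hcan' hm.1 h
    exact (hm.2 hgc hg).1 hhg
  set φ : H →ₗ[k] A := m.toFun ∘ₗ LinearMap.id.codRestrict m.domain htop
  have hφ (h : H) : φ h = m ⟨h, htop h⟩ := rfl
  refine ⟨φ, LinearMap.ext fun h ↦ eq_of_contract _ _ fun β ↦ ?_, ?_⟩
  · obtain ⟨b, hb, hmb⟩ := hm.1 β ⟨h, htop h⟩
    change contract A β (ρ.coact (φ h)) =
      contract A β (TensorProduct.map φ LinearMap.id (Coalgebra.comul h))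
    rw [contract_map]
    refine hmb.symm.trans ?_
    change m b = m ⟨_, htop _⟩
    congr 1
    exact Subtype.ext hb
  · rw [hφ]
    have h2 : (1 : H) ∈ f₀.domain := Submodule.mem_span_singleton_self 1
    rw [← hm₀.2 (x := ⟨1, h2⟩) rfl]
    have := hf₀ 1 (by simpa using h2)
    simpa using this

end ComoduleAlgebra

/-! ### Bicolinear lifts of the translation map -/

section ColinearMaps

variable {k : Type u} [Field k] {H : Type v} [Ring H] [HopfAlgebra k H]
  {X : Type*} [AddCommGroup X] [Module k X] {Y : Type*} [AddCommGroup Y] [Module k Y]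
  {X' : Type*} [AddCommGroup X'] [Module k X'] {Y' : Type*} [AddCommGroup Y'] [Module k Y']
  {δ : Y →ₗ[k] Y ⊗[k] H} {θ : H →ₗ[k] H} {s : H →ₗ[k] X ⊗[k] Y}

theorem IsColinear.map (hs : IsColinear δ θ s) (f : X →ₗ[k] X') (g : Y →ₗ[k] Y')
    {δ' : Y' →ₗ[k] Y' ⊗[k] H} (hg : δ' ∘ₗ g = TensorProduct.map g LinearMap.id ∘ₗ δ) :
    IsColinear δ' θ (TensorProduct.map f g ∘ₗ s) := by
  have h1 : TensorProduct.map LinearMap.id δ' ∘ₗ TensorProduct.map f g =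
      TensorProduct.map f (TensorProduct.map g LinearMap.id) ∘ₗ
        TensorProduct.map LinearMap.id δ := by
    rw [← TensorProduct.map_comp, ← TensorProduct.map_comp, hg]
    rfl
  have h2 : TensorProduct.map f (TensorProduct.map g LinearMap.id) ∘ₗ
      (TensorProduct.assoc k X Y H).toLinearMap = (TensorProduct.assoc k X' Y' H).toLinearMap ∘ₗ
        TensorProduct.map (TensorProduct.map f g) LinearMap.id := by
    ext
    simp
  rw [IsColinear] at hs ⊢
  rw [← LinearMap.comp_assoc, h1, LinearMap.comp_assoc, hs, ← LinearMap.comp_assoc, h2,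
    LinearMap.comp_assoc, ← LinearMap.comp_assoc _ _ (TensorProduct.map _ LinearMap.id),
    ← TensorProduct.map_comp, LinearMap.id_comp]

/-- Colinearity is preserved when `τ : H → H` is applied to the coaction. -/
theorem IsColinear.twist (hs : IsColinear δ θ s) (τ : H →ₗ[k] H) :
    IsColinear (TensorProduct.map LinearMap.id τ ∘ₗ δ) (τ ∘ₗ θ) s := by
  have h1 : TensorProduct.map LinearMap.id (TensorProduct.map LinearMap.id τ) ∘ₗ
      (TensorProduct.assoc k X Y H).toLinearMap = (TensorProduct.assoc k X Y H).toLinearMap ∘ₗ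
        TensorProduct.map LinearMap.id τ := by
    ext
    simp
  rw [IsColinear] at hs ⊢
  have h2 : TensorProduct.map (LinearMap.id : X →ₗ[k] X) (TensorProduct.map LinearMap.id τ ∘ₗ δ) =
      TensorProduct.map LinearMap.id (TensorProduct.map LinearMap.id τ) ∘ₗ
        TensorProduct.map LinearMap.id δ := by
    rw [← TensorProduct.map_comp, LinearMap.id_comp]
  rw [h2, LinearMap.comp_assoc, hs, ← LinearMap.comp_assoc, h1, LinearMap.comp_assoc,
    ← LinearMap.comp_assoc _ _ (TensorProduct.map _ τ), ← TensorProduct.map_comp,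
    LinearMap.id_comp]

end ColinearMaps

namespace ComoduleAlgebra

variable {k : Type u} [Field k] {H : Type v} [Ring H] [HopfAlgebra k H]
  {D : Type w} [Ring D] [Algebra k D] (ρ : ComoduleAlgebra k H D)

/-- A bicolinear lift `Γ : H → D ⊗ D`, `Γ(h) = ∑ l ⊗ r`, of the translation map: it is unital,
`l r = ε(h)`, `l ⊗ r₀ ⊗ r₁ = Γ(h₁) ⊗ h₂` and `l₀ ⊗ r ⊗ l₁ = Γ(h₁) ⊗ S(h₂)` (up to the order of
the factors). For `H = k[G]` it is a choice, for each `g`, of an element of `D_{g⁻¹} ⊗ D_g` with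
product `1`. -/
structure IsTranslationLift (Γ : H →ₗ[k] D ⊗[k] D) : Prop where
  right_colinear : IsColinear ρ.coact.toLinearMap LinearMap.id Γ
  left_colinear : IsColinear ρ.coact.toLinearMap (HopfAlgebra.antipode k) (swapLegs Γ)
  mul_eq : LinearMap.mul' k D ∘ₗ Γ = convUnit k H D
  map_one : Γ 1 = 1 ⊗ₜ 1

variable {ρ}

variable {R : Type x} [Ring R] [Algebra k R] {ι : R →ₐ[k] D}

/-- A translation map lifts to a unital linear map `H → D ⊗ D`: a linear lift `t` is corrected to
`h ↦ t(h) + ε(h) (1 ⊗ 1 - t(1))`. -/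
theorem exists_unital_lift (hD : ρ.IsFaithfullyFlatGalois ι) :
    ∃ s : H →ₗ[k] D ⊗[k] D, (∀ h, ρ.canLin (s h) = 1 ⊗ₜ h) ∧ s 1 = 1 ⊗ₜ 1 := by
  obtain ⟨t, ht⟩ := (Submodule.mkQ (balancedRel k (fun (a : D) (r : R) ↦ a * ι r)
    (fun (r : R) (a : D) ↦ ι r * a))).exists_rightInverse_of_surjective
      (Submodule.range_mkQ _)
  have h1 (h : H) : ρ.canLin (t (hD.translation h)) = 1 ⊗ₜ h := by
    have h2 : ρ.can ι hD.range_eq.le (hD.translation h) = 1 ⊗ₜ h :=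
      LinearEquiv.apply_symm_apply (LinearEquiv.ofBijective _ hD.can_bijective) _
    rw [← h2]
    conv_rhs => rw [← LinearMap.id_apply (R := k) (hD.translation h), ← ht]
    rfl
  refine ⟨t ∘ₗ hD.translation + Coalgebra.counit.smulRight (1 ⊗ₜ 1 - t (hD.translation 1)),
    fun h ↦ ?_, ?_⟩
  · have h3 : ρ.canLin (1 ⊗ₜ 1 - t (hD.translation 1)) = 0 := by
      rw [map_sub, h1, canLin_tmul, map_one, ← Algebra.TensorProduct.one_def, mul_one, sub_self]
    simp [h1, h3]
  · simp

/-- A bicolinear lift of the translation map represents it. -/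
theorem IsTranslationLift.mk_eq {Γ : H →ₗ[k] D ⊗[k] D} (hΓ : ρ.IsTranslationLift Γ)
    (hD : ρ.IsFaithfullyFlatGalois ι) (h : H) :
    hD.translation h = Submodule.Quotient.mk (Γ h) := by
  refine hD.can_bijective.1 ?_
  have h2 : ρ.can ι hD.range_eq.le (hD.translation h) = 1 ⊗ₜ h :=
    LinearEquiv.apply_symm_apply (LinearEquiv.ofBijective _ hD.can_bijective) _
  rw [h2, ← ρ.canLin_of_isColinear hΓ.right_colinear hΓ.mul_eq h]
  rfl

variable [Coalgebra.IsCocomm k H]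

theorem op_coact_op (a : D) : ρ.op.coact (MulOpposite.op a) =
    TensorProduct.map (MulOpposite.opLinearEquiv k).toLinearMap (HopfAlgebra.antipode k)
      (ρ.coact a) :=
  ρ.op_coact_apply a

theorem antipode_comp_antipode :
    HopfAlgebra.antipode k ∘ₗ HopfAlgebra.antipode k = (LinearMap.id : H →ₗ[k] H) :=
  LinearMap.ext antipode_antipode

/-- If `φ` is a total integral for `D`, then `φ ∘ S` is one for `D^op`. -/
theorem IsTotalIntegral.op {φ : H →ₗ[k] D} (hφ : ρ.IsTotalIntegral φ) :
    ρ.op.IsTotalIntegral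
      ((MulOpposite.opLinearEquiv k).toLinearMap ∘ₗ φ ∘ₗ HopfAlgebra.antipode k) where
  colinear := by
    ext h
    have h1 := congr($hφ.colinear (HopfAlgebra.antipode k h))
    have h2 := congr($(comul_antipode (k := k) (H := H)) h)
    simp only [LinearMap.comp_apply] at h1 h2
    rw [h2, map_map_apply] at h1
    refine (ρ.op_coact_op _).trans ?_
    simp only [AlgHom.toLinearMap_apply] at h1
    refine (congrArg (TensorProduct.map _ _) h1).trans ?_
    rw [map_map_apply, LinearMap.id_comp, antipode_comp_antipode]
    rfl
  map_one := by
    simp [hφ.map_one]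

/-- A faithfully flat Galois extension has a bicolinear lift of its translation map. -/
theorem exists_isTranslationLift (hD : ρ.IsFaithfullyFlatGalois ι) :
    ∃ Γ, ρ.IsTranslationLift Γ := by
  obtain ⟨φ, hφ⟩ := exists_isTotalIntegral hD.range_eq.le hD.faithfullyFlat hD.can_bijective
  obtain ⟨s, hs, hs1⟩ := exists_unital_lift hD
  set S := HopfAlgebra.antipode k (A := H)
  set o : D →ₗ[k] Dᵐᵒᵖ := (MulOpposite.opLinearEquiv k).toLinearMap
  set o' : Dᵐᵒᵖ →ₗ[k] D := (MulOpposite.opLinearEquiv k).symm.toLinearMap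
  have ho : o' ∘ₗ o = LinearMap.id := by ext; simp [o, o']
  -- average in the right leg
  set Γ₁ := ρ.average φ s
  have h1 : IsColinear ρ.coact.toLinearMap LinearMap.id Γ₁ := ρ.isColinear_average hφ s
  have h1m : LinearMap.mul' k D ∘ₗ Γ₁ = convUnit k H D := ρ.mul_average hφ.map_one hs
  have h1one : Γ₁ 1 = 1 ⊗ₜ 1 := ρ.average_one hφ.map_one hs1
  -- pass to the opposite algebra, where the left leg becomes the right one
  set δ : Dᵐᵒᵖ →ₗ[k] Dᵐᵒᵖ ⊗[k] H := TensorProduct.map o LinearMap.id ∘ₗ ρ.coact.toLinearMap ∘ₗ o'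
  have hδo : δ ∘ₗ o = TensorProduct.map o LinearMap.id ∘ₗ ρ.coact.toLinearMap := by
    simp only [δ]
    rw [LinearMap.comp_assoc, LinearMap.comp_assoc, ho, LinearMap.comp_id]
  have hδo' : ρ.coact.toLinearMap ∘ₗ o' = TensorProduct.map o' LinearMap.id ∘ₗ δ := by
    simp only [δ]
    rw [← LinearMap.comp_assoc, ← TensorProduct.map_comp, ho, LinearMap.id_comp,
      TensorProduct.map_id, LinearMap.id_comp]
  set s₂ := swapLegs (TensorProduct.map o o ∘ₗ Γ₁)
  have hs₂ : IsColinear δ LinearMap.id (swapLegs s₂) := by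
    rw [swapLegs_swapLegs]
    exact h1.map o o hδo
  have hcan (h : H) : ρ.op.canLin (s₂ h) = 1 ⊗ₜ h := by
    have e1 (t : D ⊗[k] D) : ρ.op.canLin (TensorProduct.comm k _ _ (TensorProduct.map o o t)) =
        TensorProduct.map o S (ρ.flipEquivFun (ρ.canLin t)) := by
      induction t using TensorProduct.induction_on with
      | zero => simp
      | add y z hy hz => simp only [map_add, hy, hz]
      | tmul a b =>
        have e2 : ρ.flipEquivFun (ρ.canLin (a ⊗ₜ b)) = ρ.coact a * (b ⊗ₜ 1) := by
          rw [canLin_tmul]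
          have := ρ.flipEquivFun_coact b
          have e3 (t : D ⊗[k] H) : ρ.flipEquivFun ((a ⊗ₜ 1) * t) =
              ρ.coact a * ρ.flipEquivFun t := by
            induction t using TensorProduct.induction_on with
            | zero => simp
            | add y z hy hz => simp only [map_add, mul_add, hy, hz]
            | tmul x y => simp [mul_assoc]
          rw [e3, this]
        rw [e2, TensorProduct.map_tmul, TensorProduct.comm_tmul, canLin_tmul]
        change _ * ρ.op.coact (MulOpposite.op a) = _
        rw [op_coact_op]
        induction ρ.coact a using TensorProduct.induction_on with
        | zero => simp
        | add y z hy hz => simp only [map_add, add_mul, mul_add, hy, hz]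
        | tmul x y => simp [o, S]
    refine (e1 (Γ₁ h)).trans ?_
    rw [ρ.canLin_of_isColinear h1 h1m]
    simp [o, S, antipode_antipode]
  have hφ' := hφ.op
  set Γ₂ := ρ.op.average (o ∘ₗ φ ∘ₗ S) s₂
  have h2 : IsColinear ρ.op.coact.toLinearMap LinearMap.id Γ₂ := ρ.op.isColinear_average hφ' s₂
  have h2' : IsColinear δ LinearMap.id (swapLegs Γ₂) :=
    ρ.op.isColinear_swapLegs_average _ s₂ hs₂
  have h2m : LinearMap.mul' k Dᵐᵒᵖ ∘ₗ Γ₂ = convUnit k H Dᵐᵒᵖ :=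
    ρ.op.mul_average hφ'.map_one hcan
  have h2one : Γ₂ 1 = 1 ⊗ₜ 1 := by
    refine ρ.op.average_one hφ'.map_one ?_
    simp [s₂, swapLegs, h1one, o]
  refine ⟨TensorProduct.map o' o' ∘ₗ swapLegs Γ₂, h2'.map o' o' hδo', ?_, ?_, ?_⟩
  · have e : swapLegs (TensorProduct.map o' o' ∘ₗ swapLegs Γ₂) = TensorProduct.map o' o' ∘ₗ Γ₂ := by
      have : (TensorProduct.comm k D D).toLinearMap ∘ₗ TensorProduct.map o' o' ∘ₗ
          (TensorProduct.comm k Dᵐᵒᵖ Dᵐᵒᵖ).toLinearMap = TensorProduct.map o' o' := by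
        ext
        simp
      exact congr($this ∘ₗ Γ₂)
    rw [e]
    refine (h2.twist S).map o' o' ?_
    ext a
    obtain ⟨a, rfl⟩ := MulOpposite.op_surjective a
    change ρ.coact a = TensorProduct.map o' LinearMap.id (TensorProduct.map LinearMap.id S
      (ρ.op.coact (MulOpposite.op a)))
    rw [op_coact_op, map_map_apply, map_map_apply]
    change _ = TensorProduct.map (o' ∘ₗ o) (S ∘ₗ S) _
    rw [ho, antipode_comp_antipode, TensorProduct.map_id]
    rfl
  · have e : LinearMap.mul' k D ∘ₗ TensorProduct.map o' o' ∘ₗ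
        (TensorProduct.comm k Dᵐᵒᵖ Dᵐᵒᵖ).toLinearMap = o' ∘ₗ LinearMap.mul' k Dᵐᵒᵖ := by
      ext
      simp [o']
    change (LinearMap.mul' k D ∘ₗ TensorProduct.map o' o' ∘ₗ
        (TensorProduct.comm k Dᵐᵒᵖ Dᵐᵒᵖ).toLinearMap) ∘ₗ Γ₂ = _
    rw [e, LinearMap.comp_assoc, h2m]
    ext h
    simp [convUnit, o']
  · simp [swapLegs, h2one, o']

end ComoduleAlgebra

/-! ### Extensions with a bicolinear lift of the translation map -/

namespace ComoduleAlgebra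

variable {k : Type u} [Field k] {H : Type v} [Ring H] [HopfAlgebra k H]
  {D : Type w} [Ring D] [Algebra k D] {ρ : ComoduleAlgebra k H D} {Γ : H →ₗ[k] D ⊗[k] D}

/-- The map `D ⊗ H → D ⊗ D`, `d ⊗ h ↦ d l ⊗ r` with `Γ(h) = ∑ l ⊗ r`. -/
def actLeft (Γ : H →ₗ[k] D ⊗[k] D) : D ⊗[k] H →ₗ[k] D ⊗[k] D :=
  LinearMap.mul' k (D ⊗[k] D) ∘ₗ
    TensorProduct.map (Algebra.TensorProduct.includeLeft : D →ₐ[k] D ⊗[k] D).toLinearMap Γ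

@[simp] theorem actLeft_tmul (d : D) (h : H) : actLeft Γ (d ⊗ₜ h) = (d ⊗ₜ 1) * Γ h := rfl

theorem actLeft_mul (a : D) (t : D ⊗[k] H) :
    actLeft Γ ((a ⊗ₜ 1) * t) = (a ⊗ₜ 1) * actLeft Γ t := by
  induction t using TensorProduct.induction_on with
  | zero => simp
  | add y z hy hz => simp only [map_add, mul_add, hy, hz]
  | tmul x y => simp [← mul_assoc]

theorem canLin_mul (a : D) (t : D ⊗[k] D) : ρ.canLin ((a ⊗ₜ 1) * t) = (a ⊗ₜ 1) * ρ.canLin t := by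
  induction t using TensorProduct.induction_on with
  | zero => simp
  | add y z hy hz => simp only [map_add, mul_add, hy, hz]
  | tmul x y => simp [← mul_assoc]

namespace IsTranslationLift

theorem mul_actLeft_coact (hΓ : ρ.IsTranslationLift Γ) (a : D) :
    LinearMap.mul' k D (actLeft Γ (ρ.coact a)) = a := by
  have h1 (t : D ⊗[k] H) : LinearMap.mul' k D (actLeft Γ t) =
      TensorProduct.rid k D (TensorProduct.map LinearMap.id Coalgebra.counit t) := by
    induction t using TensorProduct.induction_on with
    | zero => simp
    | add y z hy hz => simp only [map_add, hy, hz]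
    | tmul x h =>
      have h2 (t : D ⊗[k] D) : LinearMap.mul' k D ((x ⊗ₜ 1) * t) = x * LinearMap.mul' k D t := by
        induction t using TensorProduct.induction_on with
        | zero => simp
        | add y z hy hz => simp only [map_add, mul_add, hy, hz]
        | tmul y z => simp [mul_assoc]
      have h3 : LinearMap.mul' k D (Γ h) = _ := congr($hΓ.mul_eq h)
      rw [actLeft_tmul, h2, h3]
      simp [convUnit, Algebra.algebraMap_eq_smul_one]
  rw [h1, counit_linear_apply]

theorem canLin_eq (hΓ : ρ.IsTranslationLift Γ) (h : H) : ρ.canLin (Γ h) = 1 ⊗ₜ h :=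
  ρ.canLin_of_isColinear hΓ.right_colinear hΓ.mul_eq h

theorem actLeft_coact_one (hΓ : ρ.IsTranslationLift Γ) : actLeft Γ (ρ.coact 1) = 1 ⊗ₜ 1 := by
  rw [_root_.map_one, Algebra.TensorProduct.one_def, actLeft_tmul, hΓ.map_one]
  simp

/-- Left colinearity as a convolution identity in the algebra `(D ⊗ H) ⊗ D`:
`∑ l₀ ⊗ l₁ ⊗ r`, for `Γ(h) = ∑ l ⊗ r`, is the product of `∑ l ⊗ 1 ⊗ r`, for
`Γ(h₁) = ∑ l ⊗ r`, with `1 ⊗ S(h₂) ⊗ 1`. -/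
theorem coact_left (hΓ : ρ.IsTranslationLift Γ) (h : H) :
    TensorProduct.map ρ.coact.toLinearMap LinearMap.id (Γ h) =
      conv ((Algebra.TensorProduct.map (Algebra.TensorProduct.includeLeft : D →ₐ[k] D ⊗[k] H)
        (AlgHom.id k D)).toLinearMap ∘ₗ Γ)
        (((Algebra.TensorProduct.includeLeft : D ⊗[k] H →ₐ[k] (D ⊗[k] H) ⊗[k] D).comp
          Algebra.TensorProduct.includeRight).toLinearMap ∘ₗ HopfAlgebra.antipode k) h := by
  have h1 := congr(TensorProduct.comm k D (D ⊗[k] H) ($hΓ.left_colinear h))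
  simp only [LinearMap.comp_apply, swapLegs, LinearEquiv.coe_coe] at h1
  have h2 (t : D ⊗[k] D) : TensorProduct.comm k D (D ⊗[k] H) (TensorProduct.map LinearMap.id
      ρ.coact.toLinearMap (TensorProduct.comm k D D t)) =
      TensorProduct.map ρ.coact.toLinearMap LinearMap.id t := by
    induction t using TensorProduct.induction_on with
    | zero => simp
    | add y z hy hz => simp only [map_add, hy, hz]
    | tmul x h => simp
  rw [← h2, h1, conv, LinearMap.comp_apply, LinearMap.comp_apply]
  induction Coalgebra.comul (R := k) h using TensorProduct.induction_on with
  | zero => simp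
  | add y z hy hz => simp only [map_add, hy, hz]
  | tmul x y =>
    simp only [TensorProduct.map_tmul, LinearMap.comp_apply, LinearMap.mul'_apply,
      LinearEquiv.coe_coe]
    induction Γ x using TensorProduct.induction_on with
    | zero => simp
    | add y z hy hz => simp only [map_add, hy, hz, TensorProduct.add_tmul, add_mul]
    | tmul y z => simp

variable [Coalgebra.IsCocomm k H]

/-- The legs `a₀ l` of `∑ a₀ l ⊗ r`, `Γ(a₁) = ∑ l ⊗ r`, are coinvariant. -/
theorem coact_actLeft_coact (hΓ : ρ.IsTranslationLift Γ) (a : D) :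
    TensorProduct.map ρ.coact.toLinearMap LinearMap.id (actLeft Γ (ρ.coact a)) =
      TensorProduct.map (Algebra.TensorProduct.includeLeft : D →ₐ[k] D ⊗[k] H).toLinearMap
        LinearMap.id (actLeft Γ (ρ.coact a)) := by
  set S := HopfAlgebra.antipode k (A := H)
  set i := Algebra.TensorProduct.map (Algebra.TensorProduct.includeLeft : D →ₐ[k] D ⊗[k] H)
    (AlgHom.id k D)
  set j := (Algebra.TensorProduct.includeLeft : D ⊗[k] H →ₐ[k] (D ⊗[k] H) ⊗[k] D).comp
    Algebra.TensorProduct.includeRight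
  set Λ := conv (i.toLinearMap ∘ₗ Γ) (j.toLinearMap ∘ₗ S)
  -- the factors `a₁` and `S(a₂)` cancel, since `a₁ ⊗ a₂ ⊗ a₃` is symmetric
  have hΛ : conv j.toLinearMap Λ = i.toLinearMap ∘ₗ Γ := by
    have h2 : conv j.toLinearMap (j.toLinearMap ∘ₗ S) = convUnit k H ((D ⊗[k] H) ⊗[k] D) := by
      have := comp_conv j LinearMap.id S
      rw [id_conv_antipode, comp_convUnit, LinearMap.comp_id] at this
      exact this.symm
    rw [show Λ = conv (j.toLinearMap ∘ₗ S) (i.toLinearMap ∘ₗ Γ) from conv_comm _ _ fun x y ↦ ?_,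
      ← conv_assoc, h2, convUnit_conv]
    simp only [LinearMap.comp_apply, AlgHom.toLinearMap_apply, Commute, SemiconjBy]
    induction Γ x using TensorProduct.induction_on with
    | zero => simp
    | add y z hy hz => simp only [map_add, hy, hz, mul_add, add_mul]
    | tmul y z => simp [i, j]
  set G : (D ⊗[k] H) ⊗[k] H →ₗ[k] (D ⊗[k] H) ⊗[k] D := LinearMap.mul' k _ ∘ₗ
    TensorProduct.map
      (Algebra.TensorProduct.includeLeft : D ⊗[k] H →ₐ[k] (D ⊗[k] H) ⊗[k] D).toLinearMap Λ
  have hmul (x y : D ⊗[k] D) : TensorProduct.map ρ.coact.toLinearMap LinearMap.id (x * y) =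
      TensorProduct.map ρ.coact.toLinearMap LinearMap.id x *
        TensorProduct.map ρ.coact.toLinearMap LinearMap.id y :=
    map_mul (Algebra.TensorProduct.map ρ.coact (AlgHom.id k D)) x y
  have h1 (t : D ⊗[k] H) : TensorProduct.map ρ.coact.toLinearMap LinearMap.id (actLeft Γ t) =
      G (TensorProduct.map ρ.coact.toLinearMap LinearMap.id t) := by
    induction t using TensorProduct.induction_on with
    | zero => simp
    | add y z hy hz => simp only [map_add, hy, hz]
    | tmul d h =>
      rw [actLeft_tmul, hmul, hΓ.coact_left]
      rfl
  have h2 (d : D) (t : H ⊗[k] H) : G ((TensorProduct.assoc k D H H).symm (d ⊗ₜ t)) =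
      i (d ⊗ₜ 1) * LinearMap.mul' k _ (TensorProduct.map j.toLinearMap Λ t) := by
    induction t using TensorProduct.induction_on with
    | zero => simp
    | add y z hy hz => simp only [map_add, hy, hz, mul_add, TensorProduct.tmul_add]
    | tmul x y => simp [G, i, j, ← mul_assoc]
  rw [h1, coassoc_linear_apply]
  change _ = i (actLeft Γ (ρ.coact a))
  induction ρ.coact a using TensorProduct.induction_on with
  | zero => simp
  | add y z hy hz => simp only [map_add, hy, hz]
  | tmul d c =>
    rw [TensorProduct.map_tmul, LinearMap.id_apply, h2, actLeft_tmul, map_mul]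
    exact congr(i (d ⊗ₜ 1) * $hΛ c)

variable {R : Type x} [Ring R] [Algebra k R] {ι : R →ₐ[k] D}

/-- The map `σ(a) = ∑ a₀ l ⊗ r`, `Γ(a₁) = ∑ l ⊗ r`, as a unital section `D → R ⊗ D` of the
multiplication, linear over the subalgebra `R` of coinvariants. -/
theorem exists_section (hΓ : ρ.IsTranslationLift Γ) (hinj : Function.Injective ι)
    (hι : ι.range = ρ.coinvariants) :
    ∃ σ : D →ₗ[k] R ⊗[k] D,
      (∀ a, TensorProduct.map ι.toLinearMap LinearMap.id (σ a) = actLeft Γ (ρ.coact a)) ∧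
      (∀ r a, σ (ι r * a) = TensorProduct.map (LinearMap.mulLeft k r) LinearMap.id (σ a)) ∧
      σ 1 = 1 ⊗ₜ 1 := by
  have hinj' : Function.Injective (TensorProduct.map ι.toLinearMap (LinearMap.id : D →ₗ[k] D)) :=
    map_id_injective hinj
  have hex : Function.Exact ι.toLinearMap (ρ.coact.toLinearMap -
      (Algebra.TensorProduct.includeLeft : D →ₐ[k] D ⊗[k] H).toLinearMap) := by
    intro y
    rw [LinearMap.sub_apply, sub_eq_zero]
    change y ∈ ρ.coinvariants ↔ y ∈ ι.range
    rw [hι]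
  have hmem (a : D) : actLeft Γ (ρ.coact a) ∈
      LinearMap.range (TensorProduct.map ι.toLinearMap (LinearMap.id : D →ₗ[k] D)) := by
    refine (Module.Flat.rTensor_exact (M := D) hex _).1 ?_
    rw [LinearMap.rTensor_sub, LinearMap.sub_apply, sub_eq_zero]
    exact hΓ.coact_actLeft_coact a
  set e := LinearEquiv.ofInjective _ hinj'
  set σ : D →ₗ[k] R ⊗[k] D := e.symm.toLinearMap ∘ₗ
    (actLeft Γ ∘ₗ ρ.coact.toLinearMap).codRestrict _ hmem
  have hσ (a : D) :
      TensorProduct.map ι.toLinearMap LinearMap.id (σ a) = actLeft Γ (ρ.coact a) :=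
    congrArg Subtype.val (e.apply_symm_apply ⟨_, hmem a⟩)
  refine ⟨σ, hσ, fun r a ↦ hinj' ?_, hinj' ?_⟩
  · have hr : ρ.coact (ι r) = ι r ⊗ₜ[k] 1 := hι.le ⟨r, rfl⟩
    rw [hσ, map_mul, hr, actLeft_mul, ← hσ]
    induction σ a using TensorProduct.induction_on with
    | zero => simp
    | add y z hy hz => simp only [map_add, mul_add, hy, hz]
    | tmul x y => simp
  · rw [hσ, hΓ.actLeft_coact_one]
    simp

theorem can_bijective (hΓ : ρ.IsTranslationLift Γ) (hinj : Function.Injective ι)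
    (hι : ι.range = ρ.coinvariants) : Function.Bijective (ρ.can ι hι.le) := by
  obtain ⟨σ, hσ, -, -⟩ := hΓ.exists_section hinj hι
  set q := Submodule.mkQ (balancedRel k (fun (a : D) (r : R) ↦ a * ι r)
    (fun (r : R) (a : D) ↦ ι r * a))
  refine Function.bijective_iff_has_inverse.2 ⟨q ∘ₗ actLeft Γ, fun t ↦ ?_, fun t ↦ ?_⟩
  · obtain ⟨t, rfl⟩ := Submodule.Quotient.mk_surjective _ t
    change q (actLeft Γ (ρ.canLin t)) = q t
    induction t using TensorProduct.induction_on with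
    | zero => simp
    | add y z hy hz => simp only [map_add, hy, hz]
    | tmul a b =>
      rw [canLin_tmul, actLeft_mul]
      have h1 (z : R ⊗[k] D) :
          q ((a ⊗ₜ 1) * TensorProduct.map ι.toLinearMap LinearMap.id z) =
            q (a ⊗ₜ LinearMap.mul' k D (TensorProduct.map ι.toLinearMap LinearMap.id z)) := by
        induction z using TensorProduct.induction_on with
        | zero => simp
        | add y z hy hz => simp only [map_add, mul_add, TensorProduct.tmul_add, hy, hz]
        | tmul r d =>
          refine (Submodule.Quotient.eq _).2 (Submodule.subset_span ⟨a, r, d, ?_⟩)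
          simp
      rw [← hσ, h1, hσ, hΓ.mul_actLeft_coact]
  · change ρ.canLin (actLeft Γ t) = t
    induction t using TensorProduct.induction_on with
    | zero => simp
    | add y z hy hz => simp only [map_add, hy, hz]
    | tmul d h =>
      rw [actLeft_tmul, canLin_mul, hΓ.canLin_eq]
      simp

theorem isLeftFaithfullyFlat.{m} (hΓ : ρ.IsTranslationLift Γ) (hinj : Function.Injective ι)
    (hι : ι.range = ρ.coinvariants) : IsLeftFaithfullyFlat.{m} ι := by
  obtain ⟨σ, hσ, hσr, hσ1⟩ := hΓ.exists_section hinj hι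
  -- `m ⊗ d ↦ m σ(d)` embeds `M ⊗_R D` naturally in `M ⊗ D`
  have key (M : Type m) [AddCommGroup M] [Module k M] [Module Rᵐᵒᵖ M] [IsScalarTower k Rᵐᵒᵖ M] :
      ∃ T : TensorAlong ι M →ₗ[k] M ⊗[k] D, Function.Injective T ∧
        ∀ m d, T (TensorAlong.mk ι m d) = TensorProduct.map
          ((LinearMap.toSpanSingleton Rᵐᵒᵖ M m).restrictScalars k ∘ₗ
            (MulOpposite.opLinearEquiv k).toLinearMap) LinearMap.id (σ d) := by
    set T : TensorAlong ι M →ₗ[k] M ⊗[k] D := TensorAlong.lift ι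
      (LinearMap.mk₂ k (fun m d ↦ TensorProduct.map
          ((LinearMap.toSpanSingleton Rᵐᵒᵖ M m).restrictScalars k ∘ₗ
            (MulOpposite.opLinearEquiv k).toLinearMap) LinearMap.id (σ d))
        (fun m m' d ↦ by
          induction σ d using TensorProduct.induction_on with
          | zero => simp
          | add y z hy hz => simp only [map_add, hy, hz]; abel
          | tmul x y => simp [TensorProduct.add_tmul])
        (fun c m d ↦ by
          induction σ d using TensorProduct.induction_on with
          | zero => simp
          | add y z hy hz => simp only [map_add, hy, hz, smul_add]
          | tmul x y => simp [TensorProduct.smul_tmul', smul_comm _ c])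
        (fun m d d' ↦ by rw [map_add, map_add])
        (fun c m d ↦ by rw [map_smul, map_smul]))
      (fun m r d ↦ by
        simp only [LinearMap.mk₂_apply, hσr]
        induction σ d using TensorProduct.induction_on with
        | zero => simp
        | add y z hy hz => simp only [map_add, hy, hz]
        | tmul x y => simp [mul_smul]) with hT
    have hTmk (m : M) (d : D) : T (TensorAlong.mk ι m d) = TensorProduct.map
          ((LinearMap.toSpanSingleton Rᵐᵒᵖ M m).restrictScalars k ∘ₗ
            (MulOpposite.opLinearEquiv k).toLinearMap) LinearMap.id (σ d) := rfl
    refine ⟨T, Function.LeftInverse.injective (g := Submodule.mkQ _) fun t ↦ ?_, hTmk⟩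
    induction t using TensorAlong.induction_on with
    | zero => simp
    | add s t hs ht => rw [map_add, map_add, hs, ht]
    | mk m d =>
      have h1 (z : R ⊗[k] D) : Submodule.mkQ (balancedRel k
          (fun (m : M) (r : R) ↦ MulOpposite.op r • m) (fun (r : R) (a : D) ↦ ι r * a))
          (TensorProduct.map ((LinearMap.toSpanSingleton Rᵐᵒᵖ M m).restrictScalars k ∘ₗ
            (MulOpposite.opLinearEquiv k).toLinearMap) LinearMap.id z) =
          TensorAlong.mk ι m
            (LinearMap.mul' k D (TensorProduct.map ι.toLinearMap LinearMap.id z)) := by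
        induction z using TensorProduct.induction_on with
        | zero => simp [TensorAlong.mk]
        | add y z hy hz => simp only [map_add, hy, hz, TensorAlong.mk_add_right]
        | tmul r d => exact TensorAlong.mk_op_smul ι m r d
      rw [hTmk, h1, hσ, hΓ.mul_actLeft_coact]
  refine ⟨fun M N _ _ _ _ _ _ _ _ f hf ↦ ?_, fun M _ _ _ _ hM ↦ ?_⟩
  · obtain ⟨T, hT, hTmk⟩ := key M
    obtain ⟨T', -, hTmk'⟩ := key N
    have h1 : T' ∘ₗ TensorAlong.map ι f =
        TensorProduct.map (f.restrictScalars k) LinearMap.id ∘ₗ T := by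
      refine TensorAlong.hom_ext fun m d ↦ ?_
      rw [LinearMap.comp_apply, LinearMap.comp_apply, TensorAlong.map_mk, hTmk, hTmk',
        map_map_apply]
      congr 2
      ext
      simp
    have h2 : Function.Injective
        (TensorProduct.map (f.restrictScalars k) (LinearMap.id : D →ₗ[k] D)) := map_id_injective hf
    have h3 := h2.comp hT
    refine Function.Injective.of_comp (f := T') ?_
    intro a b hab
    refine h3 ?_
    have h4 (a) := congr($h1 a)
    simp only [LinearMap.comp_apply] at h4
    simpa only [Function.comp_apply, h4] using hab
  · obtain ⟨T, hT, hTmk⟩ := key M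
    refine subsingleton_of_forall_eq 0 fun m ↦ ?_
    have h1 : m ⊗ₜ[k] (1 : D) = 0 := by
      have h2 := hTmk m 1
      rw [Subsingleton.elim (TensorAlong.mk ι m 1) 0, map_zero, hσ1] at h2
      simpa using h2.symm
    rcases eq_or_ne (1 : D) 0 with h0 | h0
    · have h2 : (1 : R) = 0 := hinj (by simpa using h0)
      rw [← one_smul Rᵐᵒᵖ m, ← MulOpposite.op_one, h2, MulOpposite.op_zero, zero_smul]
    · obtain ⟨β, hβ⟩ := Module.Projective.exists_dual_ne_zero k h0
      have h2 := congrArg (contract M β) h1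
      rw [contract_tmul, map_zero] at h2
      exact (smul_eq_zero.1 h2).resolve_left hβ

/-- A comodule algebra with a bicolinear lift of a translation map is a faithfully flat Galois
extension of its coinvariants. -/
theorem isFaithfullyFlatGalois (hΓ : ρ.IsTranslationLift Γ) (hinj : Function.Injective ι)
    (hι : ι.range = ρ.coinvariants) : ρ.IsFaithfullyFlatGalois ι :=
  ⟨hinj, hι, hΓ.can_bijective hinj hι, hΓ.isLeftFaithfullyFlat hinj hι⟩

end IsTranslationLift

end ComoduleAlgebra

/-! ### Lifts of translation maps for tensor products and equalizers -/

section Sub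

variable {k : Type*} [Field k] {M N M' : Type*} [AddCommGroup M] [Module k M]
  [AddCommGroup N] [Module k N] [AddCommGroup M'] [Module k M']

theorem map_sub_id (f g : M →ₗ[k] N) :
    TensorProduct.map (f - g) (LinearMap.id : M' →ₗ[k] M') =
      TensorProduct.map f LinearMap.id - TensorProduct.map g LinearMap.id :=
  LinearMap.rTensor_sub f g

theorem map_id_sub (f g : M →ₗ[k] N) :
    TensorProduct.map (LinearMap.id : M' →ₗ[k] M') (f - g) =
      TensorProduct.map LinearMap.id f - TensorProduct.map LinearMap.id g :=
  LinearMap.lTensor_sub f g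

end Sub

section TensorLegs

variable {k : Type u} [Field k] {H : Type v} [Ring H] [HopfAlgebra k H]
  {X : Type*} [AddCommGroup X] [Module k X] {Y : Type*} [AddCommGroup Y] [Module k Y]
  {X' : Type*} [AddCommGroup X'] [Module k X'] {Y' : Type*} [AddCommGroup Y'] [Module k Y']

/-- The map `h ↦ ∑ (x ⊗ x') ⊗ (y ⊗ y')` with `s(h₁) = ∑ x ⊗ y` and `t(h₂) = ∑ x' ⊗ y'`. -/
def tensorLegs (s : H →ₗ[k] X ⊗[k] Y) (t : H →ₗ[k] X' ⊗[k] Y') :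
    H →ₗ[k] (X ⊗[k] X') ⊗[k] (Y ⊗[k] Y') :=
  (TensorProduct.tensorTensorTensorComm k X Y X' Y').toLinearMap ∘ₗ
    TensorProduct.map s t ∘ₗ Coalgebra.comul

theorem swapLegs_tensorLegs (s : H →ₗ[k] X ⊗[k] Y) (t : H →ₗ[k] X' ⊗[k] Y') :
    swapLegs (tensorLegs s t) = tensorLegs (swapLegs s) (swapLegs t) := by
  have e : (TensorProduct.comm k (X ⊗[k] X') (Y ⊗[k] Y')).toLinearMap ∘ₗ
      (TensorProduct.tensorTensorTensorComm k X Y X' Y').toLinearMap =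
      (TensorProduct.tensorTensorTensorComm k Y X Y' X').toLinearMap ∘ₗ
        TensorProduct.map (TensorProduct.comm k X Y).toLinearMap
          (TensorProduct.comm k X' Y').toLinearMap := by
    ext
    simp
  rw [swapLegs, tensorLegs, tensorLegs, swapLegs, swapLegs, ← LinearMap.comp_assoc, e,
    TensorProduct.map_comp]
  rfl

variable [Coalgebra.IsCocomm k H]

/-- `tensorLegs s t` is colinear for the coaction `y ⊗ y' ↦ y₀ ⊗ y' ⊗ y₁` if `s` is colinear. -/
theorem isColinear_tensorLegs_left {δ : Y →ₗ[k] Y ⊗[k] H} {θ : H →ₗ[k] H}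
    {s : H →ₗ[k] X ⊗[k] Y} (hs : IsColinear δ θ s) (t : H →ₗ[k] X' ⊗[k] Y') :
    IsColinear ((TensorProduct.rightComm k Y H Y').toLinearMap ∘ₗ
      TensorProduct.map δ LinearMap.id) θ (tensorLegs s t) := by
  have e : TensorProduct.map LinearMap.id ((TensorProduct.rightComm k Y H Y').toLinearMap ∘ₗ
        TensorProduct.map δ LinearMap.id) ∘ₗ
      (TensorProduct.tensorTensorTensorComm k X Y X' Y').toLinearMap =
      TensorProduct.map LinearMap.id (TensorProduct.rightComm k Y H Y').toLinearMap ∘ₗ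
      (TensorProduct.tensorTensorTensorComm k X (Y ⊗[k] H) X' Y').toLinearMap ∘ₗ
        TensorProduct.map (TensorProduct.map LinearMap.id δ) LinearMap.id := by
    ext
    simp
  have h1 : TensorProduct.map (tensorLegs s t) θ ∘ₗ Coalgebra.comul =
      TensorProduct.map ((TensorProduct.tensorTensorTensorComm k X Y X' Y').toLinearMap ∘ₗ
        TensorProduct.map s t) θ ∘ₗ comul₃ k H := by
    rw [← map_comp_comul_comul]
    rfl
  have h2 : TensorProduct.map (TensorProduct.map LinearMap.id δ) LinearMap.id ∘ₗ
      TensorProduct.map s t ∘ₗ Coalgebra.comul =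
      TensorProduct.map ((TensorProduct.assoc k X Y H).toLinearMap ∘ₗ TensorProduct.map s θ)
        t ∘ₗ comul₃ k H := by
    rw [← LinearMap.comp_assoc, ← TensorProduct.map_comp, hs, LinearMap.id_comp,
      ← LinearMap.comp_assoc, map_comp_comul_comul]
  rw [IsColinear, h1, tensorLegs, ← LinearMap.comp_assoc, e, LinearMap.comp_assoc,
    LinearMap.comp_assoc, h2, ← LinearMap.comp_assoc (comul₃ k H),
    ← LinearMap.comp_assoc (comul₃ k H), ← LinearMap.comp_assoc (comul₃ k H)]
  refine comul₃_swap₂₃ fun a b c ↦ ?_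
  simp only [LinearMap.comp_apply, TensorProduct.map_tmul, LinearEquiv.coe_coe]
  induction s a using TensorProduct.induction_on with
  | zero => simp
  | add y z hy hz => simp only [map_add, hy, hz, TensorProduct.add_tmul]
  | tmul x y =>
    induction t c using TensorProduct.induction_on with
    | zero => simp
    | add y z hy hz => simp only [map_add, hy, hz, TensorProduct.tmul_add, TensorProduct.add_tmul]
    | tmul x' y' => simp

/-- `tensorLegs s t` is colinear for the coaction `y ⊗ y' ↦ y ⊗ y'₀ ⊗ y'₁` if `t` is colinear. -/
theorem isColinear_tensorLegs_right (s : H →ₗ[k] X ⊗[k] Y) {δ : Y' →ₗ[k] Y' ⊗[k] H}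
    {θ : H →ₗ[k] H} {t : H →ₗ[k] X' ⊗[k] Y'} (ht : IsColinear δ θ t) :
    IsColinear ((TensorProduct.assoc k Y Y' H).symm.toLinearMap ∘ₗ
      TensorProduct.map LinearMap.id δ) θ (tensorLegs s t) := by
  have e : tensorLegs s t = TensorProduct.map (TensorProduct.comm k X' X).toLinearMap
      (TensorProduct.comm k Y' Y).toLinearMap ∘ₗ tensorLegs t s := by
    have e1 : (TensorProduct.tensorTensorTensorComm k X Y X' Y').toLinearMap ∘ₗ
        TensorProduct.map s t ∘ₗ (TensorProduct.comm k H H).toLinearMap =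
        TensorProduct.map (TensorProduct.comm k X' X).toLinearMap
          (TensorProduct.comm k Y' Y).toLinearMap ∘ₗ
          (TensorProduct.tensorTensorTensorComm k X' Y' X Y).toLinearMap ∘ₗ
          TensorProduct.map t s := by
      refine TensorProduct.ext' fun a b ↦ ?_
      simp only [LinearMap.comp_apply, LinearEquiv.coe_coe, TensorProduct.comm_tmul,
        TensorProduct.map_tmul]
      induction s b using TensorProduct.induction_on with
      | zero => simp
      | add y z hy hz =>
        simp only [map_add, hy, hz, TensorProduct.tmul_add, TensorProduct.add_tmul]
      | tmul x y =>
        induction t a using TensorProduct.induction_on with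
        | zero => simp
        | add y z hy hz =>
          simp only [map_add, hy, hz, TensorProduct.tmul_add, TensorProduct.add_tmul]
        | tmul x' y' => simp
    ext h
    have h1 := congr($e1 (Coalgebra.comul h))
    simp only [LinearMap.comp_apply, LinearEquiv.coe_coe, Coalgebra.comm_comul] at h1
    exact h1
  rw [e]
  refine (isColinear_tensorLegs_left ht s).map _ _ ?_
  refine TensorProduct.ext' fun a b ↦ ?_
  simp only [LinearMap.comp_apply, LinearEquiv.coe_coe, TensorProduct.comm_tmul,
    TensorProduct.map_tmul]
  induction δ a using TensorProduct.induction_on with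
  | zero => simp
  | add y z hy hz => simp only [map_add, hy, hz, TensorProduct.tmul_add, TensorProduct.add_tmul]
  | tmul x y => simp

end TensorLegs

namespace ComoduleAlgebra

variable {k : Type u} [Field k] {H : Type v} [Ring H] [HopfAlgebra k H]
  {A : Type w} [Ring A] [Algebra k A] {A' : Type w'} [Ring A'] [Algebra k A']
  {ρ : ComoduleAlgebra k H A} {ρ' : ComoduleAlgebra k H A'}

theorem tensorLeft_coact : (ρ.tensorLeft A').coact.toLinearMap =
    (TensorProduct.rightComm k A H A').toLinearMap ∘ₗ
      TensorProduct.map ρ.coact.toLinearMap LinearMap.id := by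
  refine TensorProduct.ext' fun a a' ↦ ?_
  change (Algebra.TensorProduct.assoc k k k A A' H).symm
    (Algebra.TensorProduct.leftComm k A' A H (a' ⊗ₜ ρ.coact a)) =
      TensorProduct.rightComm k A H A' (ρ.coact a ⊗ₜ a')
  induction ρ.coact a using TensorProduct.induction_on with
  | zero => simp
  | add y z hy hz => simp only [map_add, hy, hz, TensorProduct.tmul_add, TensorProduct.add_tmul]
  | tmul x y => simp

theorem tensorRight_coact : (tensorRight A ρ').coact.toLinearMap =
    (TensorProduct.assoc k A A' H).symm.toLinearMap ∘ₗ
      TensorProduct.map LinearMap.id ρ'.coact.toLinearMap := rfl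

namespace IsTranslationLift

theorem mul_tensorLegs {Γ : H →ₗ[k] A ⊗[k] A} {Γ' : H →ₗ[k] A' ⊗[k] A'}
    (hΓ : ρ.IsTranslationLift Γ) (hΓ' : ρ'.IsTranslationLift Γ') :
    LinearMap.mul' k (A ⊗[k] A') ∘ₗ tensorLegs Γ Γ' = convUnit k H (A ⊗[k] A') := by
  have e : LinearMap.mul' k (A ⊗[k] A') ∘ₗ
      (TensorProduct.tensorTensorTensorComm k A A A' A').toLinearMap =
      TensorProduct.map (LinearMap.mul' k A) (LinearMap.mul' k A') := by
    ext
    simp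
  rw [tensorLegs, ← LinearMap.comp_assoc, e, ← LinearMap.comp_assoc, ← TensorProduct.map_comp,
    hΓ.mul_eq, hΓ'.mul_eq, convUnit, convUnit, TensorProduct.map_comp]
  ext h
  have h1 := Coalgebra.rTensor_counit_comul (R := k) h
  have h2 : TensorProduct.map Coalgebra.counit Coalgebra.counit (Coalgebra.comul h) =
      (1 : k) ⊗ₜ[k] Coalgebra.counit (R := k) h := by
    rw [← LinearMap.lTensor_comp_rTensor, LinearMap.comp_apply, h1, LinearMap.lTensor_tmul]
  simp only [LinearMap.comp_apply]
  rw [h2]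
  simp [convUnit, Algebra.algebraMap_eq_smul_one, Algebra.TensorProduct.one_def]

theorem tensorLegs_one {Γ : H →ₗ[k] A ⊗[k] A} {Γ' : H →ₗ[k] A' ⊗[k] A'}
    (hΓ : ρ.IsTranslationLift Γ) (hΓ' : ρ'.IsTranslationLift Γ') :
    tensorLegs Γ Γ' 1 = 1 ⊗ₜ 1 := by
  simp [tensorLegs, Algebra.TensorProduct.one_def, hΓ.map_one, hΓ'.map_one]

variable [Coalgebra.IsCocomm k H]

theorem tensorLeft {Γ : H →ₗ[k] A ⊗[k] A} {Γ' : H →ₗ[k] A' ⊗[k] A'}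
    (hΓ : ρ.IsTranslationLift Γ) (hΓ' : ρ'.IsTranslationLift Γ') :
    (ρ.tensorLeft A').IsTranslationLift (tensorLegs Γ Γ') where
  right_colinear := by
    rw [tensorLeft_coact]
    exact isColinear_tensorLegs_left hΓ.right_colinear Γ'
  left_colinear := by
    rw [tensorLeft_coact, swapLegs_tensorLegs]
    exact isColinear_tensorLegs_left hΓ.left_colinear _
  mul_eq := hΓ.mul_tensorLegs hΓ'
  map_one := hΓ.tensorLegs_one hΓ'

theorem tensorRight {Γ : H →ₗ[k] A ⊗[k] A} {Γ' : H →ₗ[k] A' ⊗[k] A'}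
    (hΓ : ρ.IsTranslationLift Γ) (hΓ' : ρ'.IsTranslationLift Γ') :
    (ComoduleAlgebra.tensorRight A ρ').IsTranslationLift (tensorLegs Γ Γ') where
  right_colinear := by
    rw [tensorRight_coact]
    exact isColinear_tensorLegs_right Γ hΓ'.right_colinear
  left_colinear := by
    rw [tensorRight_coact, swapLegs_tensorLegs]
    exact isColinear_tensorLegs_right _ hΓ'.left_colinear
  mul_eq := hΓ.mul_tensorLegs hΓ'
  map_one := hΓ.tensorLegs_one hΓ'

/-- Exchanging the legs of a bicolinear lift for `A` gives one for `A^op`. -/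
theorem op {Γ : H →ₗ[k] A ⊗[k] A} (hΓ : ρ.IsTranslationLift Γ) :
    ρ.op.IsTranslationLift (TensorProduct.map (MulOpposite.opLinearEquiv k).toLinearMap
      (MulOpposite.opLinearEquiv k).toLinearMap ∘ₗ swapLegs Γ) := by
  set S := HopfAlgebra.antipode k (A := H)
  set o : A →ₗ[k] Aᵐᵒᵖ := (MulOpposite.opLinearEquiv k).toLinearMap
  have ho : ρ.op.coact.toLinearMap ∘ₗ o =
      TensorProduct.map o LinearMap.id ∘ₗ TensorProduct.map LinearMap.id S ∘ₗ
        ρ.coact.toLinearMap := by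
    ext a
    refine (ρ.op_coact_op a).trans ?_
    simp only [LinearMap.comp_apply, map_map_apply]
    rfl
  refine ⟨?_, ?_, ?_, ?_⟩
  · have h1 := (hΓ.left_colinear.twist S).map o o ho
    rwa [antipode_comp_antipode] at h1
  · have e : swapLegs (TensorProduct.map o o ∘ₗ swapLegs Γ) = TensorProduct.map o o ∘ₗ Γ := by
      have : (TensorProduct.comm k Aᵐᵒᵖ Aᵐᵒᵖ).toLinearMap ∘ₗ TensorProduct.map o o ∘ₗ
          (TensorProduct.comm k A A).toLinearMap = TensorProduct.map o o := by
        ext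
        simp
      exact congr($this ∘ₗ Γ)
    rw [e]
    exact (hΓ.right_colinear.twist S).map o o ho
  · have e : LinearMap.mul' k Aᵐᵒᵖ ∘ₗ TensorProduct.map o o ∘ₗ
        (TensorProduct.comm k A A).toLinearMap = o ∘ₗ LinearMap.mul' k A := by
      ext
      simp [o]
    change (LinearMap.mul' k Aᵐᵒᵖ ∘ₗ TensorProduct.map o o ∘ₗ
        (TensorProduct.comm k A A).toLinearMap) ∘ₗ Γ = _
    rw [e, LinearMap.comp_assoc, hΓ.mul_eq]
    ext h
    simp [convUnit, o]
  · simp [swapLegs, hΓ.map_one, o]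

end IsTranslationLift

section Equalizer

variable {ρ₁ ρ₂ : ComoduleAlgebra k H A}

theorem map_val_equalizer_coact (a : AlgHom.equalizer ρ₁.coact ρ₂.coact) :
    TensorProduct.map (AlgHom.equalizer ρ₁.coact ρ₂.coact).val.toLinearMap LinearMap.id
      ((equalizer ρ₁ ρ₂).coact a) = ρ₁.coact a :=
  congr($(map_val_equalizerCoact ρ₁ ρ₂) a)

/-- Colinearity for the coaction on `E = {a | ρ₁(a) = ρ₂(a)}` can be checked in `A`. -/
theorem isColinear_equalizer {θ : H →ₗ[k] H}
    {s : H →ₗ[k] AlgHom.equalizer ρ₁.coact ρ₂.coact ⊗[k] AlgHom.equalizer ρ₁.coact ρ₂.coact}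
    (hs : IsColinear ρ₁.coact.toLinearMap θ (TensorProduct.map
      (AlgHom.equalizer ρ₁.coact ρ₂.coact).val.toLinearMap
      (AlgHom.equalizer ρ₁.coact ρ₂.coact).val.toLinearMap ∘ₗ s)) :
    IsColinear (equalizer ρ₁ ρ₂).coact.toLinearMap θ s := by
  set E := AlgHom.equalizer ρ₁.coact ρ₂.coact
  set i : E →ₗ[k] A := E.val.toLinearMap
  have hi : Function.Injective i := Subtype.val_injective
  have hinj : Function.Injective (TensorProduct.map i
      (TensorProduct.map i (LinearMap.id : H →ₗ[k] H))) := by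
    have h1 : TensorProduct.map i (TensorProduct.map i (LinearMap.id : H →ₗ[k] H)) =
        TensorProduct.map i LinearMap.id ∘ₗ
          TensorProduct.map LinearMap.id (TensorProduct.map i LinearMap.id) := by
      rw [← TensorProduct.map_comp]
      rfl
    rw [h1]
    exact (map_id_injective hi).comp (id_map_injective (map_id_injective hi))
  ext h
  refine hinj ?_
  have h1 := congr($hs h)
  have h2 : TensorProduct.map i (TensorProduct.map i LinearMap.id) ∘ₗ
      (TensorProduct.assoc k E E H).toLinearMap = (TensorProduct.assoc k A A H).toLinearMap ∘ₗ
        TensorProduct.map (TensorProduct.map i i) LinearMap.id := by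
    ext
    simp
  have h3 : TensorProduct.map i LinearMap.id ∘ₗ (equalizer ρ₁ ρ₂).coact.toLinearMap =
      ρ₁.coact.toLinearMap ∘ₗ i := LinearMap.ext map_val_equalizer_coact
  have h2' (t) := congr($h2 t)
  simp only [LinearMap.comp_apply, map_map_apply, LinearMap.id_comp, LinearMap.comp_id] at h1 h2' ⊢
  rw [h2', h3, h1, map_map_apply, LinearMap.id_comp]

/-- If `Γ` lifts a translation map for two coactions, then it takes values in `E ⊗ E`, where `E` is
the subalgebra on which they agree, and lifts a translation map of `E`. -/
theorem IsTranslationLift.exists_equalizer {Γ : H →ₗ[k] A ⊗[k] A} (h₁ : ρ₁.IsTranslationLift Γ)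
    (h₂ : ρ₂.IsTranslationLift Γ) :
    ∃ Γ' : H →ₗ[k] AlgHom.equalizer ρ₁.coact ρ₂.coact ⊗[k] AlgHom.equalizer ρ₁.coact ρ₂.coact,
      TensorProduct.map (AlgHom.equalizer ρ₁.coact ρ₂.coact).val.toLinearMap
        (AlgHom.equalizer ρ₁.coact ρ₂.coact).val.toLinearMap ∘ₗ Γ' = Γ ∧
      (equalizer ρ₁ ρ₂).IsTranslationLift Γ' := by
  set E := AlgHom.equalizer ρ₁.coact ρ₂.coact
  set i : E →ₗ[k] A := E.val.toLinearMap
  have hi : Function.Injective i := Subtype.val_injective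
  have hinj : Function.Injective (TensorProduct.map i i) := by
    have h1 : TensorProduct.map i i =
        TensorProduct.map i LinearMap.id ∘ₗ TensorProduct.map LinearMap.id i := by
      rw [← TensorProduct.map_comp]
      rfl
    rw [h1]
    exact (map_id_injective hi).comp (id_map_injective hi)
  set d := ρ₁.coact.toLinearMap - ρ₂.coact.toLinearMap
  have hsub (s : H →ₗ[k] A ⊗[k] A) {θ : H →ₗ[k] H} (hs₁ : IsColinear ρ₁.coact.toLinearMap θ s)
      (hs₂ : IsColinear ρ₂.coact.toLinearMap θ s) (h : H) :
      TensorProduct.map LinearMap.id d (s h) = 0 := by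
    have h1 := congr($(hs₁.trans hs₂.symm) h)
    rw [map_id_sub, LinearMap.sub_apply, sub_eq_zero]
    exact h1
  have hmem (h : H) : Γ h ∈ LinearMap.range (TensorProduct.map i i) := by
    have hr := hsub Γ h₁.right_colinear h₂.right_colinear h
    have hl : TensorProduct.map d LinearMap.id (Γ h) = 0 := by
      have h1 := hsub _ h₁.left_colinear h₂.left_colinear h
      rw [swapLegs, LinearMap.comp_apply, LinearEquiv.coe_coe, TensorProduct.map_comm] at h1
      exact (LinearEquiv.map_eq_zero_iff _).1 h1
    obtain ⟨y, hy⟩ := exists_map_ker d d _ hl hr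
    set j : LinearMap.ker d →ₗ[k] E :=
      { toFun := fun a ↦ ⟨a, sub_eq_zero.1 a.2⟩
        map_add' := fun _ _ ↦ rfl
        map_smul' := fun _ _ ↦ rfl }
    refine ⟨TensorProduct.map j j y, ?_⟩
    rw [map_map_apply]
    exact hy
  set e := LinearEquiv.ofInjective _ hinj
  set Γ' : H →ₗ[k] E ⊗[k] E := e.symm.toLinearMap ∘ₗ Γ.codRestrict _ hmem
  have hΓ' : TensorProduct.map i i ∘ₗ Γ' = Γ :=
    LinearMap.ext fun h ↦ congrArg Subtype.val (e.apply_symm_apply ⟨_, hmem h⟩)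
  refine ⟨Γ', hΓ', isColinear_equalizer ?_, isColinear_equalizer ?_, ?_, hinj ?_⟩
  · exact hΓ'.symm ▸ h₁.right_colinear
  · have h1 : TensorProduct.map i i ∘ₗ swapLegs Γ' = swapLegs Γ := by
      rw [← hΓ']
      ext h
      simp [swapLegs, TensorProduct.map_comm]
    exact h1.symm ▸ h₁.left_colinear
  · ext h
    have h1 := congr($h₁.mul_eq h)
    rw [← hΓ'] at h1
    have h2 (t : E ⊗[k] E) : i (LinearMap.mul' k E t) =
        LinearMap.mul' k A (TensorProduct.map i i t) := by
      induction t using TensorProduct.induction_on with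
      | zero => simp
      | add y z hy hz => simp only [map_add, hy, hz]
      | tmul x y => simp [i]
    exact (h2 _).trans h1
  · have h1 := congr($hΓ' 1)
    rw [h₁.map_one] at h1
    refine h1.trans ?_
    simp [i]

theorem mem_coinvariants_equalizer (a : AlgHom.equalizer ρ₁.coact ρ₂.coact) :
    a ∈ (equalizer ρ₁ ρ₂).coinvariants ↔ ρ₁.coact a = (a : A) ⊗ₜ 1 := by
  rw [← map_val_equalizer_coact]
  exact (map_id_injective (M' := H) (f := (AlgHom.equalizer ρ₁.coact ρ₂.coact).val.toLinearMap)
    Subtype.val_injective).eq_iff.symm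

end Equalizer

/-! ### The enveloping extension -/

section Env

theorem envMap_range_le {R : Type x} [Ring R] [Algebra k R] {ι : R →ₐ[k] A}
    (hι : ι.range ≤ ρ.coinvariants) : (envMap ι).range ≤ (ρ.tensorLeft Aᵐᵒᵖ).coinvariants := by
  rintro _ ⟨t, rfl⟩
  change (ρ.tensorLeft Aᵐᵒᵖ).coact.toLinearMap (envMap ι t) = envMap ι t ⊗ₜ 1
  induction t using TensorProduct.induction_on with
  | zero => simp
  | add y z hy hz => simp only [map_add, hy, hz, TensorProduct.add_tmul]
  | tmul r s =>
    have hr : ρ.coact (ι r) = ι r ⊗ₜ[k] 1 := hι ⟨r, rfl⟩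
    rw [tensorLeft_coact]
    simp [envMap, hr]

variable [Coalgebra.IsCocomm k H]

/-- Since `S² = id`, the coinvariants of `A^op` are those of `A`. -/
theorem coact_eq_of_op {a : A}
    (h : ρ.op.coact (MulOpposite.op a) = MulOpposite.op a ⊗ₜ 1) : ρ.coact a = a ⊗ₜ 1 := by
  rw [op_coact_op] at h
  have h1 := congrArg (TensorProduct.map (MulOpposite.opLinearEquiv k).symm.toLinearMap
    (HopfAlgebra.antipode k)) h
  rw [map_map_apply, antipode_comp_antipode] at h1
  have h2 : (MulOpposite.opLinearEquiv k).symm.toLinearMap ∘ₗ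
      (MulOpposite.opLinearEquiv k).toLinearMap = (LinearMap.id : A →ₗ[k] A) := by
    ext
    simp
  rw [h2, TensorProduct.map_id] at h1
  simpa using h1

/-- Elements of `A ⊗ A^op` that are coinvariant in both factors lie in `B ⊗ B^op`. -/
theorem exists_envMap_eq (t : A ⊗[k] Aᵐᵒᵖ) (h₁ : (ρ.tensorLeft Aᵐᵒᵖ).coact t = t ⊗ₜ 1)
    (h₂ : (tensorRight A ρ.op).coact t = t ⊗ₜ 1) : ∃ b, envMap ρ.coinvariants.val b = t := by
  set d := ρ.coact.toLinearMap -
    (Algebra.TensorProduct.includeLeft : A →ₐ[k] A ⊗[k] H).toLinearMap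
  set d' := ρ.op.coact.toLinearMap -
    (Algebra.TensorProduct.includeLeft : Aᵐᵒᵖ →ₐ[k] Aᵐᵒᵖ ⊗[k] H).toLinearMap
  have h1 : TensorProduct.map d LinearMap.id t = 0 := by
    rw [map_sub_id, LinearMap.sub_apply, sub_eq_zero]
    refine (TensorProduct.rightComm k A H Aᵐᵒᵖ).injective ?_
    have h3 := congr($(tensorLeft_coact (ρ := ρ) (A' := Aᵐᵒᵖ)) t)
    refine h3.symm.trans (h₁.trans ?_)
    clear h₁ h₂ h3
    induction t using TensorProduct.induction_on with
    | zero => simp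
    | add y z hy hz => simp only [map_add, hy, hz, TensorProduct.add_tmul]
    | tmul x y => simp
  have h2 : TensorProduct.map LinearMap.id d' t = 0 := by
    rw [map_id_sub, LinearMap.sub_apply, sub_eq_zero]
    refine (TensorProduct.assoc k A Aᵐᵒᵖ H).symm.injective ?_
    refine Eq.trans h₂ ?_
    clear h₁ h₂ h1
    induction t using TensorProduct.induction_on with
    | zero => simp
    | add y z hy hz => simp only [map_add, ← hy, ← hz, TensorProduct.add_tmul]
    | tmul x y => simp
  obtain ⟨y, hy⟩ := exists_map_ker d d' t h1 h2
  set f : LinearMap.ker d →ₗ[k] ρ.coinvariants :=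
    { toFun := fun a ↦ ⟨a, sub_eq_zero.1 a.2⟩
      map_add' := fun _ _ ↦ rfl
      map_smul' := fun _ _ ↦ rfl }
  set g : LinearMap.ker d' →ₗ[k] ρ.coinvariantsᵐᵒᵖ :=
    { toFun := fun a ↦ MulOpposite.op ⟨MulOpposite.unop a, coact_eq_of_op (sub_eq_zero.1 a.2)⟩
      map_add' := fun _ _ ↦ rfl
      map_smul' := fun _ _ ↦ rfl }
  refine ⟨TensorProduct.map f g y, ?_⟩
  change TensorProduct.map ρ.coinvariants.val.toLinearMap
    (AlgHom.op ρ.coinvariants.val).toLinearMap (TensorProduct.map f g y) = t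
  rw [map_map_apply]
  exact hy

variable (ρ)

theorem envToCotensor_injective : Function.Injective ρ.envToCotensor := by
  refine Function.Injective.of_comp (f := Subtype.val) ?_
  have h1 : TensorProduct.map ρ.coinvariants.val.toLinearMap
      (AlgHom.op ρ.coinvariants.val).toLinearMap =
      TensorProduct.map ρ.coinvariants.val.toLinearMap LinearMap.id ∘ₗ
        TensorProduct.map LinearMap.id (AlgHom.op ρ.coinvariants.val).toLinearMap := by
    rw [← TensorProduct.map_comp]
    rfl
  change Function.Injective (TensorProduct.map ρ.coinvariants.val.toLinearMap
      (AlgHom.op ρ.coinvariants.val).toLinearMap)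
  rw [h1]
  refine (map_id_injective Subtype.val_injective).comp (id_map_injective ?_)
  intro a b hab
  exact MulOpposite.unop_injective (Subtype.val_injective (congrArg MulOpposite.unop hab))

theorem envToCotensor_range :
    ρ.envToCotensor.range = (ρ.cotensorCoaction ρ.op).coinvariants := by
  ext a
  refine Iff.trans ?_ (mem_coinvariants_equalizer a).symm
  constructor
  · rintro ⟨t, rfl⟩
    exact envMap_range_le (by rw [Subalgebra.range_val]) ⟨t, rfl⟩
  · intro h
    obtain ⟨b, hb⟩ := exists_envMap_eq (a : A ⊗[k] Aᵐᵒᵖ) h (a.2.symm.trans h)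
    exact ⟨b, Subtype.ext hb⟩

theorem cotensorToEnv_injective
    (hE : (ρ.cotensorCoaction ρ.op).IsFaithfullyFlatGalois ρ.envToCotensor) :
    Function.Injective (cotensorToEnv ρ) := by
  set ρ₁ := ρ.tensorLeft Aᵐᵒᵖ
  have hι := envMap_range_le (ρ := ρ) (ι := ρ.coinvariants.val) (by rw [Subalgebra.range_val])
  have hinj : Function.Injective (TensorProduct.map (ρ.cotensor ρ.op).val.toLinearMap
      (LinearMap.id : H →ₗ[k] H)) := map_id_injective Subtype.val_injective
  refine Function.Injective.of_comp (f := ρ₁.can _ hι) ?_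
  have h1 (t) : ρ₁.can _ hι (cotensorToEnv ρ t) =
      TensorProduct.map (ρ.cotensor ρ.op).val.toLinearMap LinearMap.id
        ((ρ.cotensorCoaction ρ.op).can _ hE.range_eq.le t) := by
    obtain ⟨t, rfl⟩ := Submodule.Quotient.mk_surjective _ t
    change ρ₁.canLin (TensorProduct.map (ρ.cotensor ρ.op).val.toLinearMap
      (ρ.cotensor ρ.op).val.toLinearMap t) = Algebra.TensorProduct.map (ρ.cotensor ρ.op).val
        (AlgHom.id k H) ((ρ.cotensorCoaction ρ.op).canLin t)
    induction t using TensorProduct.induction_on with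
    | zero => simp
    | add y z hy hz => simp only [map_add, hy, hz]
    | tmul x y =>
      rw [canLin_tmul, map_mul]
      refine congrArg₂ (· * ·) ?_ (map_val_equalizer_coact y).symm
      simp
  intro s t hst
  refine hE.can_bijective.1 (hinj ?_)
  rw [← h1, ← h1]
  exact hst

end Env

end ComoduleAlgebra

section Translation

variable {k : Type u} [Field k] {H : Type v} [Ring H] [HopfAlgebra k H]
  {A : Type w} [Ring A] [Algebra k A] {R : Type x} [Ring R] [Algebra k R] {ι : R →ₐ[k] A}

theorem shuffle_comp_map_mkQ :
    shuffle ι ∘ₗ TensorProduct.map (Submodule.mkQ _) (Submodule.mkQ _) =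
      Submodule.mkQ _ ∘ₗ (TensorProduct.tensorTensorTensorComm k A A Aᵐᵒᵖ Aᵐᵒᵖ).toLinearMap ∘ₗ
        TensorProduct.map LinearMap.id
          (TensorProduct.map (MulOpposite.opLinearEquiv k).toLinearMap
            (MulOpposite.opLinearEquiv k).toLinearMap ∘ₗ
              (TensorProduct.comm k A A).toLinearMap) := by
  refine TensorProduct.ext_fourfold' fun l r l' r' ↦ ?_
  rfl

theorem envTranslation_eq_mk {γ : H →ₗ[k] SelfTensor ι} {Γ : H →ₗ[k] A ⊗[k] A}
    (h : ∀ c, γ c = Submodule.Quotient.mk (Γ c)) (c : H) :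
    envTranslation γ c = Submodule.Quotient.mk (tensorLegs Γ
      (TensorProduct.map (MulOpposite.opLinearEquiv k).toLinearMap
        (MulOpposite.opLinearEquiv k).toLinearMap ∘ₗ swapLegs Γ) c) := by
  obtain rfl : γ = Submodule.mkQ _ ∘ₗ Γ := LinearMap.ext h
  have h1 := congr($(shuffle_comp_map_mkQ (ι := ι))
    (TensorProduct.map Γ Γ (Coalgebra.comul c)))
  simp only [LinearMap.comp_apply, map_map_apply, LinearMap.id_comp] at h1
  exact h1

end Translation

end HopfGalois

end

theorem proposition2p7 {k : Type*} [Field k] {H : Type*} [Ring H] [HopfAlgebra k H]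
    [Coalgebra.IsCocomm k H] {A : Type*} [Ring A] [Algebra k A]
    (ρ : HopfGalois.ComoduleAlgebra k H A)
    (hA : ρ.IsFaithfullyFlatGalois ρ.coinvariants.val) :
    ∃ hE : (ρ.cotensorCoaction ρ.op).IsFaithfullyFlatGalois ρ.envToCotensor,
      Function.Injective (HopfGalois.cotensorToEnv ρ) ∧
      ∀ h : H, HopfGalois.cotensorToEnv ρ (hE.translation h) =
        HopfGalois.envTranslation hA.translation h := by
  obtain ⟨Γ, hΓ⟩ := HopfGalois.ComoduleAlgebra.exists_isTranslationLift hA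
  obtain ⟨Γ', hΓΓ', hΓ'⟩ := (hΓ.tensorLeft hΓ.op).exists_equalizer (hΓ.tensorRight hΓ.op)
  have hE : (ρ.cotensorCoaction ρ.op).IsFaithfullyFlatGalois ρ.envToCotensor :=
    hΓ'.isFaithfullyFlatGalois ρ.envToCotensor_injective ρ.envToCotensor_range
  refine ⟨hE, ρ.cotensorToEnv_injective hE, fun h ↦ ?_⟩
  have h1 : hE.translation h = Submodule.Quotient.mk (Γ' h) := hΓ'.mk_eq hE h
  rw [h1, HopfGalois.envTranslation_eq_mk (hΓ.mk_eq hA), ← hΓΓ']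
  rfl
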